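/- For $q\in L^1(\mathbb R)$ and $\lambda\in\mathbb R$ consider the ZS–AKNS equation $\mathcal L\psi=\lambda\psi$ for $2\times2$ matrix-valued functions $\psi$ of $x\in\mathbb R$, where $$\mathcal L=i\sigma_3\frac{d}{dx}+\begin{pmatrix}0&-iq(x)\\ i\overline{q(x)}&0\end{pmatrix},\qquad \sigma_3=\begin{pmatrix}1&0\\0&-1\end{pmatrix};$$ a solution is a locally absolutely continuous $\psi$ satisfying the equation for almost every $x$. Let $$H^{0,1}(\mathbb R)=\{f\in L^2: xf\in L^2\},\qquad H^{1,1}(\mathbb R)=\{f\in L^2: f'\in L^2,\ xf\in L^2\},\qquad H^{1,1}_1(\mathbb R)=\{f\in H^{1,1}:\|f\|_{L^\infty}<1\},$$ where functions are complex-valued, $f'$ is the weak derivative, $\|f\|_{H^{0,1}}^2=\|f\|_{L^2}^2+\|xf\|_{L^2}^2$ and $\|f\|_{H^{1,1}}^2=\|f\|_{L^2}^2+\|f'\|_{L^2}^2+\|xf\|_{L^2}^2$; the norm of $L^1\cap L^2$ is $\|f\|_{L^1}+\|f\|_{L^2}$. Call a map $F$ between such spaces locally Lipschitz if for every $\rho>0$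 there is a $C$ with $\|F(q_1)-F(q_2)\|\le C\|q_1-q_2\|$ whenever $\|q_1\|,\|q_2\|\le\rho$. **Theorem.** For every $q\in L^1(\mathbb R)$ and $\lambda\in\mathbb R$ there are unique solutions $\Psi^{\pm}(x,\lambda)$ of $\mathcal L\psi=\lambda\psi$ with $\lim_{x\to\pm\infty}\Psi^\pm(x,\lambda)e^{i\lambda x\sigma_3}=I$, and a unique matrix $T(\lambda)$ with $\Psi^+(x,\lambda)=\Psi^-(x,\lambda)T(\lambda)$ for all $x$; it has the form $$T(\lambda)=\begin{pmatrix}a(\lambda)&\overline{b(\lambda)}\\ b(\lambda)&\overline{a(\lambda)}\end{pmatrix},\qquad |a(\lambda)|^2-|b(\lambda)|^2=1,$$ so that $r(\lambda)=-b(\lambda)/\overline{a(\lambda)}$ is well defined with $|r(\lambda)|<1$. The direct scattering map $q\mapsto r$ is locally Lipschitz from $H^{1,1}(\mathbb R)$ to $H^{1,1}_1(\mathbb R)$ (with the $H^{1,1}$ norm on the target). Moreover, it is locally Lipschitz 1. from $L^1(\mathbb R)$ to $L^\infty(\mathbb R)$, 2. from $L^1(\mathbb R)\cap L^2(\mathbb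 R)$ to $L^2(\mathbb R)$, 3. from $H^{1,1}(\mathbb R)$ to $H^{0,1}(\mathbb R)$, and 4. for $q\in H^{0,1}(\mathbb R)$ the function $r$ has a weak derivative $r'\in L^2(\mathbb R)$, and $q\mapsto r'$ is locally Lipschitz from $H^{0,1}(\mathbb R)$ to $L^2(\mathbb R)$. -/

import Mathlib

open MeasureTheory Filter Topology
open scoped ENNReal NNReal ContDiff

noncomputable section

namespace ZSAKNS

/-! ### Jost solutions and scattering data of the ZS-AKNS operator -/

/-- The third Pauli matrix. -/
def sigma3 : Matrix (Fin 2) (Fin 2) ℂ := !![1, 0; 0, -1]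

/-- The potential matrix `Q(x) = (0, -i q(x); i conj (q(x)), 0)`. -/
def potential (q : ℝ → ℂ) (x : ℝ) : Matrix (Fin 2) (Fin 2) ℂ :=
  !![0, -Complex.I * q x; Complex.I * star (q x), 0]

/-- The matrix exponential `exp (i x lam sigma3)`. -/
def phase (lam x : ℝ) : Matrix (Fin 2) (Fin 2) ℂ :=
  Matrix.diagonal ![Complex.exp (Complex.I * lam * x), Complex.exp (-(Complex.I * lam * x))]

/-- `psi` is a (Carathéodory) matrix solution of `L psi = lam psi`, where
`L = i sigma3 d/dx + Q(x)`: its entries are locally absolutely continuous, and the equation holds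
for almost every `x`. -/
def IsSolution (q : ℝ → ℂ) (lam : ℝ) (psi : ℝ → Matrix (Fin 2) (Fin 2) ℂ) : Prop :=
  (∀ i j : Fin 2, ∀ s t : ℝ, AbsolutelyContinuousOnInterval (fun x => psi x i j) s t) ∧
  ∀ᵐ x : ℝ, ∃ D : Matrix (Fin 2) (Fin 2) ℂ,
    (∀ i j : Fin 2, HasDerivAt (fun y => psi y i j) (D i j) x) ∧
    (Complex.I • sigma3) * D + potential q x * psi x = (lam : ℂ) • psi x

/-- The Jost solution normalized along the filter `l`: `l = atTop` gives `Psi⁺`, and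
`l = atBot` gives `Psi⁻`. -/
def IsJost (l : Filter ℝ) (q : ℝ → ℂ) (lam : ℝ) (psi : ℝ → Matrix (Fin 2) (Fin 2) ℂ) : Prop :=
  IsSolution q lam psi ∧ Tendsto (fun x => psi x * phase lam x) l (𝓝 1)

/-- `T` is a transition matrix at `lam`: `Psi⁺(x) = Psi⁻(x) T` for all `x`. -/
def IsTransition (q : ℝ → ℂ) (lam : ℝ) (T : Matrix (Fin 2) (Fin 2) ℂ) : Prop :=
  ∃ psiPlus psiMinus : ℝ → Matrix (Fin 2) (Fin 2) ℂ,
    IsJost atTop q lam psiPlus ∧ IsJost atBot q lam psiMinus ∧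
      ∀ x : ℝ, psiPlus x = psiMinus x * T

/-- The transition matrix `T(lam)`. -/
def transition (q : ℝ → ℂ) (lam : ℝ) : Matrix (Fin 2) (Fin 2) ℂ :=
  Classical.epsilon (IsTransition q lam)

/-- The scattering coefficient `a(lam)`, the `11` entry of `T(lam)`. -/
def coeffA (q : ℝ → ℂ) (lam : ℝ) : ℂ := transition q lam 0 0

/-- The scattering coefficient `b(lam)`, the `21` entry of `T(lam)`. -/
def coeffB (q : ℝ → ℂ) (lam : ℝ) : ℂ := transition q lam 1 0

/-- The direct scattering map `q ↦ r`, `r(lam) = - b(lam) / conj (a(lam))`. -/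
def reflection (q : ℝ → ℂ) (lam : ℝ) : ℂ := -coeffB q lam / star (coeffA q lam)

/-! ### Weak derivatives and weighted Sobolev spaces on the line

Functions represent their almost-everywhere classes. -/

/-- `g` is the weak (distributional) derivative of `f`. -/
def IsWeakDeriv (f g : ℝ → ℂ) : Prop :=
  LocallyIntegrable f ∧ LocallyIntegrable g ∧
    ∀ φ : ℝ → ℝ, ContDiff ℝ ∞ φ → HasCompactSupport φ →
      ∫ x, φ x • g x = -∫ x, deriv φ x • f x

/-- The weak derivative is unique up to null sets. -/
theorem IsWeakDeriv.ae_eq {f g g' : ℝ → ℂ} (h : IsWeakDeriv f g) (h' : IsWeakDeriv f g') :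
    g =ᵐ[volume] g' :=
  ae_eq_of_integral_contDiff_smul_eq h.2.1 h'.2.1 fun φ hφ hc =>
    (h.2.2 φ hφ hc).trans (h'.2.2 φ hφ hc).symm

open Classical in
/-- A representative of the weak derivative of `f` (`0` if `f` is not weakly differentiable). -/
def weakDeriv (f : ℝ → ℂ) : ℝ → ℂ :=
  if h : ∃ g, IsWeakDeriv f g then h.choose else 0

/-- If `f` is weakly differentiable, then `weakDeriv f` is its weak derivative. -/
theorem IsWeakDeriv.weakDeriv {f g : ℝ → ℂ} (h : IsWeakDeriv f g) :
    IsWeakDeriv f (weakDeriv f) := by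
  have h' : ∃ g, IsWeakDeriv f g := ⟨g, h⟩
  rw [ZSAKNS.weakDeriv, dif_pos h']
  exact h'.choose_spec

/-- Multiplication by the independent variable. -/
def mulX (f : ℝ → ℂ) : ℝ → ℂ := fun x => (x : ℂ) * f x

/-- The space `L¹`. -/
def L1 : Set (ℝ → ℂ) := {f | MemLp f 1}

/-- The space `L¹ ∩ L²`. -/
def L1L2 : Set (ℝ → ℂ) := {f | MemLp f 1 ∧ MemLp f 2}

/-- The space `H^{0,1}` of all `f ∈ L²` with `x f ∈ L²`. -/
def H01 : Set (ℝ → ℂ) := {f | MemLp f 2 ∧ MemLp (mulX f) 2}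

/-- The space `H^{1,1}` of all `f ∈ L²` with `f' ∈ L²` and `x f ∈ L²`. -/
def H11 : Set (ℝ → ℂ) :=
  {f | MemLp f 2 ∧ (∃ g, IsWeakDeriv f g ∧ MemLp g 2) ∧ MemLp (mulX f) 2}

/-- The subset `H^{1,1}_1` of all `f ∈ H^{1,1}` with `‖f‖_∞ < 1`. -/
def H11One : Set (ℝ → ℂ) := {f | f ∈ H11 ∧ eLpNorm f ∞ volume < 1}

/-- The `L^p` norm. -/
def normL (p : ℝ≥0∞) (f : ℝ → ℂ) : ℝ≥0∞ := eLpNorm f p volume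

/-- The norm of `L¹ ∩ L²`. -/
def normL1L2 (f : ℝ → ℂ) : ℝ≥0∞ := normL 1 f + normL 2 f

/-- The norm of `H^{0,1}`, `(‖f‖² + ‖x f‖²)^{1/2}`. -/
def normH01 (f : ℝ → ℂ) : ℝ≥0∞ := (normL 2 f ^ 2 + normL 2 (mulX f) ^ 2) ^ (1 / 2 : ℝ)

/-- The norm of `H^{1,1}`, `(‖f‖² + ‖f'‖² + ‖x f‖²)^{1/2}`. -/
def normH11 (f : ℝ → ℂ) : ℝ≥0∞ :=
  (normL 2 f ^ 2 + normL 2 (weakDeriv f) ^ 2 + normL 2 (mulX f) ^ 2) ^ (1 / 2 : ℝ)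

/-- `F` maps the normed space `X` (with norm `N`) into the subset `Y` of a space with norm `M`. It
is locally Lipschitz, with one constant on each bounded set: for every radius `ρ` there is a `C`
such that `‖F f - F g‖ ≤ C ‖f - g‖` whenever `‖f‖ ≤ ρ` and `‖g‖ ≤ ρ`. -/
def LocallyLipschitzMap (X : Set (ℝ → ℂ)) (N : (ℝ → ℂ) → ℝ≥0∞)
    (Y : Set (ℝ → ℂ)) (M : (ℝ → ℂ) → ℝ≥0∞) (F : (ℝ → ℂ) → (ℝ → ℂ)) : Prop :=
  (∀ f ∈ X, F f ∈ Y) ∧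
  ∀ ρ : ℝ≥0, ∃ C : ℝ≥0, ∀ f ∈ X, ∀ g ∈ X, N f ≤ ρ → N g ≤ ρ → M (F f - F g) ≤ C * N (f - g)

end ZSAKNS

end

/-!
Removing the free phase, the columns of a solution become pairs `(u, v)` with
`u' = q e^{2ilx} v`, `v' = conj q e^{-2ilx} u` (`isSolution_iff`). The column normalized to `(1, 0)`
at `+∞` is the bounded solution of a Volterra equation (`jostVec`), found by contraction in a norm
weighted by `exp (2 ∫_x^∞ |q|)`; the one at `-∞` comes from it by reflection in the origin
(`jostVecLeft`). The Wronskian of two columns is constant (`IsCol.wronskian_eq`). This gives the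
uniqueness of the Jost solutions, the form of `T`, the identity `|a|² - |b|² = 1`, and a formula for
`r` in terms of the values of the two normalized columns at the origin (`reflection_eq_wronR`).

For the estimates, write the Volterra equation as `v = (1, 0) + K_q v`. Here `K_q (1, 0)` is the
Fourier transform of a truncation of `q`, bounded in `L²` by Plancherel, and the solution operator of
the equation is bounded, uniformly on bounded sets of `L¹`, both pointwise and in `L²` (Gronwall and
Minkowski). Hence the columns at the origin depend on `q` in a Lipschitz way, and, what matters more,
their second differences over four potentials are controlled (`eLpNorm_jostVec_sub_sub_le`). These
bounds survive products and inverses (`Regular`), so they hold for `r` (`regular_wronR`).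

The derivative and the decay of `r` follow from second differences by covariance. Replacing `q` by
`e^{2ihx} q` replaces `r(l)` by `r(l + h)` (`wronR_modulate`), and replacing `q` by `q(· + h)`
replaces `r(l)` by `e^{2ilh} r(l)` (`wronR_translate`). The increment in `h` of `r(q₁) - r(q₂)`,
respectively of its modulation, is therefore a second difference of `q ↦ r` over `q₁`, `q₂` and their
modulations or translates, and it is at most `h` times the right hand side of the asserted Lipschitz
estimate. Weak compactness in `L²` turns this into a weak derivative in the first case
(`exists_isWeakDeriv_wronR_sub`), and Fatou's lemma into a bound of `l (r(q₁) - r(q₂))` in the second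
(`exists_eLpNorm_mulX_wronR_sub_le`). Two norms of potentials are needed, because an increment such as
`q(· + h) - q` is of order `h` only in `L²`: with `w = 1 + |x|`, increments are measured in the weak
norm `‖·‖₂ + ‖·/w‖₁` and the potentials themselves in the strong norm `‖·‖₁ + ‖w ·‖₂`. The loss of the
weight is compensated by the decay of `v - (1, 0)` in `L²` like `1 / w(x)` as `x → ∞`.
-/

/-! ### Absolutely continuous functions and tail integrals -/

/-- A function whose increments are dominated by those of an absolutely continuous function is
absolutely continuous. -/
theorem AbsolutelyContinuousOnInterval.of_dist_le {X Y : Type*} [PseudoMetricSpace X]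
    [PseudoMetricSpace Y] {f : ℝ → X} {g : ℝ → Y} {a b : ℝ}
    (hg : AbsolutelyContinuousOnInterval g a b) (K : ℝ)
    (h : ∀ s t, dist (f s) (f t) ≤ K * dist (g s) (g t)) :
    AbsolutelyContinuousOnInterval f a b := by
  unfold AbsolutelyContinuousOnInterval at hg ⊢
  refine squeeze_zero (fun E => Finset.sum_nonneg fun i _ => dist_nonneg) (fun E => ?_)
    (by simpa using hg.const_mul K)
  rw [Finset.mul_sum]
  exact Finset.sum_le_sum fun i _ => h _ _

namespace ZSAKNS

theorem absolutelyContinuousOnInterval_const {X : Type*} [PseudoMetricSpace X] (c : X) (s t : ℝ) :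
    AbsolutelyContinuousOnInterval (fun _ : ℝ => c) s t := by
  simpa [AbsolutelyContinuousOnInterval] using tendsto_const_nhds

/-- The integral of `f` over the half-line `(x, ∞)`. -/
noncomputable def tail {E : Type*} [NormedAddCommGroup E] [NormedSpace ℝ E]
    (f : ℝ → E) (x : ℝ) : E :=
  ∫ y in Set.Ioi x, f y

section Tail

variable {E : Type*} [NormedAddCommGroup E] [NormedSpace ℝ E] {f : ℝ → E}

theorem tail_eq_sub (hf : Integrable f) (c x : ℝ) :
    tail f x = tail f c - ∫ t in c..x, f t := by
  rw [tail, tail, ← intervalIntegral.integral_Ioi_sub_Ioi' hf.integrableOn hf.integrableOn]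
  abel

theorem dist_tail_le (hf : Integrable f) (s t : ℝ) :
    dist (tail f s) (tail f t) ≤ dist (tail (fun y => ‖f y‖) s) (tail (fun y => ‖f y‖) t) := by
  wlog hst : s ≤ t generalizing s t
  · rw [dist_comm, dist_comm (tail (fun y => ‖f y‖) s)]
    exact this t s (le_of_not_ge hst)
  rw [tail_eq_sub hf s t, tail_eq_sub hf.norm s t, dist_eq_norm, dist_eq_norm, sub_sub_cancel,
    sub_sub_cancel]
  exact (intervalIntegral.norm_integral_le_integral_norm hst).trans (le_abs_self _)

theorem absolutelyContinuousOnInterval_tail (hf : Integrable f) (s t : ℝ) :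
    AbsolutelyContinuousOnInterval (tail f) s t := by
  have h1 : AbsolutelyContinuousOnInterval (fun x => ∫ y in s..x, ‖f y‖) s t :=
    hf.norm.intervalIntegrable.absolutelyContinuousOnInterval_intervalIntegral (by simp)
  refine h1.of_dist_le 1 fun u v => ?_
  rw [one_mul]
  refine (dist_tail_le hf u v).trans (le_of_eq ?_)
  rw [tail_eq_sub hf.norm s u, tail_eq_sub hf.norm s v, dist_sub_left]

theorem continuous_tail (hf : Integrable f) : Continuous (tail f) := by
  have : tail f = fun x => tail f 0 - ∫ t in (0 : ℝ)..x, f t := funext (tail_eq_sub hf 0)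
  rw [this]
  exact continuous_const.sub (intervalIntegral.continuous_primitive
    (fun _ _ => hf.intervalIntegrable) 0)

theorem ae_hasDerivAt_tail [CompleteSpace E] (hf : Integrable f) :
    ∀ᵐ x, HasDerivAt (tail f) (-f x) x := by
  filter_upwards [_root_.LocallyIntegrable.ae_hasDerivAt_integral hf.locallyIntegrable] with x hx
  have : tail f = fun x => tail f 0 - ∫ t in (0 : ℝ)..x, f t := funext (tail_eq_sub hf 0)
  rw [this]
  exact (hx 0).const_sub _

theorem tendsto_tail_atTop : Tendsto (tail f) atTop (𝓝 0) :=
  tendsto_integral_Ioi_zero tendsto_id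

theorem norm_tail_le (x : ℝ) : ‖tail f x‖ ≤ tail (fun y => ‖f y‖) x :=
  norm_integral_le_integral_norm _

end Tail

theorem tail_norm_nonneg (q : ℝ → ℂ) (x : ℝ) : 0 ≤ tail (fun y => ‖q y‖) x :=
  integral_nonneg fun _ => norm_nonneg _

theorem tail_norm_le {q : ℝ → ℂ} (hq : Integrable q) (x : ℝ) :
    tail (fun y => ‖q y‖) x ≤ ∫ y, ‖q y‖ :=
  setIntegral_le_integral hq.norm (Eventually.of_forall fun _ => norm_nonneg _)

/-! ### The Volterra weight and Gronwall's inequality -/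

/-- The weight `exp (2 ∫_x^∞ |q|)`, relative to which integration against `|q|` over `(x, ∞)` is
a contraction with constant `1 / 2`. -/
noncomputable def weight (q : ℝ → ℂ) (x : ℝ) : ℝ := Real.exp (2 * tail (fun y => ‖q y‖) x)

theorem one_le_weight (q : ℝ → ℂ) (x : ℝ) : 1 ≤ weight q x :=
  Real.one_le_exp (by have := tail_norm_nonneg q x; positivity)

theorem weight_pos (q : ℝ → ℂ) (x : ℝ) : 0 < weight q x := Real.exp_pos _

theorem weight_le {q : ℝ → ℂ} (hq : Integrable q) (x : ℝ) :
    weight q x ≤ Real.exp (2 * ∫ y, ‖q y‖) :=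
  Real.exp_le_exp.2 (by have := tail_norm_le hq x; linarith)

theorem continuous_weight {q : ℝ → ℂ} (hq : Integrable q) : Continuous (weight q) :=
  Real.continuous_exp.comp (continuous_const.mul (continuous_tail hq.norm))

theorem integrable_norm_mul_weight {q : ℝ → ℂ} (hq : Integrable q) :
    Integrable fun y => ‖q y‖ * weight q y := by
  refine hq.norm.mul_bdd (c := Real.exp (2 * ∫ y, ‖q y‖))
    (continuous_weight hq).aestronglyMeasurable (Eventually.of_forall fun x => ?_)
  rw [Real.norm_of_nonneg (weight_pos q x).le]
  exact weight_le hq x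

/-- Both sides have derivative `-|q| * weight q` and tend to `0` at `+∞`. -/
theorem tail_norm_mul_weight {q : ℝ → ℂ} (hq : Integrable q) (x : ℝ) :
    tail (fun y => ‖q y‖ * weight q y) x = (weight q x - 1) / 2 := by
  set g := fun y => ‖q y‖ * weight q y
  have hg : Integrable g := integrable_norm_mul_weight hq
  -- The difference of the two sides is absolutely continuous with vanishing derivative.
  set F : ℝ → ℝ := fun x => weight q x - 2 * tail g x
  have hac : ∀ s t, AbsolutelyContinuousOnInterval F s t := by
    intro s t
    have h1 : AbsolutelyContinuousOnInterval (weight q) s t := by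
      refine (absolutelyContinuousOnInterval_tail hq.norm s t).of_dist_le
        (2 * Real.exp (2 * ∫ y, ‖q y‖)) fun u v => ?_
      have := Convex.norm_image_sub_le_of_norm_hasDerivWithin_le
        (f := fun z : ℝ => Real.exp (2 * z)) (f' := fun z => Real.exp (2 * z) * (2 * 1))
        (s := Set.Iic (∫ y, ‖q y‖)) (C := 2 * Real.exp (2 * ∫ y, ‖q y‖))
        (fun z _ => (((hasDerivAt_id z).const_mul 2).exp).hasDerivWithinAt)
        (fun z hz => by
          rw [Real.norm_of_nonneg (by positivity)]
          have : Real.exp (2 * z) ≤ Real.exp (2 * ∫ y, ‖q y‖) :=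
            Real.exp_le_exp.2 (by have := Set.mem_Iic.1 hz; linarith)
          linarith)
        (convex_Iic _) (tail_norm_le hq v) (tail_norm_le hq u)
      simpa [dist_eq_norm, weight] using this
    exact h1.sub ((absolutelyContinuousOnInterval_tail hg s t).const_mul 2)
  have hder : ∀ᵐ x, HasDerivAt F 0 x := by
    filter_upwards [ae_hasDerivAt_tail hq.norm, ae_hasDerivAt_tail hg] with x h1 h2
    convert! ((h1.const_mul 2).exp).sub (h2.const_mul 2) using 1
    simp only [g, weight]
    ring
  have hlim : Tendsto F atTop (𝓝 1) := by
    have h1 : Tendsto (weight q) atTop (𝓝 1) := by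
      have := (Real.continuous_exp.tendsto (2 * 0)).comp
        ((tendsto_tail_atTop (f := fun y => ‖q y‖)).const_mul 2)
      rwa [mul_zero, Real.exp_zero] at this
    simpa using h1.sub ((tendsto_tail_atTop (f := g)).const_mul 2)
  have hF : F x = 1 := by
    refine tendsto_nhds_unique (tendsto_const_nhds.congr' ?_) hlim
    filter_upwards with t
    obtain ⟨C, hC⟩ := (hac x t).const_of_ae_hasDerivAt_zero (hder.mono fun _ h _ => h)
    rw [hC x (by simp), hC t (by simp)]
  simp only [F] at hF
  linarith

/-- Integration against `|q|` over half-lines contracts the weight by the factor `1 / 2`. -/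
theorem lintegral_enorm_mul_weight_le {q : ℝ → ℂ} (hq : Integrable q) (x : ℝ) :
    ∫⁻ y in Set.Ioi x, ‖q y‖ₑ * ENNReal.ofReal (weight q y) ≤ ENNReal.ofReal (weight q x) / 2 := by
  have h1 : ∫⁻ y in Set.Ioi x, ‖q y‖ₑ * ENNReal.ofReal (weight q y)
      = ENNReal.ofReal (tail (fun y => ‖q y‖ * weight q y) x) := by
    rw [tail, ofReal_integral_eq_lintegral_ofReal (integrable_norm_mul_weight hq).integrableOn
      (Eventually.of_forall fun y => mul_nonneg (norm_nonneg _) (weight_pos q y).le)]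
    refine lintegral_congr fun y => ?_
    rw [ENNReal.ofReal_mul (norm_nonneg _), ofReal_norm]
  rw [h1, tail_norm_mul_weight hq]
  calc _ ≤ ENNReal.ofReal (weight q x / 2) := ENNReal.ofReal_le_ofReal (by linarith)
    _ = _ := by rw [ENNReal.ofReal_div_of_pos (by norm_num)]; simp

/-- Gronwall's inequality with a constant inhomogeneity, for a bounded (possibly non-measurable)
function. -/
theorem le_mul_weight_of_le_const_add_lintegral {q : ℝ → ℂ} (hq : Integrable q) {s : ℝ → ℝ≥0∞}
    {M H : ℝ≥0∞} (hM : M ≠ ⊤) (x₀ : ℝ) (hsM : ∀ x, s x ≤ M)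
    (hs : ∀ x, x₀ ≤ x → s x ≤ H + ∫⁻ y in Set.Ioi x, ‖q y‖ₑ * s y) :
    s x₀ ≤ 2 * H * ENNReal.ofReal (weight q x₀) := by
  set W : ℝ → ℝ≥0∞ := fun x => ENNReal.ofReal (weight q x)
  have hW1 : ∀ x, 1 ≤ W x := fun x => by
    rw [← ENNReal.ofReal_one]; exact ENNReal.ofReal_le_ofReal (one_le_weight q x)
  have hW0 : ∀ x, W x ≠ 0 := fun x => (lt_of_lt_of_le one_pos (hW1 x)).ne'
  have hWt : ∀ x, W x ≠ ⊤ := fun x => ENNReal.ofReal_ne_top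
  -- The supremum of `s / W` on `[x₀, ∞)` satisfies `K ≤ H + K / 2`.
  set K : ℝ≥0∞ := ⨆ x : Set.Ici x₀, s x / W x
  have hKM : K ≤ M := iSup_le fun x =>
    (ENNReal.div_le_of_le_mul (by
      calc s x ≤ M * 1 := by rw [mul_one]; exact hsM x
        _ ≤ M * W x := by gcongr; exact hW1 _))
  have hKt : K ≠ ⊤ := ne_top_of_le_ne_top hM hKM
  have hsK : ∀ x, x₀ ≤ x → s x ≤ K * W x := fun x hx => by
    have : s x / W x ≤ K := le_iSup (fun x : Set.Ici x₀ => s x / W x) ⟨x, hx⟩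
    rwa [ENNReal.div_le_iff (hW0 x) (hWt x)] at this
  have hK : K ≤ H + K / 2 := by
    refine iSup_le fun ⟨x, hx⟩ => ?_
    rw [ENNReal.div_le_iff (hW0 x) (hWt x)]
    calc s x ≤ H + ∫⁻ y in Set.Ioi x, ‖q y‖ₑ * s y := hs x hx
      _ ≤ H + ∫⁻ y in Set.Ioi x, K * (‖q y‖ₑ * W y) := by
          gcongr H + ?_
          refine setLIntegral_mono' measurableSet_Ioi fun y hy => ?_
          calc ‖q y‖ₑ * s y ≤ ‖q y‖ₑ * (K * W y) := by
                gcongr; exact hsK y (le_trans hx (le_of_lt hy))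
            _ = _ := by ring
      _ = H + K * ∫⁻ y in Set.Ioi x, ‖q y‖ₑ * W y := by rw [lintegral_const_mul' _ _ hKt]
      _ ≤ H * W x + K * (W x / 2) := by
          gcongr
          · exact le_mul_of_one_le_right' (hW1 x)
          · exact lintegral_enorm_mul_weight_le hq x
      _ = (H + K / 2) * W x := by rw [add_mul, div_eq_mul_inv, div_eq_mul_inv]; ring
  have hK2 : K ≤ 2 * H := by
    by_cases hH : H = ⊤
    · simp [hH]
    lift K to ℝ≥0 using hKt with K' hK'
    lift H to ℝ≥0 using hH with H'
    have h3 : K' ≤ H' + K' / 2 := by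
      have : ((H' : ℝ≥0∞) + K' / 2) = ((H' + K' / 2 : ℝ≥0) : ℝ≥0∞) := by
        push_cast; simp
      rw [this] at hK
      exact_mod_cast hK
    have h4 : K' ≤ 2 * H' := by
      rw [← NNReal.coe_le_coe] at h3 ⊢
      push_cast at h3 ⊢
      linarith
    exact_mod_cast h4
  calc s x₀ ≤ K * W x₀ := hsK x₀ le_rfl
    _ ≤ _ := by gcongr

/-- The constant `2 exp (2 ‖q‖₁)` in Gronwall's inequality. -/
noncomputable def gronwallConst (q : ℝ → ℂ) : ℝ≥0∞ :=
  2 * ENNReal.ofReal (Real.exp (2 * ∫ y, ‖q y‖))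

/-- Gronwall's inequality with a variable inhomogeneity. -/
theorem le_add_lintegral_of_le_add_lintegral {q : ℝ → ℂ} (hq : Integrable q) {s h : ℝ → ℝ≥0∞}
    {M : ℝ≥0∞} (hM : M ≠ ⊤) (hsM : ∀ x, s x ≤ M) (hh : AEMeasurable h)
    (hs : ∀ x, s x ≤ h x + ∫⁻ y in Set.Ioi x, ‖q y‖ₑ * s y) (x : ℝ) :
    s x ≤ h x + gronwallConst q * ∫⁻ y in Set.Ioi x, ‖q y‖ₑ * h y := by
  -- The integral term `t` satisfies the inequality with the constant inhomogeneity `∫ |q| h`.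
  set t : ℝ → ℝ≥0∞ := fun x => ∫⁻ y in Set.Ioi x, ‖q y‖ₑ * s y
  have hqm : AEMeasurable fun y => ‖q y‖ₑ := hq.aestronglyMeasurable.enorm
  have htM : ∀ x, t x ≤ M * ∫⁻ y, ‖q y‖ₑ := fun x => by
    rw [← lintegral_const_mul' _ _ hM]
    refine (setLIntegral_le_lintegral _ _).trans (lintegral_mono fun y => ?_)
    rw [mul_comm]
    gcongr
    exact hsM y
  have h1 : t x ≤ 2 * (∫⁻ y in Set.Ioi x, ‖q y‖ₑ * h y) * ENNReal.ofReal (weight q x) := by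
    refine le_mul_weight_of_le_const_add_lintegral hq
      (ENNReal.mul_ne_top hM hq.hasFiniteIntegral.ne) x htM fun z hz => ?_
    calc t z ≤ ∫⁻ y in Set.Ioi z, (‖q y‖ₑ * h y + ‖q y‖ₑ * t y) := by
          refine lintegral_mono fun y => ?_
          rw [← mul_add]
          gcongr
          exact hs y
      _ = (∫⁻ y in Set.Ioi z, ‖q y‖ₑ * h y) + ∫⁻ y in Set.Ioi z, ‖q y‖ₑ * t y :=
          lintegral_add_left' (hqm.mul hh).restrict _
      _ ≤ _ := by
          gcongr
  refine (hs x).trans ?_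
  gcongr h x + ?_
  refine h1.trans ?_
  rw [gronwallConst, mul_right_comm]
  gcongr
  exact weight_le hq x

/-! ### The Volterra operator of the Zakharov-Shabat system -/

/-- The off-diagonal coupling `-A v`, where `A = (0, z e^{2iθ}; conj z e^{-2iθ}, 0)`. -/
noncomputable def coupling (z : ℂ) (θ : ℝ) (v : ℂ × ℂ) : ℂ × ℂ :=
  (-(z * Complex.exp (2 * Complex.I * θ) * v.2),
    -(star z * Complex.exp (-(2 * Complex.I * θ)) * v.1))

theorem norm_exp_two_I_mul (θ : ℝ) : ‖Complex.exp (2 * Complex.I * θ)‖ = 1 := by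
  rw [show (2 * Complex.I * θ : ℂ) = ((2 * θ : ℝ) : ℂ) * Complex.I by push_cast; ring]
  exact Complex.norm_exp_ofReal_mul_I _

theorem norm_exp_neg_two_I_mul (θ : ℝ) : ‖Complex.exp (-(2 * Complex.I * θ))‖ = 1 := by
  rw [Complex.exp_neg, norm_inv, norm_exp_two_I_mul, inv_one]

theorem norm_coupling (z : ℂ) (θ : ℝ) (v : ℂ × ℂ) : ‖coupling z θ v‖ = ‖z‖ * ‖v‖ := by
  simp only [coupling, Prod.norm_def, norm_neg, norm_mul, norm_exp_two_I_mul,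
    norm_exp_neg_two_I_mul, norm_star, mul_one]
  rw [max_comm, mul_max_of_nonneg _ _ (norm_nonneg z)]

theorem coupling_sub (z : ℂ) (θ : ℝ) (v w : ℂ × ℂ) :
    coupling z θ (v - w) = coupling z θ v - coupling z θ w := by
  ext <;> simp [coupling] <;> ring

theorem sub_coupling (z z' : ℂ) (θ : ℝ) (v : ℂ × ℂ) :
    coupling (z - z') θ v = coupling z θ v - coupling z' θ v := by
  ext <;> simp [coupling] <;> ring

theorem continuous_coupling :
    Continuous fun p : ℂ × ℝ × (ℂ × ℂ) => coupling p.1 p.2.1 p.2.2 := by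
  unfold coupling
  fun_prop

/-- Bounded, jointly continuous functions of position and spectral parameter. -/
structure BddCont (v : ℝ → ℝ → ℂ × ℂ) : Prop where
  cont : Continuous fun p : ℝ × ℝ => v p.1 p.2
  bdd : ∃ C : ℝ, ∀ x l, ‖v x l‖ ≤ C

theorem BddCont.sub {v w : ℝ → ℝ → ℂ × ℂ} (hv : BddCont v) (hw : BddCont w) :
    BddCont (v - w) := by
  obtain ⟨C, hC⟩ := hv.bdd
  obtain ⟨D, hD⟩ := hw.bdd
  exact ⟨hv.cont.sub hw.cont, C + D, fun x l =>
    (norm_sub_le _ _).trans (add_le_add (hC x l) (hD x l))⟩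

theorem BddCont.add {v w : ℝ → ℝ → ℂ × ℂ} (hv : BddCont v) (hw : BddCont w) :
    BddCont (v + w) := by
  obtain ⟨C, hC⟩ := hv.bdd
  obtain ⟨D, hD⟩ := hw.bdd
  exact ⟨hv.cont.add hw.cont, C + D, fun x l =>
    (norm_add_le _ _).trans (add_le_add (hC x l) (hD x l))⟩

theorem BddCont.const (c : ℂ × ℂ) : BddCont fun _ _ => c :=
  ⟨continuous_const, ‖c‖, fun _ _ => le_rfl⟩

theorem BddCont.continuous_left {v : ℝ → ℝ → ℂ × ℂ} (hv : BddCont v) (l : ℝ) :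
    Continuous fun x => v x l :=
  hv.cont.comp (continuous_id.prodMk continuous_const)

theorem BddCont.continuous_right {v : ℝ → ℝ → ℂ × ℂ} (hv : BddCont v) (x : ℝ) :
    Continuous (v x) :=
  hv.cont.comp (continuous_const.prodMk continuous_id)

/-- The Volterra operator `v ↦ ∫_x^∞ coupling (q y) (lam y) (v(y, lam)) dy`. -/
noncomputable def volterra (q : ℝ → ℂ) (v : ℝ → ℝ → ℂ × ℂ) (x l : ℝ) : ℂ × ℂ :=
  tail (fun y => coupling (q y) (l * y) (v y l)) x

theorem integrable_coupling {q : ℝ → ℂ} (hq : Integrable q) {v : ℝ → ℝ → ℂ × ℂ}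
    (hv : BddCont v) (l : ℝ) : Integrable fun y => coupling (q y) (l * y) (v y l) := by
  obtain ⟨C, hC⟩ := hv.bdd
  refine (hq.norm.mul_const C).mono' ?_ (Eventually.of_forall fun y => ?_)
  · have h1 : AEStronglyMeasurable (fun y : ℝ => (q y, l * y, v y l)) volume :=
      hq.aestronglyMeasurable.prodMk (Continuous.aestronglyMeasurable
        ((continuous_const.mul continuous_id).prodMk (hv.continuous_left l)))
    exact Continuous.comp_aestronglyMeasurable
      (g := fun p : ℂ × ℝ × (ℂ × ℂ) => coupling p.1 p.2.1 p.2.2)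
      (f := fun y : ℝ => (q y, l * y, v y l)) continuous_coupling h1
  · rw [norm_coupling]
    gcongr
    exact hC y l

theorem enorm_volterra_le (q : ℝ → ℂ) (v : ℝ → ℝ → ℂ × ℂ) (x l : ℝ) :
    ‖volterra q v x l‖ₑ ≤ ∫⁻ y in Set.Ioi x, ‖q y‖ₑ * ‖v y l‖ₑ := by
  refine (enorm_integral_le_lintegral_enorm _).trans (le_of_eq (lintegral_congr fun y => ?_))
  rw [← ofReal_norm, norm_coupling, ENNReal.ofReal_mul (norm_nonneg _), ofReal_norm,
    ofReal_norm]

theorem BddCont.volterra {q : ℝ → ℂ} (hq : Integrable q) {v : ℝ → ℝ → ℂ × ℂ} (hv : BddCont v) :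
    BddCont (volterra q v) := by
  obtain ⟨C, hC⟩ := hv.bdd
  refine ⟨?_, ∫ y, ‖q y‖ * C, fun x l => ?_⟩
  · rw [continuous_iff_continuousAt]
    rintro ⟨x, l⟩
    have hrw : (fun p : ℝ × ℝ => ZSAKNS.volterra q v p.1 p.2) = fun p : ℝ × ℝ => ∫ y,
        (Set.Ioi p.1).indicator (fun y => coupling (q y) (p.2 * y) (v y p.2)) y := by
      funext p
      rw [integral_indicator measurableSet_Ioi]
      rfl
    rw [hrw]
    refine continuousAt_of_dominated (bound := fun y => ‖q y‖ * C)
      (Eventually.of_forall fun p => ?_) (Eventually.of_forall fun p =>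
        Eventually.of_forall fun y => ?_) (hq.norm.mul_const C) ?_
    · exact (integrable_coupling hq hv p.2).aestronglyMeasurable.indicator measurableSet_Ioi
    · refine (norm_indicator_le_norm_self _ _).trans ?_
      rw [norm_coupling]
      gcongr
      exact hC y _
    · have hne : ∀ᵐ y : ℝ, y ≠ x := by simp [ae_iff]
      filter_upwards [hne] with y hy
      have hc : Continuous fun p : ℝ × ℝ => coupling (q y) (p.2 * y) (v y p.2) :=
        continuous_coupling.comp (continuous_const.prodMk ((continuous_snd.mul
          continuous_const).prodMk ((hv.continuous_right y).comp continuous_snd)))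
      rcases lt_or_gt_of_ne hy with h | h
      · refine (continuousAt_const (y := (0 : ℂ × ℂ))).congr ?_
        filter_upwards [continuous_fst.continuousAt.eventually (lt_mem_nhds h)] with p hp
        rw [Set.indicator_of_notMem (by simpa using (le_of_lt hp))]
      · refine hc.continuousAt.congr ?_
        filter_upwards [continuous_fst.continuousAt.eventually (gt_mem_nhds h)] with p hp
        rw [Set.indicator_of_mem (by simpa using hp)]
  · refine (norm_tail_le x).trans ?_
    calc tail (fun y => ‖coupling (q y) (l * y) (v y l)‖) x
        ≤ ∫ y, ‖coupling (q y) (l * y) (v y l)‖ :=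
          setIntegral_le_integral (integrable_coupling hq hv l).norm
            (Eventually.of_forall fun _ => norm_nonneg _)
      _ ≤ ∫ y, ‖q y‖ * C := by
          refine integral_mono (integrable_coupling hq hv l).norm (hq.norm.mul_const C) fun y => ?_
          simp only [norm_coupling]
          gcongr
          exact hC y l

theorem volterra_sub {q : ℝ → ℂ} (hq : Integrable q) {v w : ℝ → ℝ → ℂ × ℂ} (hv : BddCont v)
    (hw : BddCont w) : volterra q (v - w) = volterra q v - volterra q w := by
  funext x l
  simp only [volterra, tail, Pi.sub_apply, coupling_sub]
  exact integral_sub (integrable_coupling hq hv l).integrableOn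
    (integrable_coupling hq hw l).integrableOn

theorem sub_volterra {q q' : ℝ → ℂ} (hq : Integrable q) (hq' : Integrable q')
    {v : ℝ → ℝ → ℂ × ℂ} (hv : BddCont v) :
    volterra (q - q') v = volterra q v - volterra q' v := by
  funext x l
  simp only [volterra, tail, Pi.sub_apply, sub_coupling]
  exact integral_sub (integrable_coupling hq hv l).integrableOn
    (integrable_coupling hq' hv l).integrableOn

/-- Bounded solutions of the inhomogeneous Volterra equation are controlled pointwise by the
inhomogeneity. -/
theorem enorm_le_of_eq_add_volterra {q : ℝ → ℂ} (hq : Integrable q) {v f : ℝ → ℝ → ℂ × ℂ}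
    (hv : BddCont v) (hf : BddCont f) (h : v = f + volterra q v) (x l : ℝ) :
    ‖v x l‖ₑ ≤ ‖f x l‖ₑ + gronwallConst q * ∫⁻ y in Set.Ioi x, ‖q y‖ₑ * ‖f y l‖ₑ := by
  obtain ⟨C, hC⟩ := hv.bdd
  refine le_add_lintegral_of_le_add_lintegral hq (M := ENNReal.ofReal C) (s := fun x => ‖v x l‖ₑ)
    (h := fun x => ‖f x l‖ₑ) ENNReal.ofReal_ne_top (fun x => ?_)
    (hf.continuous_left l).enorm.aemeasurable (fun x => ?_) x
  · rw [← ofReal_norm]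
    exact ENNReal.ofReal_le_ofReal (hC x l)
  · calc ‖v x l‖ₑ = ‖f x l + volterra q v x l‖ₑ := by
          conv_lhs => rw [h]
          rfl
      _ ≤ ‖f x l‖ₑ + ‖volterra q v x l‖ₑ := enorm_add_le _ _
      _ ≤ _ := by gcongr; exact enorm_volterra_le q v x l

/-- The Volterra equation with constant inhomogeneity has a solution that is bounded and jointly
continuous in position and spectral parameter. -/
theorem exists_eq_add_volterra {q : ℝ → ℂ} (hq : Integrable q) (c : ℂ × ℂ) :
    ∃ v, BddCont v ∧ v = (fun _ _ => c) + volterra q v := by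
  classical
  let B := BoundedContinuousFunction (ℝ × ℝ) (ℂ × ℂ)
  have hW := continuous_weight hq
  -- Conjugating by the weight turns the Volterra operator into a contraction.
  let lift : B → ℝ → ℝ → ℂ × ℂ := fun v x l => weight q x • v (x, l)
  have hlift : ∀ v, BddCont (lift v) := fun v =>
    ⟨(hW.comp continuous_fst).smul v.continuous, Real.exp (2 * ∫ y, ‖q y‖) * ‖v‖, fun x l => by
      rw [norm_smul, Real.norm_of_nonneg (weight_pos q x).le]
      gcongr
      · exact weight_le hq x
      · exact v.norm_coe_le_norm _⟩
  have hrhs : ∀ v, BddCont ((fun _ _ => c) + volterra q (lift v)) := fun v =>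
    (BddCont.const c).add ((hlift v).volterra hq)
  let T : B → B := fun v => BoundedContinuousFunction.ofNormedAddCommGroup
    (fun p : ℝ × ℝ => (weight q p.1)⁻¹ • (c + volterra q (lift v) p.1 p.2))
    (((hW.comp continuous_fst).inv₀ fun p => (weight_pos q p.1).ne').smul (hrhs v).cont)
    (hrhs v).bdd.choose (fun p => by
      rw [norm_smul, norm_inv, Real.norm_of_nonneg (weight_pos q p.1).le]
      have h1 := (hrhs v).bdd.choose_spec p.1 p.2
      refine le_trans ?_ h1
      exact mul_le_of_le_one_left (norm_nonneg _) (inv_le_one_of_one_le₀ (one_le_weight q p.1)))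
  have hTapp : ∀ v p, T v p = (weight q p.1)⁻¹ • (c + volterra q (lift v) p.1 p.2) :=
    fun v p => rfl
  have hT : ContractingWith (1 / 2 : ℝ≥0) T := by
    refine ⟨by rw [← NNReal.coe_lt_coe]; norm_num, LipschitzWith.of_dist_le_mul fun v w => ?_⟩
    refine (BoundedContinuousFunction.dist_le (by positivity)).2 fun p => ?_
    have h1 : T v p - T w p = (weight q p.1)⁻¹ • volterra q (lift v - lift w) p.1 p.2 := by
      rw [volterra_sub hq (hlift v) (hlift w)]
      rw [hTapp, hTapp, ← smul_sub, add_sub_add_left_eq_sub]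
      rfl
    rw [dist_eq_norm, h1, norm_smul, norm_inv, Real.norm_of_nonneg (weight_pos q p.1).le]
    rw [inv_mul_le_iff₀ (weight_pos q p.1)]
    have h2 : ‖volterra q (lift v - lift w) p.1 p.2‖
        ≤ tail (fun y => dist v w * (‖q y‖ * weight q y)) p.1 := by
      refine (norm_tail_le p.1).trans (setIntegral_mono
        (integrable_coupling hq ((hlift v).sub (hlift w)) p.2).norm.integrableOn
        ((integrable_norm_mul_weight hq).const_mul _).integrableOn fun y => ?_)
      simp only [norm_coupling, Pi.sub_apply, lift, ← smul_sub, norm_smul]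
      rw [Real.norm_of_nonneg (weight_pos q y).le, ← dist_eq_norm]
      have := BoundedContinuousFunction.dist_coe_le_dist (f := v) (g := w) (y, p.2)
      calc ‖q y‖ * (weight q y * dist (v (y, p.2)) (w (y, p.2)))
          ≤ ‖q y‖ * (weight q y * dist v w) := by
            have := (weight_pos q y).le; gcongr
        _ = _ := by ring
    refine h2.trans ?_
    have h3 : tail (fun y => dist v w * (‖q y‖ * weight q y)) p.1
        = dist v w * ((weight q p.1 - 1) / 2) := by
      rw [← tail_norm_mul_weight hq, tail, tail, integral_const_mul]
    rw [h3]
    push_cast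
    nlinarith [dist_nonneg (x := v) (y := w)]
  refine ⟨lift (hT.fixedPoint T), hlift _, ?_⟩
  funext x l
  have h1 := hT.fixedPoint_isFixedPt
  calc weight q x • (hT.fixedPoint T) (x, l) = weight q x • (T (hT.fixedPoint T)) (x, l) := by
        rw [h1.eq]
    _ = c + volterra q (lift (hT.fixedPoint T)) x l := by
        rw [hTapp, smul_inv_smul₀ (weight_pos q x).ne']
    _ = _ := rfl

/-! ### Two facts about `L²` norms: Minkowski's integral inequality and Plancherel's bound -/

section L2

variable {α : Type*} [MeasurableSpace α] {μ : Measure α}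

theorem eLpNorm_two_eq {ε : Type*} [ENorm ε] (f : α → ε) :
    eLpNorm f 2 μ = (∫⁻ x, ‖f x‖ₑ ^ 2 ∂μ) ^ (1 / 2 : ℝ) := by
  rw [eLpNorm_eq_lintegral_rpow_enorm_toReal (by norm_num) (by norm_num)]
  simp

theorem eLpNorm_two_sq {ε : Type*} [ENorm ε] (f : α → ε) :
    eLpNorm f 2 μ ^ 2 = ∫⁻ x, ‖f x‖ₑ ^ 2 ∂μ := by
  rw [eLpNorm_two_eq, ← ENNReal.rpow_natCast, ← ENNReal.rpow_mul]
  simp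

theorem lintegral_mul_le_eLpNorm_two {f g : α → ℝ≥0∞} (hf : AEMeasurable f μ)
    (hg : AEMeasurable g μ) : ∫⁻ x, f x * g x ∂μ ≤ eLpNorm f 2 μ * eLpNorm g 2 μ := by
  have := ENNReal.lintegral_mul_le_Lp_mul_Lq μ (p := 2) (q := 2)
    ((Real.holderConjugate_iff).2 ⟨by norm_num, by norm_num⟩) hf hg
  simpa [eLpNorm_two_eq] using this

theorem eLpNorm_two_const_mul {c : ℝ≥0∞} (hc : c ≠ ⊤) (f : α → ℝ≥0∞) :
    eLpNorm (fun x => c * f x) 2 μ = c * eLpNorm f 2 μ := by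
  simp only [eLpNorm_two_eq, enorm_eq_self, mul_pow]
  rw [lintegral_const_mul' _ _ (ENNReal.pow_ne_top hc), ENNReal.mul_rpow_of_nonneg _ _ (by norm_num),
    ← ENNReal.rpow_natCast, ← ENNReal.rpow_mul]
  simp

/-- Minkowski's integral inequality in `L²`. -/
theorem eLpNorm_lintegral_mul_le {β : Type*} [MeasurableSpace β] {ν : Measure β} [SFinite μ]
    [SFinite ν] {k : β → ℝ≥0∞} (hk : AEMeasurable k ν) {g : β → α → ℝ≥0∞}
    (hg : Measurable fun p : β × α => g p.1 p.2) :
    eLpNorm (fun l => ∫⁻ y, k y * g y l ∂ν) 2 μ ≤ ∫⁻ y, k y * eLpNorm (g y) 2 μ ∂ν := by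
  wlog hkm : Measurable k generalizing k
  · have := this hk.measurable_mk.aemeasurable hk.measurable_mk
    have h1 : ∀ h : β → ℝ≥0∞, ∫⁻ y, k y * h y ∂ν = ∫⁻ y, hk.mk k y * h y ∂ν := fun h =>
      lintegral_congr_ae (by filter_upwards [hk.ae_eq_mk] with y hy; rw [hy])
    simpa only [h1] using this
  set G : α → ℝ≥0∞ := fun l => ∫⁻ y, k y * g y l ∂ν
  have hF : Measurable fun p : β × α => k p.1 * g p.1 p.2 := (hkm.comp measurable_fst).mul hg
  have hG : Measurable G := hF.lintegral_prod_left'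
  have hFl : ∀ l, Measurable fun y => k y * g y l := fun l => hF.comp measurable_prodMk_right
  have hgy : ∀ y, Measurable (g y) := fun y => hg.comp measurable_prodMk_left
  -- Expand the square as a double integral and use Cauchy-Schwarz for fixed `y`, `z`.
  have h1 : ∀ h : α → ℝ≥0∞, Measurable h →
      ∫⁻ l, G l * h l ∂μ ≤ (∫⁻ z, k z * eLpNorm (g z) 2 μ ∂ν) * eLpNorm h 2 μ := by
    intro h hh
    calc ∫⁻ l, G l * h l ∂μ = ∫⁻ l, ∫⁻ z, k z * g z l * h l ∂ν ∂μ := by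
          refine lintegral_congr fun l => ?_
          exact (lintegral_mul_const _ (hFl l)).symm
      _ = ∫⁻ z, ∫⁻ l, k z * g z l * h l ∂μ ∂ν :=
          lintegral_lintegral_swap (f := fun l z => k z * g z l * h l)
            (((hF.comp measurable_swap).mul (hh.comp measurable_fst)).aemeasurable)
      _ ≤ ∫⁻ z, k z * eLpNorm (g z) 2 μ * eLpNorm h 2 μ ∂ν := by
          refine lintegral_mono fun z => ?_
          simp only [mul_assoc]
          rw [lintegral_const_mul (k z) (f := fun l => g z l * h l) ((hgy z).mul hh)]
          gcongr
          exact lintegral_mul_le_eLpNorm_two (hgy z).aemeasurable hh.aemeasurable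
      _ = _ := by
          refine lintegral_mul_const _ (hkm.mul ?_)
          simp only [eLpNorm_two_eq]
          exact (((hg.pow_const 2).lintegral_prod_right').pow_const _)
  set N : ℝ≥0∞ := ∫⁻ z, k z * eLpNorm (g z) 2 μ ∂ν
  have h2 : eLpNorm G 2 μ ^ 2 ≤ N ^ 2 := by
    calc eLpNorm G 2 μ ^ 2 = ∫⁻ l, G l * G l ∂μ := by
          rw [eLpNorm_two_sq]; simp [sq]
      _ = ∫⁻ l, ∫⁻ y, k y * g y l * G l ∂ν ∂μ := by
          refine lintegral_congr fun l => ?_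
          exact (lintegral_mul_const _ (hFl l)).symm
      _ = ∫⁻ y, ∫⁻ l, k y * g y l * G l ∂μ ∂ν :=
          lintegral_lintegral_swap (f := fun l z => k z * g z l * G l)
            (((hF.comp measurable_swap).mul (hG.comp measurable_fst)).aemeasurable)
      _ ≤ ∫⁻ y, k y * eLpNorm (g y) 2 μ * N ∂ν := by
          refine lintegral_mono fun y => ?_
          simp only [mul_assoc]
          rw [lintegral_const_mul (k y) (f := fun l => g y l * G l) ((hgy y).mul hG)]
          gcongr
          refine le_trans (le_of_eq (lintegral_congr fun l => mul_comm _ _))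
            ((h1 _ (hgy y)).trans (le_of_eq (mul_comm _ _)))
      _ = N ^ 2 := by
          rw [sq]
          refine lintegral_mul_const _ (hkm.mul ?_)
          simp only [eLpNorm_two_eq]
          exact (((hg.pow_const 2).lintegral_prod_right').pow_const _)
  exact (ENNReal.pow_le_pow_left_iff two_ne_zero).1 h2

end L2

open FourierTransform SchwartzMap in
/-- Plancherel's theorem for the Fourier integral of a function in `L¹ ∩ L²`. -/
theorem eLpNorm_fourier_le {f : ℝ → ℂ} (hf1 : Integrable f) (hf2 : MemLp f 2) :
    eLpNorm (𝓕 f) 2 volume ≤ eLpNorm f 2 volume := by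
  set F : Lp ℂ 2 (volume : Measure ℝ) := hf2.toLp f
  have hcont : Continuous (𝓕 f) :=
    VectorFourier.fourierIntegral_continuous Real.continuous_fourierChar
      (by exact continuous_inner) hf1
  -- The integral and the `L²` Fourier transforms agree as distributions.
  have hae : ((𝓕 F : Lp ℂ 2 (volume : Measure ℝ)) : ℝ → ℂ) =ᵐ[volume] 𝓕 f := by
    refine ae_eq_of_integral_contDiff_smul_eq ?_ hcont.locallyIntegrable fun φ hφ hc => ?_
    · exact (Lp.memLp _).locallyIntegrable (by norm_num)
    · set ψ : 𝓢(ℝ, ℂ) := HasCompactSupport.toSchwartzMap (f := fun x => (φ x : ℂ))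
        (hc.comp_left (g := fun x : ℝ => (x : ℂ)) rfl) (Complex.ofRealCLM.contDiff.comp hφ)
      have hψ : ∀ x, ψ x = (φ x : ℂ) := fun x => rfl
      have h1 := DFunLike.congr_fun (MeasureTheory.Lp.fourier_toTemperedDistribution_eq F) ψ
      rw [TemperedDistribution.fourier_apply, Lp.toTemperedDistribution_apply,
        Lp.toTemperedDistribution_apply] at h1
      have h2 : ∫ x, (𝓕 ψ) x • (F : ℝ → ℂ) x = ∫ x, (𝓕 ψ) x • f x :=
        integral_congr_ae (by filter_upwards [hf2.coeFn_toLp] with x hx; rw [hx])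
      have h3 : ∫ x, (𝓕 ψ) x • f x = ∫ x, ψ x • 𝓕 f x := by
        simpa using! (VectorFourier.integral_fourierIntegral_smul_eq_flip (L := innerₗ ℝ)
          Real.continuous_fourierChar continuous_inner ψ.integrable hf1)
      calc ∫ x, φ x • (𝓕 F : Lp ℂ 2 (volume : Measure ℝ)) x
          = ∫ x, ψ x • (𝓕 F : Lp ℂ 2 (volume : Measure ℝ)) x := by simp [hψ]
        _ = ∫ x, ψ x • 𝓕 f x := by rw [← h1, h2, h3]
        _ = _ := by simp [hψ]
  have hnorm := MeasureTheory.Lp.norm_fourier_eq F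
  rw [← eLpNorm_congr_ae hae, ← eLpNorm_congr_ae hf2.coeFn_toLp]
  have h4 : ∀ G : Lp ℂ 2 (volume : Measure ℝ), eLpNorm G 2 volume = ENNReal.ofReal ‖G‖ := by
    intro G
    rw [Lp.norm_def, ENNReal.ofReal_toReal (Lp.eLpNorm_ne_top G)]
  rw [h4, h4, hnorm]

open FourierTransform in
/-- Plancherel's bound for the Fourier transform with kernel `exp (-2 i l y)`; the sharp constant
is `√π`. -/
theorem eLpNorm_integral_exp_le {f : ℝ → ℂ} (hf1 : Integrable f) (hf2 : MemLp f 2) :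
    eLpNorm (fun l : ℝ => ∫ y : ℝ, f y * Complex.exp (-(2 * Complex.I * (l * y : ℝ)))) 2 volume
      ≤ 2 * eLpNorm f 2 volume := by
  have hpi : (Real.pi⁻¹ : ℝ) ≠ 0 := inv_ne_zero Real.pi_ne_zero
  have h1 : (fun l : ℝ => ∫ y : ℝ, f y * Complex.exp (-(2 * Complex.I * (l * y : ℝ))))
      = fun l => 𝓕 f (Real.pi⁻¹ * l) := by
    funext l
    rw [Real.fourier_eq']
    refine integral_congr_ae (Eventually.of_forall fun y => ?_)
    simp only [smul_eq_mul, RCLike.inner_apply, conj_trivial]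
    rw [mul_comm]
    congr 2
    have : (Real.pi : ℂ) ≠ 0 := by exact_mod_cast Real.pi_ne_zero
    push_cast
    field_simp
  rw [h1]
  have hemb : MeasurableEmbedding fun l : ℝ => Real.pi⁻¹ * l :=
    (Homeomorph.mulLeft₀ _ hpi).measurableEmbedding
  have h2 : eLpNorm (fun l => 𝓕 f (Real.pi⁻¹ * l)) 2 volume
      = eLpNorm (𝓕 f) 2 (Measure.map (fun l : ℝ => Real.pi⁻¹ * l) volume) :=
    (hemb.eLpNorm_map_measure).symm
  rw [h2, Real.map_volume_mul_left hpi, inv_inv,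
    eLpNorm_smul_measure_of_ne_top (by norm_num), abs_of_pos Real.pi_pos]
  refine mul_le_mul' ?_ (eLpNorm_fourier_le hf1 hf2)
  calc ENNReal.ofReal Real.pi ^ (1 / (2 : ℝ≥0∞)).toReal ≤ ENNReal.ofReal 4 ^ (1 / 2 : ℝ) := by
        have : (1 / (2 : ℝ≥0∞)).toReal = 1 / 2 := by simp
        rw [this]
        gcongr
        exact Real.pi_le_four
    _ = 2 := by
        rw [ENNReal.ofReal_rpow_of_nonneg (by norm_num) (by norm_num),
          show (4 : ℝ) = 2 ^ (2 : ℝ) by norm_num, ← Real.rpow_mul (by norm_num)]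
        norm_num

/-! ### The normalized column and its dependence on the potential -/

/-- The column `(1, 0)`, as a constant function of position and spectral parameter. -/
def unitCol : ℝ → ℝ → ℂ × ℂ := fun _ _ => (1, 0)

theorem BddCont.unitCol : BddCont unitCol := BddCont.const _

/-- The first column of the solution normalized at `+∞`, in the interaction picture: the bounded
solution of `v = (1, 0) + volterra q v`. -/
noncomputable def jostVec (q : ℝ → ℂ) : ℝ → ℝ → ℂ × ℂ :=
  open Classical in
  if h : Integrable q then (exists_eq_add_volterra h (1, 0)).choose else fun _ _ => (1, 0)

theorem bddCont_jostVec (q : ℝ → ℂ) : BddCont (jostVec q) := by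
  by_cases h : Integrable q
  · rw [jostVec, dif_pos h]
    exact (exists_eq_add_volterra h (1, 0)).choose_spec.1
  · rw [jostVec, dif_neg h]
    exact BddCont.const _

theorem jostVec_eq {q : ℝ → ℂ} (h : Integrable q) :
    jostVec q = unitCol + volterra q (jostVec q) := by
  rw [jostVec, dif_pos h]
  exact (exists_eq_add_volterra h (1, 0)).choose_spec.2

theorem lintegral_Ioi_le {f : ℝ → ℝ≥0∞} (x : ℝ) : ∫⁻ y in Set.Ioi x, f y ≤ ∫⁻ y, f y :=
  setLIntegral_le_lintegral _ _

/-- The norm of the solution operator `f ↦ v`, `v = f + volterra q v`, for `‖q‖₁ ≤ R`. -/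
noncomputable def solveConst (R : ℝ≥0) : ℝ≥0 := 1 + 2 * (Real.exp (2 * R)).toNNReal * R

theorem one_add_gronwallConst_mul_le {q : ℝ → ℂ} (hq : Integrable q) {R : ℝ≥0}
    (hR : ∫⁻ y, ‖q y‖ₑ ≤ R) : 1 + gronwallConst q * ∫⁻ y, ‖q y‖ₑ ≤ solveConst R := by
  have h1 : ∫ y, ‖q y‖ ≤ R := by
    rw [integral_norm_eq_lintegral_enorm hq.aestronglyMeasurable]
    exact ENNReal.toReal_le_coe_of_le_coe hR
  rw [solveConst, gronwallConst]
  push_cast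
  gcongr
  exact ENNReal.ofReal_le_ofReal (Real.exp_le_exp.2 (by linarith))

section Solve

variable {q : ℝ → ℂ} {v f : ℝ → ℝ → ℂ × ℂ} {R : ℝ≥0}

theorem enorm_le_solveConst_mul (hq : Integrable q) (hR : ∫⁻ y, ‖q y‖ₑ ≤ R) (hv : BddCont v)
    (hf : BddCont f) (h : v = f + volterra q v) {x l : ℝ} {F : ℝ≥0∞}
    (hF : ∀ y, ‖f y l‖ₑ ≤ F) : ‖v x l‖ₑ ≤ solveConst R * F := by
  refine (enorm_le_of_eq_add_volterra hq hv hf h x l).trans ?_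
  have h1 : ∫⁻ y in Set.Ioi x, ‖q y‖ₑ * ‖f y l‖ₑ ≤ (∫⁻ y, ‖q y‖ₑ) * F := by
    refine (lintegral_Ioi_le x).trans ?_
    rw [← lintegral_mul_const'' _ hq.aestronglyMeasurable.enorm]
    exact lintegral_mono fun y => by gcongr; exact hF y
  calc _ ≤ F + gronwallConst q * ((∫⁻ y, ‖q y‖ₑ) * F) := by gcongr; exact hF x
    _ = (1 + gronwallConst q * ∫⁻ y, ‖q y‖ₑ) * F := by ring
    _ ≤ _ := by gcongr; exact one_add_gronwallConst_mul_le hq hR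

theorem measurable_enorm_uncurry (hf : BddCont f) :
    Measurable fun p : ℝ × ℝ => ‖f p.1 p.2‖ₑ := hf.cont.enorm.measurable

/-- The solution operator of the Volterra equation is bounded in `L²` of the spectral parameter: the
pointwise Gronwall bound is integrated by Minkowski's inequality. -/
theorem eLpNorm_le_solveConst_mul (hq : Integrable q) (hR : ∫⁻ y, ‖q y‖ₑ ≤ R) (hv : BddCont v)
    (hf : BddCont f) (h : v = f + volterra q v) {x : ℝ} {F : ℝ≥0∞}
    (hF : ∀ y, x ≤ y → eLpNorm (f y) 2 volume ≤ F) :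
    eLpNorm (v x) 2 volume ≤ solveConst R * F := by
  have hm := measurable_enorm_uncurry hf
  set g : ℝ → ℝ≥0∞ := fun l => ∫⁻ y in Set.Ioi x, ‖q y‖ₑ * ‖f y l‖ₑ
  have hg : eLpNorm g 2 volume ≤ (∫⁻ y, ‖q y‖ₑ) * F := by
    refine (eLpNorm_lintegral_mul_le hq.aestronglyMeasurable.enorm.restrict hm).trans ?_
    calc ∫⁻ y in Set.Ioi x, ‖q y‖ₑ * eLpNorm (fun l => ‖f y l‖ₑ) 2 volume
        ≤ ∫⁻ y in Set.Ioi x, ‖q y‖ₑ * F := by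
          refine setLIntegral_mono' measurableSet_Ioi fun y hy => ?_
          gcongr
          rw [eLpNorm_enorm]
          exact hF y (le_of_lt hy)
      _ ≤ ∫⁻ y, ‖q y‖ₑ * F := lintegral_Ioi_le x
      _ = _ := lintegral_mul_const'' _ hq.aestronglyMeasurable.enorm
  have hgt : gronwallConst q ≠ ⊤ := ENNReal.mul_ne_top (by norm_num) ENNReal.ofReal_ne_top
  have h1 : eLpNorm (v x) 2 volume
      ≤ eLpNorm ((fun l => ‖f x l‖ₑ) + fun l => gronwallConst q * g l) 2 volume :=
    eLpNorm_mono_enorm fun l => enorm_le_of_eq_add_volterra hq hv hf h x l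
  have hgm : AEMeasurable g := by
    have h2 : AEMeasurable (fun p : ℝ × ℝ => ‖q p.1‖ₑ * ‖f p.1 p.2‖ₑ)
        ((volume.restrict (Set.Ioi x)).prod volume) :=
      (hq.aestronglyMeasurable.enorm.restrict.comp_fst).mul hm.aemeasurable
    exact h2.lintegral_prod_left'
  calc eLpNorm (v x) 2 volume ≤ _ := h1
    _ ≤ eLpNorm (fun l => ‖f x l‖ₑ) 2 volume
        + eLpNorm (fun l => gronwallConst q * g l) 2 volume :=
      eLpNorm_add_le (hf.continuous_right x).enorm.aestronglyMeasurable
        (hgm.const_mul _).aestronglyMeasurable (by norm_num)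
    _ ≤ F + gronwallConst q * ((∫⁻ y, ‖q y‖ₑ) * F) := by
      gcongr
      · rw [eLpNorm_enorm]
        exact hF x le_rfl
      · rw [eLpNorm_two_const_mul hgt]
        gcongr
    _ = (1 + gronwallConst q * ∫⁻ y, ‖q y‖ₑ) * F := by ring
    _ ≤ _ := by gcongr; exact one_add_gronwallConst_mul_le hq hR

theorem eLpNorm_volterra_le {p : ℝ → ℂ} (hp : Integrable p) (hv : BddCont v) (x : ℝ) :
    eLpNorm (volterra p v x) 2 volume
      ≤ ∫⁻ y in Set.Ioi x, ‖p y‖ₑ * eLpNorm (v y) 2 volume := by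
  calc eLpNorm (volterra p v x) 2 volume
      ≤ eLpNorm (fun l => ∫⁻ y in Set.Ioi x, ‖p y‖ₑ * ‖v y l‖ₑ) 2 volume :=
        eLpNorm_mono_enorm fun l => enorm_volterra_le p v x l
    _ ≤ ∫⁻ y in Set.Ioi x, ‖p y‖ₑ * eLpNorm (fun l => ‖v y l‖ₑ) 2 volume :=
        eLpNorm_lintegral_mul_le hp.aestronglyMeasurable.enorm.restrict
          (measurable_enorm_uncurry hv)
    _ = _ := by simp only [eLpNorm_enorm]

/-- The part of the Volterra operator that is linear in the potential is a Fourier transform. -/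
theorem eLpNorm_volterra_const_le {p : ℝ → ℂ} (hp : Integrable p) (x : ℝ) :
    eLpNorm (volterra p unitCol x) 2 volume
      ≤ 2 * eLpNorm ((Set.Ioi x).indicator p) 2 volume := by
  set g : ℝ → ℂ := (Set.Ioi x).indicator fun y => star (p y)
  have hg1 : Integrable g :=
    (hp.mono (continuous_star.comp_aestronglyMeasurable hp.aestronglyMeasurable)
      (by simp)).indicator measurableSet_Ioi
  have hgp : eLpNorm g 2 volume = eLpNorm ((Set.Ioi x).indicator p) 2 volume := by
    refine eLpNorm_congr_norm_ae (Eventually.of_forall fun y => ?_)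
    simp [g, Set.indicator_apply]
    split_ifs <;> simp
  rw [← hgp]
  by_cases hg2 : eLpNorm g 2 volume = ⊤
  · rw [hg2]; simp
  have hg : MemLp g 2 := ⟨hg1.aestronglyMeasurable, lt_top_iff_ne_top.2 hg2⟩
  refine le_trans ?_ (eLpNorm_integral_exp_le hg1 hg)
  refine eLpNorm_mono fun l => ?_
  have h1 : Integrable fun y => coupling (p y) (l * y) (unitCol y l) :=
    integrable_coupling hp BddCont.unitCol l
  have h2 : volterra p unitCol x l
      = (0, -∫ y : ℝ, g y * Complex.exp (-(2 * Complex.I * (l * y : ℝ)))) := by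
    have hfst : (volterra p unitCol x l).1 = 0 := by
      rw [volterra, tail, fst_integral h1.integrableOn]
      simp [coupling, unitCol]
    have hsnd : (volterra p unitCol x l).2
        = -∫ y : ℝ, g y * Complex.exp (-(2 * Complex.I * (l * y : ℝ))) := by
      rw [volterra, tail, snd_integral h1.integrableOn, ← integral_neg,
        ← integral_indicator measurableSet_Ioi]
      congr 1
      funext y
      by_cases hy : y ∈ Set.Ioi x <;> simp [hy, g, coupling, unitCol]
    exact Prod.ext hfst hsnd
  rw [h2]
  simp [Prod.norm_def]

end Solve

/-! ### Weighted norms of potentials -/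

/-- An even weight on the line, at least `1` and nondecreasing on the right half-line. Only the
constant weight `1` and `1 + |x|` occur below. -/
structure IsWeight (w : ℝ → ℝ≥0∞) : Prop where
  measurable : Measurable w
  one_le : ∀ x, 1 ≤ w x
  ne_top : ∀ x, w x ≠ ⊤
  even : ∀ x, w (-x) = w x
  mono : ∀ x y, 0 ≤ x → x ≤ y → w x ≤ w y

/-- The strong norm `‖p‖₁ + ‖w p‖₂`. -/
noncomputable def strongNorm (w : ℝ → ℝ≥0∞) (p : ℝ → ℂ) : ℝ≥0∞ :=
  (∫⁻ y, ‖p y‖ₑ) + eLpNorm (fun x => w x * ‖p x‖ₑ) 2 volume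

/-- The weak norm `‖p‖₂ + ‖p / w‖₁`, in which the increments of a potential under translation and
modulation are small. -/
noncomputable def weakNorm (w : ℝ → ℝ≥0∞) (p : ℝ → ℂ) : ℝ≥0∞ :=
  eLpNorm p 2 volume + ∫⁻ y, ‖p y‖ₑ * (w y)⁻¹

/-- Membership in the ball of radius `R` for the strong norm. -/
structure InBall (w : ℝ → ℝ≥0∞) (R : ℝ≥0) (q : ℝ → ℂ) : Prop where
  meas : AEStronglyMeasurable q volume
  le : strongNorm w q ≤ R

section Weighted

variable {w : ℝ → ℝ≥0∞} {R : ℝ≥0} {p q q₁ q₂ q₃ q₄ : ℝ → ℂ}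

theorem lintegral_enorm_le_strongNorm (w : ℝ → ℝ≥0∞) (p : ℝ → ℂ) :
    ∫⁻ y, ‖p y‖ₑ ≤ strongNorm w p := le_self_add

theorem InBall.lintegral_le (hq : InBall w R q) : ∫⁻ y, ‖q y‖ₑ ≤ R :=
  (lintegral_enorm_le_strongNorm w q).trans hq.le

theorem InBall.integrable (hq : InBall w R q) : Integrable q :=
  ⟨hq.meas, lt_of_le_of_lt hq.lintegral_le ENNReal.coe_lt_top⟩

theorem IsWeight.ne_zero (hw : IsWeight w) (x : ℝ) : w x ≠ 0 :=
  (lt_of_lt_of_le one_pos (hw.one_le x)).ne'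

theorem IsWeight.inv_ne_top (hw : IsWeight w) (x : ℝ) : (w x)⁻¹ ≠ ⊤ :=
  ENNReal.inv_ne_top.2 (hw.ne_zero x)

theorem IsWeight.inv_le_one (hw : IsWeight w) (x : ℝ) : (w x)⁻¹ ≤ 1 :=
  ENNReal.inv_le_one.2 (hw.one_le x)

theorem eLpNorm_indicator_Ioi_le_strongNorm (hw : IsWeight w) (p : ℝ → ℂ) {x : ℝ} (hx : 0 ≤ x) :
    eLpNorm ((Set.Ioi x).indicator p) 2 volume ≤ strongNorm w p * (w x)⁻¹ := by
  calc eLpNorm ((Set.Ioi x).indicator p) 2 volume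
      ≤ eLpNorm (fun y => (w x)⁻¹ * (w y * ‖p y‖ₑ)) 2 volume := by
        refine eLpNorm_mono_enorm fun y => ?_
        rw [enorm_eq_self]
        by_cases hy : y ∈ Set.Ioi x
        · rw [Set.indicator_of_mem hy, ← mul_assoc]
          refine le_mul_of_one_le_left' ?_
          rw [mul_comm, ← div_eq_mul_inv, ENNReal.le_div_iff_mul_le (Or.inl (hw.ne_zero x))
            (Or.inl (hw.ne_top x)), one_mul]
          exact hw.mono x y hx (le_of_lt hy)
        · simp [Set.indicator_of_notMem hy]
    _ = (w x)⁻¹ * eLpNorm (fun y => w y * ‖p y‖ₑ) 2 volume :=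
        eLpNorm_two_const_mul (hw.inv_ne_top x) _
    _ ≤ strongNorm w p * (w x)⁻¹ := by
        rw [mul_comm]
        gcongr
        exact le_add_self

theorem eLpNorm_volterra_const_le_strongNorm (hw : IsWeight w) (hp : Integrable p) {x : ℝ}
    (hx : 0 ≤ x) : eLpNorm (volterra p unitCol x) 2 volume
      ≤ 2 * strongNorm w p * (w x)⁻¹ := by
  rw [mul_assoc]
  exact (eLpNorm_volterra_const_le hp x).trans
    (by gcongr; exact eLpNorm_indicator_Ioi_le_strongNorm hw p hx)

theorem eLpNorm_volterra_const_le_weakNorm (w : ℝ → ℝ≥0∞) (hp : Integrable p) (x : ℝ) :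
    eLpNorm (volterra p unitCol x) 2 volume ≤ 2 * weakNorm w p :=
  (eLpNorm_volterra_const_le hp x).trans
    (by gcongr; exact (eLpNorm_indicator_le _).trans le_self_add)

theorem eLpNorm_volterra_le_mul_inv (hw : IsWeight w) (hp : Integrable p)
    {v : ℝ → ℝ → ℂ × ℂ} (hv : BddCont v) {F : ℝ≥0∞}
    (hF : ∀ y, 0 ≤ y → eLpNorm (v y) 2 volume ≤ F * (w y)⁻¹) {x : ℝ} (hx : 0 ≤ x) :
    eLpNorm (volterra p v x) 2 volume ≤ strongNorm w p * F * (w x)⁻¹ := by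
  calc eLpNorm (volterra p v x) 2 volume
      ≤ ∫⁻ y in Set.Ioi x, ‖p y‖ₑ * eLpNorm (v y) 2 volume := eLpNorm_volterra_le hp hv x
    _ ≤ ∫⁻ y in Set.Ioi x, ‖p y‖ₑ * (F * (w x)⁻¹) := by
        refine setLIntegral_mono' measurableSet_Ioi fun y hy => ?_
        gcongr
        exact (hF y (hx.trans (le_of_lt hy))).trans
          (by gcongr; exact hw.mono x y hx (le_of_lt hy))
    _ ≤ ∫⁻ y, ‖p y‖ₑ * (F * (w x)⁻¹) := lintegral_Ioi_le x
    _ = (∫⁻ y, ‖p y‖ₑ) * (F * (w x)⁻¹) := lintegral_mul_const'' _ hp.aestronglyMeasurable.enorm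
    _ ≤ strongNorm w p * (F * (w x)⁻¹) := by
        gcongr; exact lintegral_enorm_le_strongNorm w p
    _ = _ := by rw [mul_assoc]

theorem eLpNorm_volterra_le_strongNorm_mul (w : ℝ → ℝ≥0∞) (hp : Integrable p)
    {v : ℝ → ℝ → ℂ × ℂ} (hv : BddCont v) {F : ℝ≥0∞}
    (hF : ∀ y, 0 ≤ y → eLpNorm (v y) 2 volume ≤ F) {x : ℝ} (hx : 0 ≤ x) :
    eLpNorm (volterra p v x) 2 volume ≤ strongNorm w p * F := by
  calc eLpNorm (volterra p v x) 2 volume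
      ≤ ∫⁻ y in Set.Ioi x, ‖p y‖ₑ * eLpNorm (v y) 2 volume := eLpNorm_volterra_le hp hv x
    _ ≤ ∫⁻ y in Set.Ioi x, ‖p y‖ₑ * F := by
        refine setLIntegral_mono' measurableSet_Ioi fun y hy => ?_
        gcongr
        exact hF y (hx.trans (le_of_lt hy))
    _ ≤ ∫⁻ y, ‖p y‖ₑ * F := lintegral_Ioi_le x
    _ = (∫⁻ y, ‖p y‖ₑ) * F := lintegral_mul_const'' _ hp.aestronglyMeasurable.enorm
    _ ≤ strongNorm w p * F := by
        gcongr; exact lintegral_enorm_le_strongNorm w p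

/-- A function decaying like `1 / w` in position compensates for a potential that is small only in
the weak norm. -/
theorem eLpNorm_volterra_le_weakNorm_mul (hw : IsWeight w) (hp : Integrable p)
    {v : ℝ → ℝ → ℂ × ℂ} (hv : BddCont v) {F : ℝ≥0∞}
    (hF : ∀ y, 0 ≤ y → eLpNorm (v y) 2 volume ≤ F * (w y)⁻¹) {x : ℝ} (hx : 0 ≤ x) :
    eLpNorm (volterra p v x) 2 volume ≤ weakNorm w p * F := by
  calc eLpNorm (volterra p v x) 2 volume
      ≤ ∫⁻ y in Set.Ioi x, ‖p y‖ₑ * eLpNorm (v y) 2 volume := eLpNorm_volterra_le hp hv x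
    _ ≤ ∫⁻ y in Set.Ioi x, ‖p y‖ₑ * (w y)⁻¹ * F := by
        refine setLIntegral_mono' measurableSet_Ioi fun y hy => ?_
        rw [mul_assoc, mul_comm _ F]
        gcongr
        exact hF y (hx.trans (le_of_lt hy))
    _ ≤ ∫⁻ y, ‖p y‖ₑ * (w y)⁻¹ * F := lintegral_Ioi_le x
    _ = (∫⁻ y, ‖p y‖ₑ * (w y)⁻¹) * F :=
        lintegral_mul_const'' _ (hp.aestronglyMeasurable.enorm.mul hw.measurable.inv.aemeasurable)
    _ ≤ weakNorm w p * F := by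
        gcongr; exact le_add_self

theorem jostVec_sub_const_eq (hq : Integrable q) :
    jostVec q - unitCol
      = volterra q unitCol + volterra q (jostVec q - unitCol) := by
  rw [volterra_sub hq (bddCont_jostVec q) BddCont.unitCol]
  conv_lhs => rw [jostVec_eq hq]
  abel

theorem jostVec_sub_eq (h₁ : Integrable q₁) (h₂ : Integrable q₂) :
    jostVec q₁ - jostVec q₂
      = volterra (q₁ - q₂) (jostVec q₁) + volterra q₂ (jostVec q₁ - jostVec q₂) := by
  rw [volterra_sub h₂ (bddCont_jostVec _) (bddCont_jostVec _),
    sub_volterra h₁ h₂ (bddCont_jostVec _)]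
  conv_lhs => rw [jostVec_eq h₁, jostVec_eq h₂]
  abel

/-- The second difference of the normalized column solves a Volterra equation whose inhomogeneity is
of first order in a second difference of the potentials or of second order in first differences. -/
theorem jostVec_sub_sub_eq (h₁ : Integrable q₁) (h₂ : Integrable q₂) (h₃ : Integrable q₃)
    (h₄ : Integrable q₄) :
    jostVec q₁ - jostVec q₂ - (jostVec q₃ - jostVec q₄)
      = volterra (q₁ - q₂ - (q₃ - q₄)) (jostVec q₁)
        + volterra (q₃ - q₄) (jostVec q₁ - jostVec q₃)
        + volterra (q₂ - q₄) (jostVec q₁ - jostVec q₂)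
        + volterra q₄ (jostVec q₁ - jostVec q₂ - (jostVec q₃ - jostVec q₄)) := by
  have hb := bddCont_jostVec
  rw [volterra_sub h₄ ((hb q₁).sub (hb q₂)) ((hb q₃).sub (hb q₄)),
    sub_volterra (h₁.sub h₂) (h₃.sub h₄) (hb q₁), volterra_sub (h₃.sub h₄) (hb q₁) (hb q₃),
    sub_volterra h₂ h₄ ((hb q₁).sub (hb q₂))]
  conv_lhs => rw [jostVec_sub_eq h₁ h₂, jostVec_sub_eq h₃ h₄]
  abel

theorem enorm_jostVec_le (hq : Integrable q) (hR : ∫⁻ y, ‖q y‖ₑ ≤ R) (x l : ℝ) :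
    ‖jostVec q x l‖ₑ ≤ solveConst R := by
  have := enorm_le_solveConst_mul hq hR (bddCont_jostVec q) BddCont.unitCol
    (jostVec_eq hq) (x := x) (l := l) (F := 1) (fun y => by
      rw [← ofReal_norm]; simp [Prod.norm_def, unitCol])
  simpa using this

theorem enorm_jostVec_sub_le (h₁ : Integrable q₁) (h₂ : Integrable q₂)
    (hR₁ : ∫⁻ y, ‖q₁ y‖ₑ ≤ R) (hR₂ : ∫⁻ y, ‖q₂ y‖ₑ ≤ R) (x l : ℝ) :
    ‖jostVec q₁ x l - jostVec q₂ x l‖ₑ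
      ≤ ((solveConst R * solveConst R : ℝ≥0) : ℝ≥0∞) * ∫⁻ y, ‖(q₁ - q₂) y‖ₑ := by
  have hb := bddCont_jostVec
  have := enorm_le_solveConst_mul h₂ hR₂ ((hb q₁).sub (hb q₂)) ((hb q₁).volterra (h₁.sub h₂))
    (jostVec_sub_eq h₁ h₂) (x := x) (l := l) (F := (∫⁻ y, ‖(q₁ - q₂) y‖ₑ) * solveConst R)
    (fun y => by
      refine (enorm_volterra_le _ _ _ _).trans ((lintegral_Ioi_le y).trans ?_)
      rw [← lintegral_mul_const'' _ (h₁.sub h₂).aestronglyMeasurable.enorm]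
      exact lintegral_mono fun z => by gcongr; exact enorm_jostVec_le h₁ hR₁ _ _)
  refine this.trans (le_of_eq ?_)
  push_cast
  ring

/-- The constant in the `L²` estimates for differences of normalized columns. -/
noncomputable def diffConst (R : ℝ≥0) : ℝ≥0 := 2 + solveConst R * (2 * R)

/-- On the right half-line, the normalized column approaches `(1, 0)` at the rate `1 / w` in `L²`
of the spectral parameter. -/
theorem eLpNorm_jostVec_sub_const_le (hw : IsWeight w) (hq : InBall w R q) {x : ℝ} (hx : 0 ≤ x) :
    eLpNorm ((jostVec q - unitCol) x) 2 volume
      ≤ ((solveConst R * (2 * R) : ℝ≥0) : ℝ≥0∞) * (w x)⁻¹ := by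
  have hb := BddCont.unitCol
  refine (eLpNorm_le_solveConst_mul hq.integrable hq.lintegral_le ((bddCont_jostVec q).sub hb)
    (hb.volterra hq.integrable) (jostVec_sub_const_eq hq.integrable)
    (F := 2 * R * (w x)⁻¹) fun y hy => ?_).trans (le_of_eq ?_)
  · refine (eLpNorm_volterra_const_le_strongNorm hw hq.integrable (hx.trans hy)).trans ?_
    gcongr
    · exact hq.le
    · exact hw.mono x y hx hy
  · push_cast
    ring

theorem volterra_jostVec_eq (hp : Integrable p) (q : ℝ → ℂ) :
    volterra p (jostVec q)
      = volterra p unitCol + volterra p (jostVec q - unitCol) := by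
  rw [volterra_sub hp (bddCont_jostVec q) BddCont.unitCol]
  abel

theorem eLpNorm_volterra_jostVec_le_add (hp : Integrable p) (q : ℝ → ℂ) (x : ℝ) :
    eLpNorm (volterra p (jostVec q) x) 2 volume
      ≤ eLpNorm (volterra p unitCol x) 2 volume
        + eLpNorm (volterra p (jostVec q - unitCol) x) 2 volume := by
  have hb := BddCont.unitCol
  rw [volterra_jostVec_eq hp q]
  exact eLpNorm_add_le ((hb.volterra hp).continuous_right x).aestronglyMeasurable
    ((((bddCont_jostVec q).sub hb).volterra hp).continuous_right x).aestronglyMeasurable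
    (by norm_num)

theorem eLpNorm_volterra_jostVec_le_weakNorm (hw : IsWeight w) (hp : Integrable p)
    (hq : InBall w R q) {x : ℝ} (hx : 0 ≤ x) :
    eLpNorm (volterra p (jostVec q) x) 2 volume ≤ diffConst R * weakNorm w p := by
  refine (eLpNorm_volterra_jostVec_le_add hp q x).trans ?_
  refine (add_le_add (eLpNorm_volterra_const_le_weakNorm w hp x)
    (eLpNorm_volterra_le_weakNorm_mul hw hp ((bddCont_jostVec q).sub BddCont.unitCol)
      (fun y hy => eLpNorm_jostVec_sub_const_le hw hq hy) hx)).trans (le_of_eq ?_)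
  rw [diffConst]
  push_cast
  ring

theorem eLpNorm_volterra_jostVec_le_strongNorm (hw : IsWeight w) (hp : Integrable p)
    (hq : InBall w R q) {x : ℝ} (hx : 0 ≤ x) :
    eLpNorm (volterra p (jostVec q) x) 2 volume ≤ diffConst R * strongNorm w p * (w x)⁻¹ := by
  refine (eLpNorm_volterra_jostVec_le_add hp q x).trans ?_
  refine (add_le_add (eLpNorm_volterra_const_le_strongNorm hw hp hx)
    (eLpNorm_volterra_le_mul_inv hw hp ((bddCont_jostVec q).sub BddCont.unitCol)
      (fun y hy => eLpNorm_jostVec_sub_const_le hw hq hy) hx)).trans (le_of_eq ?_)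
  rw [diffConst]
  push_cast
  ring

theorem eLpNorm_jostVec_sub_le_weakNorm (hw : IsWeight w) (h₁ : InBall w R q₁)
    (h₂ : InBall w R q₂) {x : ℝ} (hx : 0 ≤ x) :
    eLpNorm ((jostVec q₁ - jostVec q₂) x) 2 volume
      ≤ ((solveConst R * diffConst R : ℝ≥0) : ℝ≥0∞) * weakNorm w (q₁ - q₂) := by
  have hb := bddCont_jostVec
  have hp := h₁.integrable.sub h₂.integrable
  push_cast
  rw [mul_assoc]
  exact eLpNorm_le_solveConst_mul h₂.integrable h₂.lintegral_le ((hb q₁).sub (hb q₂))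
    ((hb q₁).volterra hp) (jostVec_sub_eq h₁.integrable h₂.integrable) fun y hy =>
      eLpNorm_volterra_jostVec_le_weakNorm hw hp h₁ (hx.trans hy)

theorem eLpNorm_jostVec_sub_le_strongNorm (hw : IsWeight w) (h₁ : InBall w R q₁)
    (h₂ : InBall w R q₂) {x : ℝ} (hx : 0 ≤ x) :
    eLpNorm ((jostVec q₁ - jostVec q₂) x) 2 volume
      ≤ ((solveConst R * diffConst R : ℝ≥0) : ℝ≥0∞) * strongNorm w (q₁ - q₂) * (w x)⁻¹ := by
  have hb := bddCont_jostVec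
  have hp := h₁.integrable.sub h₂.integrable
  push_cast
  rw [mul_assoc, mul_assoc, ← mul_assoc (diffConst R : ℝ≥0∞)]
  exact eLpNorm_le_solveConst_mul h₂.integrable h₂.lintegral_le ((hb q₁).sub (hb q₂))
    ((hb q₁).volterra hp) (jostVec_sub_eq h₁.integrable h₂.integrable) fun y hy =>
      (eLpNorm_volterra_jostVec_le_strongNorm hw hp h₁ (hx.trans hy)).trans
        (by gcongr; exact hw.mono x y hx hy)

/-- The second difference of the normalized column over four potentials, in `L²`. -/
theorem eLpNorm_jostVec_sub_sub_le (hw : IsWeight w) (h₁ : InBall w R q₁) (h₂ : InBall w R q₂)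
    (h₃ : InBall w R q₃) (h₄ : InBall w R q₄) :
    eLpNorm ((jostVec q₁ - jostVec q₂ - (jostVec q₃ - jostVec q₄)) 0) 2 volume
      ≤ ((solveConst R * (diffConst R + solveConst R * diffConst R) : ℝ≥0) : ℝ≥0∞)
        * (weakNorm w (q₁ - q₂ - (q₃ - q₄)) + (weakNorm w (q₁ - q₂) + weakNorm w (q₃ - q₄))
          * (strongNorm w (q₁ - q₃) + strongNorm w (q₂ - q₄))) := by
  have hb := bddCont_jostVec
  have i₁ := h₁.integrable
  have i₂ := h₂.integrable
  have i₃ := h₃.integrable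
  have i₄ := h₄.integrable
  have b1 := (hb q₁).volterra ((i₁.sub i₂).sub (i₃.sub i₄))
  have b2 := ((hb q₁).sub (hb q₃)).volterra (i₃.sub i₄)
  have b3 := ((hb q₁).sub (hb q₂)).volterra (i₂.sub i₄)
  push_cast
  rw [mul_assoc]
  refine eLpNorm_le_solveConst_mul i₄ h₄.lintegral_le
    (((hb q₁).sub (hb q₂)).sub ((hb q₃).sub (hb q₄))) ((b1.add b2).add b3)
    (jostVec_sub_sub_eq i₁ i₂ i₃ i₄) fun y hy => ?_
  have e1 := eLpNorm_volterra_jostVec_le_weakNorm hw ((i₁.sub i₂).sub (i₃.sub i₄)) h₁ hy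
  have e2 := eLpNorm_volterra_le_weakNorm_mul hw (i₃.sub i₄) ((hb q₁).sub (hb q₃))
    (fun z hz => eLpNorm_jostVec_sub_le_strongNorm hw h₁ h₃ hz) hy
  have e3 := eLpNorm_volterra_le_strongNorm_mul w (i₂.sub i₄) ((hb q₁).sub (hb q₂))
    (fun z hz => eLpNorm_jostVec_sub_le_weakNorm hw h₁ h₂ hz) hy
  set A := weakNorm w (q₁ - q₂ - (q₃ - q₄))
  set B := weakNorm w (q₁ - q₂)
  set B' := weakNorm w (q₃ - q₄)
  set S := strongNorm w (q₁ - q₃)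
  set S' := strongNorm w (q₂ - q₄)
  set k : ℝ≥0∞ := ((solveConst R * diffConst R : ℝ≥0) : ℝ≥0∞) with hk
  have hk' : (solveConst R : ℝ≥0∞) * diffConst R = k := by rw [hk]; push_cast; rfl
  rw [hk']
  set d : ℝ≥0∞ := (diffConst R : ℝ≥0∞)
  have h12 := eLpNorm_add_le ((b1.add b2).continuous_right y).aestronglyMeasurable
    (b3.continuous_right y).aestronglyMeasurable (μ := volume) (p := 2) (by norm_num)
  have h11 := eLpNorm_add_le (b1.continuous_right y).aestronglyMeasurable
    (b2.continuous_right y).aestronglyMeasurable (μ := volume) (p := 2) (by norm_num)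
  calc _ ≤ _ := h12
    _ ≤ _ := add_le_add h11 le_rfl
    _ ≤ d * A + B' * (k * S) + S' * (k * B) := add_le_add (add_le_add e1 e2) e3
    _ ≤ d * A + B' * (k * S) + S' * (k * B)
        + (k * A + d * ((B + B') * (S + S')) + k * (B * S + B' * S')) := le_self_add
    _ = (d + k) * (A + (B + B') * (S + S')) := by ring

end Weighted

/-! ### An algebra of regular functionals of the potential -/

theorem eLpNorm_two_le_const_mul {f g : ℝ → ℂ} {C : ℝ≥0∞} (hC : C ≠ ⊤)
    (h : ∀ l, ‖f l‖ₑ ≤ C * ‖g l‖ₑ) : eLpNorm f 2 volume ≤ C * eLpNorm g 2 volume := by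
  rw [← eLpNorm_enorm g, ← eLpNorm_two_const_mul hC]
  exact eLpNorm_mono_enorm h

theorem eLpNorm_two_add_le {f g : ℝ → ℂ} (hf : Continuous f) (hg : Continuous g) {A B : ℝ≥0∞}
    (hA : eLpNorm f 2 volume ≤ A) (hB : eLpNorm g 2 volume ≤ B) :
    eLpNorm (f + g) 2 volume ≤ A + B :=
  (eLpNorm_add_le hf.aestronglyMeasurable hg.aestronglyMeasurable (by norm_num)).trans
    (add_le_add hA hB)

/-- The quantity controlling second differences over four potentials: the second difference of the
potentials itself, and products of a first difference `q₁ - q₂` or `q₃ - q₄` with a transversal first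
difference `q₁ - q₃` or `q₂ - q₄`. -/
noncomputable def fourNorm (w : ℝ → ℝ≥0∞) (q₁ q₂ q₃ q₄ : ℝ → ℂ) : ℝ≥0∞ :=
  weakNorm w (q₁ - q₂ - (q₃ - q₄)) + (weakNorm w (q₁ - q₂) + weakNorm w (q₃ - q₄))
    * (strongNorm w (q₁ - q₃) + strongNorm w (q₂ - q₄))

/-- A functional `F` of the potential, with values in functions of the spectral parameter, that is
bounded and Lipschitz on bounded sets: uniformly in the spectral parameter for the `L¹` norm, and in
`L²` for the weak norm, the latter together with its second differences. The fields `bdd` and `lipSup`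
involve only `L¹`, so that they supply the uniformly bounded factor in estimates of products. -/
structure Regular (w : ℝ → ℝ≥0∞) (F : (ℝ → ℂ) → ℝ → ℂ) : Prop where
  cont : ∀ q, Integrable q → Continuous (F q)
  bdd : ∀ R : ℝ≥0, ∃ C : ℝ≥0, ∀ q, Integrable q → ∫⁻ y, ‖q y‖ₑ ≤ R → ∀ l, ‖F q l‖ₑ ≤ C
  lipSup : ∀ R : ℝ≥0, ∃ C : ℝ≥0, ∀ q₁ q₂, Integrable q₁ → Integrable q₂ →
    ∫⁻ y, ‖q₁ y‖ₑ ≤ R → ∫⁻ y, ‖q₂ y‖ₑ ≤ R →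
      ∀ l, ‖F q₁ l - F q₂ l‖ₑ ≤ C * ∫⁻ y, ‖(q₁ - q₂) y‖ₑ
  lip : ∀ R : ℝ≥0, ∃ C : ℝ≥0, ∀ q₁ q₂, InBall w R q₁ → InBall w R q₂ →
    eLpNorm (F q₁ - F q₂) 2 volume ≤ C * weakNorm w (q₁ - q₂)
  four : ∀ R : ℝ≥0, ∃ C : ℝ≥0, ∀ q₁ q₂ q₃ q₄, InBall w R q₁ → InBall w R q₂ → InBall w R q₃ →
    InBall w R q₄ →
      eLpNorm (F q₁ - F q₂ - (F q₃ - F q₄)) 2 volume ≤ C * fourNorm w q₁ q₂ q₃ q₄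

section Regular

variable {w : ℝ → ℝ≥0∞} {F G : (ℝ → ℂ) → ℝ → ℂ}

theorem weak_mul_strong_le_fourNorm (w : ℝ → ℝ≥0∞) (q₁ q₂ q₃ q₄ : ℝ → ℂ) :
    weakNorm w (q₃ - q₄) * strongNorm w (q₁ - q₃) ≤ fourNorm w q₁ q₂ q₃ q₄ :=
  (mul_le_mul' le_add_self le_self_add).trans le_add_self

theorem weak_mul_strong_le_fourNorm' (w : ℝ → ℝ≥0∞) (q₁ q₂ q₃ q₄ : ℝ → ℂ) :
    weakNorm w (q₃ - q₄) * strongNorm w (q₂ - q₄) ≤ fourNorm w q₁ q₂ q₃ q₄ :=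
  (mul_le_mul' le_add_self le_add_self).trans le_add_self

theorem lintegral_enorm_ne_top {p : ℝ → ℂ} (hp : Integrable p) (C : ℝ≥0) :
    C * ∫⁻ y, ‖p y‖ₑ ≠ ⊤ :=
  ENNReal.mul_ne_top ENNReal.coe_ne_top hp.hasFiniteIntegral.ne

theorem enorm_star_eq (z : ℂ) : ‖Star.star z‖ₑ = ‖z‖ₑ := by
  rw [← ofReal_norm, norm_star, ofReal_norm]

theorem Regular.star (hF : Regular w F) : Regular w fun q l => star (F q l) where
  cont q hq := continuous_star.comp (hF.cont q hq)
  bdd R := by simpa using hF.bdd R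
  lipSup R := by
    obtain ⟨C, hC⟩ := hF.lipSup R
    refine ⟨C, fun q₁ q₂ h₁ h₂ k₁ k₂ l => ?_⟩
    rw [← star_sub, enorm_star_eq]
    exact hC q₁ q₂ h₁ h₂ k₁ k₂ l
  lip R := by
    obtain ⟨C, hC⟩ := hF.lip R
    refine ⟨C, fun q₁ q₂ h₁ h₂ => le_trans (eLpNorm_mono_enorm fun l => ?_) (hC q₁ q₂ h₁ h₂)⟩
    simp only [Pi.sub_apply]
    rw [← star_sub, enorm_star_eq]
  four R := by
    obtain ⟨C, hC⟩ := hF.four R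
    refine ⟨C, fun q₁ q₂ q₃ q₄ h₁ h₂ h₃ h₄ => le_trans (eLpNorm_mono_enorm fun l => ?_)
      (hC q₁ q₂ q₃ q₄ h₁ h₂ h₃ h₄)⟩
    simp only [Pi.sub_apply]
    rw [← star_sub, ← star_sub, ← star_sub, enorm_star_eq]

theorem Regular.sub (hF : Regular w F) (hG : Regular w G) :
    Regular w fun q l => F q l - G q l where
  cont q hq := (hF.cont q hq).sub (hG.cont q hq)
  bdd R := by
    obtain ⟨C, hC⟩ := hF.bdd R
    obtain ⟨D, hD⟩ := hG.bdd R
    refine ⟨C + D, fun q hq hR l => enorm_sub_le.trans ?_⟩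
    push_cast
    exact add_le_add (hC q hq hR l) (hD q hq hR l)
  lipSup R := by
    obtain ⟨C, hC⟩ := hF.lipSup R
    obtain ⟨D, hD⟩ := hG.lipSup R
    refine ⟨C + D, fun q₁ q₂ h₁ h₂ k₁ k₂ l => ?_⟩
    rw [sub_sub_sub_comm]
    refine enorm_sub_le.trans ?_
    push_cast
    rw [add_mul]
    exact add_le_add (hC q₁ q₂ h₁ h₂ k₁ k₂ l) (hD q₁ q₂ h₁ h₂ k₁ k₂ l)
  lip R := by
    obtain ⟨C, hC⟩ := hF.lip R
    obtain ⟨D, hD⟩ := hG.lip R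
    refine ⟨C + D, fun q₁ q₂ h₁ h₂ => ?_⟩
    have hr : ((fun l => F q₁ l - G q₁ l) - fun l => F q₂ l - G q₂ l)
        = (F q₁ - F q₂) + -(G q₁ - G q₂) := by
      funext l; simp only [Pi.sub_apply, Pi.add_apply, Pi.neg_apply]; ring
    rw [hr]
    push_cast
    rw [add_mul]
    refine eLpNorm_two_add_le ((hF.cont q₁ h₁.integrable).sub (hF.cont q₂ h₂.integrable))
      ((hG.cont q₁ h₁.integrable).sub (hG.cont q₂ h₂.integrable)).neg (hC q₁ q₂ h₁ h₂) ?_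
    rw [eLpNorm_neg]
    exact hD q₁ q₂ h₁ h₂
  four R := by
    obtain ⟨C, hC⟩ := hF.four R
    obtain ⟨D, hD⟩ := hG.four R
    refine ⟨C + D, fun q₁ q₂ q₃ q₄ h₁ h₂ h₃ h₄ => ?_⟩
    have hr : ((fun l => F q₁ l - G q₁ l) - (fun l => F q₂ l - G q₂ l)
          - ((fun l => F q₃ l - G q₃ l) - fun l => F q₄ l - G q₄ l))
        = (F q₁ - F q₂ - (F q₃ - F q₄)) + -(G q₁ - G q₂ - (G q₃ - G q₄)) := by
      funext l; simp only [Pi.sub_apply, Pi.add_apply, Pi.neg_apply]; ring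
    rw [hr]
    push_cast
    rw [add_mul]
    have c := fun q (h : InBall w R q) => hF.cont q h.integrable
    have d := fun q (h : InBall w R q) => hG.cont q h.integrable
    refine eLpNorm_two_add_le (((c q₁ h₁).sub (c q₂ h₂)).sub ((c q₃ h₃).sub (c q₄ h₄)))
      (((d q₁ h₁).sub (d q₂ h₂)).sub ((d q₃ h₃).sub (d q₄ h₄))).neg
      (hC q₁ q₂ q₃ q₄ h₁ h₂ h₃ h₄) ?_
    rw [eLpNorm_neg]
    exact hD q₁ q₂ q₃ q₄ h₁ h₂ h₃ h₄

/-- Regular functionals are closed under products: in each term of the Leibniz rule for differences,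
one factor is bounded in `L²` and the other uniformly in the spectral parameter. -/
theorem Regular.mul (hF : Regular w F) (hG : Regular w G) :
    Regular w fun q l => F q l * G q l where
  cont q hq := (hF.cont q hq).mul (hG.cont q hq)
  bdd R := by
    obtain ⟨C, hC⟩ := hF.bdd R
    obtain ⟨D, hD⟩ := hG.bdd R
    refine ⟨C * D, fun q hq hR l => ?_⟩
    rw [enorm_mul]
    push_cast
    exact mul_le_mul' (hC q hq hR l) (hD q hq hR l)
  lipSup R := by
    obtain ⟨C, hC⟩ := hF.bdd R
    obtain ⟨D, hD⟩ := hG.bdd R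
    obtain ⟨C', hC'⟩ := hF.lipSup R
    obtain ⟨D', hD'⟩ := hG.lipSup R
    refine ⟨C' * D + C * D', fun q₁ q₂ h₁ h₂ k₁ k₂ l => ?_⟩
    rw [show F q₁ l * G q₁ l - F q₂ l * G q₂ l
      = (F q₁ l - F q₂ l) * G q₁ l + F q₂ l * (G q₁ l - G q₂ l) by ring]
    refine (enorm_add_le _ _).trans ?_
    rw [enorm_mul, enorm_mul]
    refine (add_le_add (mul_le_mul' (hC' q₁ q₂ h₁ h₂ k₁ k₂ l) (hD q₁ h₁ k₁ l))
      (mul_le_mul' (hC q₂ h₂ k₂ l) (hD' q₁ q₂ h₁ h₂ k₁ k₂ l))).trans (le_of_eq ?_)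
    push_cast
    ring
  lip R := by
    obtain ⟨C, hC⟩ := hF.bdd R
    obtain ⟨D, hD⟩ := hG.bdd R
    obtain ⟨C', hC'⟩ := hF.lip R
    obtain ⟨D', hD'⟩ := hG.lip R
    refine ⟨D * C' + C * D', fun q₁ q₂ h₁ h₂ => ?_⟩
    have hr : ((fun l => F q₁ l * G q₁ l) - fun l => F q₂ l * G q₂ l)
        = (fun l => (F q₁ - F q₂) l * G q₁ l) + fun l => F q₂ l * (G q₁ - G q₂) l := by
      funext l; simp only [Pi.sub_apply, Pi.add_apply]; ring
    have c := fun q (h : InBall w R q) => hF.cont q h.integrable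
    have d := fun q (h : InBall w R q) => hG.cont q h.integrable
    rw [hr]
    push_cast
    rw [add_mul]
    refine eLpNorm_two_add_le (((c q₁ h₁).sub (c q₂ h₂)).mul (d q₁ h₁))
      ((c q₂ h₂).mul ((d q₁ h₁).sub (d q₂ h₂))) ?_ ?_ <;> rw [mul_assoc]
    · refine (eLpNorm_two_le_const_mul (g := F q₁ - F q₂) ENNReal.coe_ne_top fun l => ?_).trans
        (mul_le_mul' le_rfl (hC' q₁ q₂ h₁ h₂))
      rw [Pi.mul_apply, enorm_mul, mul_comm]
      exact mul_le_mul' (hD q₁ h₁.integrable h₁.lintegral_le l) le_rfl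
    · refine (eLpNorm_two_le_const_mul (g := G q₁ - G q₂) ENNReal.coe_ne_top fun l => ?_).trans
        (mul_le_mul' le_rfl (hD' q₁ q₂ h₁ h₂))
      rw [Pi.mul_apply, enorm_mul]
      exact mul_le_mul' (hC q₂ h₂.integrable h₂.lintegral_le l) le_rfl
  four R := by
    obtain ⟨C, hC⟩ := hF.bdd R
    obtain ⟨D, hD⟩ := hG.bdd R
    obtain ⟨C₁, hC₁⟩ := hF.lipSup R
    obtain ⟨D₁, hD₁⟩ := hG.lipSup R
    obtain ⟨C₂, hC₂⟩ := hF.lip R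
    obtain ⟨D₂, hD₂⟩ := hG.lip R
    obtain ⟨C₄, hC₄⟩ := hF.four R
    obtain ⟨D₄, hD₄⟩ := hG.four R
    refine ⟨D * C₄ + D₁ * C₂ + C * D₄ + C₁ * D₂, fun q₁ q₂ q₃ q₄ h₁ h₂ h₃ h₄ => ?_⟩
    -- The discrete Leibniz rule for second differences.
    have hr : ((fun l => F q₁ l * G q₁ l) - (fun l => F q₂ l * G q₂ l)
          - ((fun l => F q₃ l * G q₃ l) - fun l => F q₄ l * G q₄ l))
        = (fun l => (F q₁ - F q₂ - (F q₃ - F q₄)) l * G q₁ l)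
          + (fun l => (F q₃ - F q₄) l * (G q₁ - G q₃) l)
          + (fun l => F q₂ l * (G q₁ - G q₂ - (G q₃ - G q₄)) l)
          + fun l => (F q₂ - F q₄) l * (G q₃ - G q₄) l := by
      funext l; simp only [Pi.sub_apply, Pi.add_apply]; ring
    have c := fun q (h : InBall w R q) => hF.cont q h.integrable
    have d := fun q (h : InBall w R q) => hG.cont q h.integrable
    have cc := ((c q₁ h₁).sub (c q₂ h₂)).sub ((c q₃ h₃).sub (c q₄ h₄))
    have dd := ((d q₁ h₁).sub (d q₂ h₂)).sub ((d q₃ h₃).sub (d q₄ h₄))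
    rw [hr]
    push_cast
    rw [add_mul, add_mul, add_mul]
    have k1 := cc.mul (d q₁ h₁)
    have k2 := ((c q₃ h₃).sub (c q₄ h₄)).mul ((d q₁ h₁).sub (d q₃ h₃))
    have k3 := (c q₂ h₂).mul dd
    have k4 := ((c q₂ h₂).sub (c q₄ h₄)).mul ((d q₃ h₃).sub (d q₄ h₄))
    refine eLpNorm_two_add_le ((k1.add k2).add k3) k4 (eLpNorm_two_add_le (k1.add k2) k3
      (eLpNorm_two_add_le k1 k2 ?_ ?_) ?_) ?_
    · rw [mul_assoc]
      refine (eLpNorm_two_le_const_mul (g := F q₁ - F q₂ - (F q₃ - F q₄)) ENNReal.coe_ne_top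
        fun l => ?_).trans (mul_le_mul' le_rfl (hC₄ q₁ q₂ q₃ q₄ h₁ h₂ h₃ h₄))
      rw [Pi.mul_apply, enorm_mul, mul_comm]
      exact mul_le_mul' (hD q₁ h₁.integrable h₁.lintegral_le l) le_rfl
    · have hi := h₁.integrable.sub h₃.integrable
      calc _ ≤ (D₁ * ∫⁻ y, ‖(q₁ - q₃) y‖ₑ) * eLpNorm (F q₃ - F q₄) 2 volume := by
            refine eLpNorm_two_le_const_mul (lintegral_enorm_ne_top hi D₁) fun l => ?_
            rw [Pi.mul_apply, enorm_mul, mul_comm]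
            exact mul_le_mul' (hD₁ q₁ q₃ h₁.integrable h₃.integrable h₁.lintegral_le
              h₃.lintegral_le l) le_rfl
        _ ≤ (D₁ * strongNorm w (q₁ - q₃)) * (C₂ * weakNorm w (q₃ - q₄)) :=
            mul_le_mul' (mul_le_mul' le_rfl (lintegral_enorm_le_strongNorm w _))
              (hC₂ q₃ q₄ h₃ h₄)
        _ = D₁ * C₂ * (weakNorm w (q₃ - q₄) * strongNorm w (q₁ - q₃)) := by ring
        _ ≤ _ := mul_le_mul' le_rfl (weak_mul_strong_le_fourNorm w q₁ q₂ q₃ q₄)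
    · rw [mul_assoc]
      refine (eLpNorm_two_le_const_mul (g := G q₁ - G q₂ - (G q₃ - G q₄)) ENNReal.coe_ne_top
        fun l => ?_).trans (mul_le_mul' le_rfl (hD₄ q₁ q₂ q₃ q₄ h₁ h₂ h₃ h₄))
      rw [Pi.mul_apply, enorm_mul]
      exact mul_le_mul' (hC q₂ h₂.integrable h₂.lintegral_le l) le_rfl
    · have hi := h₂.integrable.sub h₄.integrable
      calc _ ≤ (C₁ * ∫⁻ y, ‖(q₂ - q₄) y‖ₑ) * eLpNorm (G q₃ - G q₄) 2 volume := by
            refine eLpNorm_two_le_const_mul (lintegral_enorm_ne_top hi C₁) fun l => ?_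
            rw [Pi.mul_apply, enorm_mul]
            exact mul_le_mul' (hC₁ q₂ q₄ h₂.integrable h₄.integrable h₂.lintegral_le
              h₄.lintegral_le l) le_rfl
        _ ≤ (C₁ * strongNorm w (q₂ - q₄)) * (D₂ * weakNorm w (q₃ - q₄)) :=
            mul_le_mul' (mul_le_mul' le_rfl (lintegral_enorm_le_strongNorm w _))
              (hD₂ q₃ q₄ h₃ h₄)
        _ = C₁ * D₂ * (weakNorm w (q₃ - q₄) * strongNorm w (q₂ - q₄)) := by ring
        _ ≤ _ := mul_le_mul' le_rfl (weak_mul_strong_le_fourNorm' w q₁ q₂ q₃ q₄)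

/-- Inversion preserves regularity for functionals of modulus at least `1`. -/
theorem Regular.inv (hF : Regular w F) (h1 : ∀ q, Integrable q → ∀ l, 1 ≤ ‖F q l‖) :
    Regular w fun q l => (F q l)⁻¹ := by
  have h0 : ∀ q, Integrable q → ∀ l, F q l ≠ 0 := fun q hq l =>
    norm_ne_zero_iff.1 (lt_of_lt_of_le one_pos (h1 q hq l)).ne'
  have hle : ∀ q, Integrable q → ∀ l, ‖(F q l)⁻¹‖ₑ ≤ 1 := fun q hq l => by
    rw [← ofReal_norm, norm_inv, ← ENNReal.ofReal_one]
    exact ENNReal.ofReal_le_ofReal (inv_le_one_of_one_le₀ (h1 q hq l))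
  have hsub : ∀ q₁ q₂, Integrable q₁ → Integrable q₂ → ∀ l,
      ‖(F q₁ l)⁻¹ - (F q₂ l)⁻¹‖ₑ ≤ ‖F q₁ l - F q₂ l‖ₑ := fun q₁ q₂ i₁ i₂ l => by
    rw [show (F q₁ l)⁻¹ - (F q₂ l)⁻¹ = -((F q₁ l - F q₂ l) * ((F q₁ l)⁻¹ * (F q₂ l)⁻¹)) by
      have := h0 q₁ i₁ l
      have := h0 q₂ i₂ l
      field_simp
      ring]
    rw [enorm_neg, enorm_mul, enorm_mul]
    exact mul_le_of_le_one_right' (mul_le_one' (hle q₁ i₁ l) (hle q₂ i₂ l))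
  refine ⟨fun q hq => (hF.cont q hq).inv₀ (h0 q hq), fun R => ⟨1, fun q hq _ l => hle q hq l⟩,
    fun R => ?_, fun R => ?_, fun R => ?_⟩
  · obtain ⟨C, hC⟩ := hF.lipSup R
    exact ⟨C, fun q₁ q₂ i₁ i₂ k₁ k₂ l => (hsub q₁ q₂ i₁ i₂ l).trans (hC q₁ q₂ i₁ i₂ k₁ k₂ l)⟩
  · obtain ⟨C, hC⟩ := hF.lip R
    exact ⟨C, fun q₁ q₂ k₁ k₂ => (eLpNorm_mono_enorm fun l =>
      hsub q₁ q₂ k₁.integrable k₂.integrable l).trans (hC q₁ q₂ k₁ k₂)⟩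
  · obtain ⟨C₁, hC₁⟩ := hF.lipSup R
    obtain ⟨C₂, hC₂⟩ := hF.lip R
    obtain ⟨C₄, hC₄⟩ := hF.four R
    -- The discrete quotient rule for second differences.
    refine ⟨C₄ + C₁ * C₂ + C₁ * C₂, fun q₁ q₂ q₃ q₄ h₁ h₂ h₃ h₄ => ?_⟩
    have i₁ := h₁.integrable
    have i₂ := h₂.integrable
    have i₃ := h₃.integrable
    have i₄ := h₄.integrable
    have hr : ((fun l => (F q₁ l)⁻¹) - (fun l => (F q₂ l)⁻¹)
          - ((fun l => (F q₃ l)⁻¹) - fun l => (F q₄ l)⁻¹))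
        = (fun l => -((F q₁ - F q₂ - (F q₃ - F q₄)) l * ((F q₁ l)⁻¹ * (F q₂ l)⁻¹)))
          + (fun l => -((F q₃ - F q₄) l * (((F q₁ l)⁻¹ - (F q₃ l)⁻¹) * (F q₂ l)⁻¹)))
          + fun l => -((F q₃ - F q₄) l * (((F q₂ l)⁻¹ - (F q₄ l)⁻¹) * (F q₃ l)⁻¹)) := by
      funext l
      have := h0 q₁ i₁ l
      have := h0 q₂ i₂ l
      have := h0 q₃ i₃ l
      have := h0 q₄ i₄ l
      simp only [Pi.sub_apply, Pi.add_apply]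
      field_simp
      ring
    have c := fun q (h : Integrable q) => hF.cont q h
    have g := fun q (h : Integrable q) => (hF.cont q h).inv₀ (h0 q h)
    have k1 := ((((c q₁ i₁).sub (c q₂ i₂)).sub ((c q₃ i₃).sub (c q₄ i₄))).mul
      ((g q₁ i₁).mul (g q₂ i₂))).neg
    have k2 := (((c q₃ i₃).sub (c q₄ i₄)).mul (((g q₁ i₁).sub (g q₃ i₃)).mul (g q₂ i₂))).neg
    have k3 := (((c q₃ i₃).sub (c q₄ i₄)).mul (((g q₂ i₂).sub (g q₄ i₄)).mul (g q₃ i₃))).neg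
    rw [hr]
    push_cast
    rw [add_mul, add_mul]
    refine eLpNorm_two_add_le (k1.add k2) k3 (eLpNorm_two_add_le k1 k2 ?_ ?_) ?_
    · refine (eLpNorm_mono_enorm fun l => ?_).trans (hC₄ q₁ q₂ q₃ q₄ h₁ h₂ h₃ h₄)
      rw [Pi.neg_apply, enorm_neg, Pi.mul_apply, enorm_mul, Pi.mul_apply, enorm_mul]
      exact mul_le_of_le_one_right' (mul_le_one' (hle q₁ i₁ l) (hle q₂ i₂ l))
    · calc _ ≤ (C₁ * ∫⁻ y, ‖(q₁ - q₃) y‖ₑ) * eLpNorm (F q₃ - F q₄) 2 volume := by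
            refine eLpNorm_two_le_const_mul (lintegral_enorm_ne_top (i₁.sub i₃) C₁) fun l => ?_
            rw [Pi.neg_apply, enorm_neg, Pi.mul_apply, enorm_mul, Pi.mul_apply, enorm_mul, mul_comm]
            exact mul_le_mul' ((mul_le_of_le_one_right' (hle q₂ i₂ l)).trans
              ((hsub q₁ q₃ i₁ i₃ l).trans
                (hC₁ q₁ q₃ i₁ i₃ h₁.lintegral_le h₃.lintegral_le l))) le_rfl
        _ ≤ (C₁ * strongNorm w (q₁ - q₃)) * (C₂ * weakNorm w (q₃ - q₄)) :=
            mul_le_mul' (mul_le_mul' le_rfl (lintegral_enorm_le_strongNorm w _))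
              (hC₂ q₃ q₄ h₃ h₄)
        _ = C₁ * C₂ * (weakNorm w (q₃ - q₄) * strongNorm w (q₁ - q₃)) := by ring
        _ ≤ _ := mul_le_mul' le_rfl (weak_mul_strong_le_fourNorm w q₁ q₂ q₃ q₄)
    · calc _ ≤ (C₁ * ∫⁻ y, ‖(q₂ - q₄) y‖ₑ) * eLpNorm (F q₃ - F q₄) 2 volume := by
            refine eLpNorm_two_le_const_mul (lintegral_enorm_ne_top (i₂.sub i₄) C₁) fun l => ?_
            rw [Pi.neg_apply, enorm_neg, Pi.mul_apply, enorm_mul, Pi.mul_apply, enorm_mul, mul_comm]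
            exact mul_le_mul' ((mul_le_of_le_one_right' (hle q₃ i₃ l)).trans
              ((hsub q₂ q₄ i₂ i₄ l).trans
                (hC₁ q₂ q₄ i₂ i₄ h₂.lintegral_le h₄.lintegral_le l))) le_rfl
        _ ≤ (C₁ * strongNorm w (q₂ - q₄)) * (C₂ * weakNorm w (q₃ - q₄)) :=
            mul_le_mul' (mul_le_mul' le_rfl (lintegral_enorm_le_strongNorm w _))
              (hC₂ q₃ q₄ h₃ h₄)
        _ = C₁ * C₂ * (weakNorm w (q₃ - q₄) * strongNorm w (q₂ - q₄)) := by ring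
        _ ≤ _ := mul_le_mul' le_rfl (weak_mul_strong_le_fourNorm' w q₁ q₂ q₃ q₄)

/-- A norm-nonincreasing linear functional of the normalized column at the origin is regular. -/
theorem regular_clm_jostVec (hw : IsWeight w) (A : ℂ × ℂ →L[ℂ] ℂ) (hA : ∀ v, ‖A v‖ ≤ ‖v‖) :
    Regular w fun q l => A (jostVec q 0 l) := by
  have hAe : ∀ v, ‖A v‖ₑ ≤ ‖v‖ₑ := fun v => by
    rw [← ofReal_norm, ← ofReal_norm]
    exact ENNReal.ofReal_le_ofReal (hA v)
  refine ⟨fun q _ => A.continuous.comp ((bddCont_jostVec q).continuous_right 0),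
    fun R => ⟨solveConst R, fun q hq hR l => (hAe _).trans (enorm_jostVec_le hq hR 0 l)⟩,
    fun R => ⟨solveConst R * solveConst R, fun q₁ q₂ h₁ h₂ k₁ k₂ l => ?_⟩,
    fun R => ⟨solveConst R * diffConst R, fun q₁ q₂ h₁ h₂ => ?_⟩,
    fun R => ⟨solveConst R * (diffConst R + solveConst R * diffConst R),
      fun q₁ q₂ q₃ q₄ h₁ h₂ h₃ h₄ => ?_⟩⟩
  · rw [← map_sub]
    exact (hAe _).trans (enorm_jostVec_sub_le h₁ h₂ k₁ k₂ 0 l)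
  · refine le_trans (eLpNorm_mono_enorm fun l => ?_)
      (eLpNorm_jostVec_sub_le_weakNorm hw h₁ h₂ le_rfl)
    simp only [Pi.sub_apply]
    rw [← map_sub]
    exact hAe _
  · refine le_trans (eLpNorm_mono_enorm fun l => ?_)
      (eLpNorm_jostVec_sub_sub_le hw h₁ h₂ h₃ h₄)
    simp only [Pi.sub_apply]
    rw [← map_sub, ← map_sub, ← map_sub]
    exact hAe _

/-- The potential of the problem reflected in the origin. -/
def reflectPot (q : ℝ → ℂ) (x : ℝ) : ℂ := -q (-x)

theorem reflectPot_sub (q₁ q₂ : ℝ → ℂ) :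
    reflectPot q₁ - reflectPot q₂ = reflectPot (q₁ - q₂) := by
  funext x; simp only [reflectPot, Pi.sub_apply]; ring

theorem integrable_reflectPot {q : ℝ → ℂ} (hq : Integrable q) : Integrable (reflectPot q) :=
  hq.comp_neg.neg

theorem lintegral_comp_neg (f : ℝ → ℝ≥0∞) : ∫⁻ x, f (-x) = ∫⁻ x, f x :=
  (Measure.measurePreserving_neg (volume : Measure ℝ)).lintegral_comp_emb
    (MeasurableEquiv.neg ℝ).measurableEmbedding f

theorem eLpNorm_two_comp_neg {ε : Type*} [ENorm ε] (f : ℝ → ε) :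
    eLpNorm (fun x => f (-x)) 2 volume = eLpNorm f 2 volume := by
  rw [eLpNorm_two_eq, eLpNorm_two_eq, lintegral_comp_neg fun x => ‖f x‖ₑ ^ 2]

theorem lintegral_reflectPot (q : ℝ → ℂ) : ∫⁻ y, ‖reflectPot q y‖ₑ = ∫⁻ y, ‖q y‖ₑ := by
  simp only [reflectPot, enorm_neg]
  exact lintegral_comp_neg fun y => ‖q y‖ₑ

theorem strongNorm_reflectPot (hw : IsWeight w) (p : ℝ → ℂ) :
    strongNorm w (reflectPot p) = strongNorm w p := by
  rw [strongNorm, strongNorm, lintegral_reflectPot]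
  congr 1
  rw [← eLpNorm_two_comp_neg fun x => w x * ‖p x‖ₑ]
  simp only [reflectPot, enorm_neg, hw.even]

theorem weakNorm_reflectPot (hw : IsWeight w) (p : ℝ → ℂ) :
    weakNorm w (reflectPot p) = weakNorm w p := by
  rw [weakNorm, weakNorm]
  congr 1
  · rw [← eLpNorm_two_comp_neg p, ← eLpNorm_neg]
    congr 1
    funext x
    simp [reflectPot]
  · rw [← lintegral_comp_neg fun y => ‖p y‖ₑ * (w y)⁻¹]
    simp only [reflectPot, enorm_neg, hw.even]

theorem InBall.reflectPot (hw : IsWeight w) {R : ℝ≥0} {q : ℝ → ℂ} (hq : InBall w R q) :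
    InBall w R (reflectPot q) :=
  ⟨(integrable_reflectPot hq.integrable).aestronglyMeasurable,
    (strongNorm_reflectPot hw q).le.trans hq.le⟩

/-- Regularity of the functionals built from the column normalized at `-∞`. -/
theorem Regular.reflect (hw : IsWeight w) (hF : Regular w F) :
    Regular w fun q l => F (reflectPot q) (-l) := by
  refine ⟨fun q hq => (hF.cont _ (integrable_reflectPot hq)).comp continuous_neg, fun R => ?_,
    fun R => ?_, fun R => ?_, fun R => ?_⟩
  · obtain ⟨C, hC⟩ := hF.bdd R
    exact ⟨C, fun q hq hR l => hC _ (integrable_reflectPot hq)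
      ((lintegral_reflectPot q).le.trans hR) _⟩
  · obtain ⟨C, hC⟩ := hF.lipSup R
    refine ⟨C, fun q₁ q₂ h₁ h₂ k₁ k₂ l => ?_⟩
    have := hC _ _ (integrable_reflectPot h₁) (integrable_reflectPot h₂)
      ((lintegral_reflectPot q₁).le.trans k₁) ((lintegral_reflectPot q₂).le.trans k₂) (-l)
    rwa [reflectPot_sub, lintegral_reflectPot] at this
  · obtain ⟨C, hC⟩ := hF.lip R
    refine ⟨C, fun q₁ q₂ h₁ h₂ => ?_⟩
    have := hC _ _ (h₁.reflectPot hw) (h₂.reflectPot hw)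
    rw [reflectPot_sub, weakNorm_reflectPot hw, ← eLpNorm_two_comp_neg] at this
    exact this
  · obtain ⟨C, hC⟩ := hF.four R
    refine ⟨C, fun q₁ q₂ q₃ q₄ h₁ h₂ h₃ h₄ => ?_⟩
    have := hC _ _ _ _ (h₁.reflectPot hw) (h₂.reflectPot hw) (h₃.reflectPot hw)
      (h₄.reflectPot hw)
    simp only [fourNorm, reflectPot_sub, weakNorm_reflectPot hw, strongNorm_reflectPot hw] at this
    rw [← eLpNorm_two_comp_neg] at this
    exact this

end Regular

/-! ### Columns of solutions and their Wronskians -/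

theorem eq_of_absolutelyContinuous_of_deriv_zero {f : ℝ → ℂ}
    (hf : ∀ s t, AbsolutelyContinuousOnInterval f s t) (h : ∀ᵐ x, HasDerivAt f 0 x) (x y : ℝ) :
    f x = f y := by
  obtain ⟨C, hC⟩ := (hf x y).const_of_ae_hasDerivAt_zero (h.mono fun _ h _ => h)
  rw [hC x (by simp), hC y (by simp)]

/-- `(u, v)` is a column of a solution in the interaction picture: it is locally absolutely
continuous and satisfies `u' = q e^{2ilx} v`, `v' = conj q e^{-2ilx} u` almost everywhere. -/
structure IsCol (q : ℝ → ℂ) (l : ℝ) (u v : ℝ → ℂ) : Prop where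
  acFst : ∀ s t, AbsolutelyContinuousOnInterval u s t
  acSnd : ∀ s t, AbsolutelyContinuousOnInterval v s t
  deriv : ∀ᵐ x : ℝ, HasDerivAt u (q x * Complex.exp (2 * Complex.I * (l * x : ℝ)) * v x) x ∧
    HasDerivAt v (star (q x) * Complex.exp (-(2 * Complex.I * (l * x : ℝ))) * u x) x

section Columns

variable {q : ℝ → ℂ} {l : ℝ} {u v u' v' : ℝ → ℂ}

theorem absolutelyContinuousOnInterval_mul {f g : ℝ → ℂ} {s t : ℝ}
    (hf : AbsolutelyContinuousOnInterval f s t)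
    (hg : AbsolutelyContinuousOnInterval g s t) :
    AbsolutelyContinuousOnInterval (fun x => f x * g x) s t := hf.smul hg

/-- The Wronskian of two columns is constant. -/
theorem IsCol.wronskian_eq (h : IsCol q l u v) (h' : IsCol q l u' v') (x y : ℝ) :
    u x * v' x - v x * u' x = u y * v' y - v y * u' y := by
  refine eq_of_absolutelyContinuous_of_deriv_zero (f := fun x => u x * v' x - v x * u' x)
    (fun s t => (absolutelyContinuousOnInterval_mul (h.acFst s t) (h'.acSnd s t)).sub
      (absolutelyContinuousOnInterval_mul (h.acSnd s t) (h'.acFst s t)))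
    ?_ x y
  filter_upwards [h.deriv, h'.deriv] with x h1 h2
  convert! (h1.1.mul h2.2).sub (h1.2.mul h2.1) using 1
  ring

theorem star_exp_two_I_mul (θ : ℝ) :
    star (Complex.exp (2 * Complex.I * θ)) = Complex.exp (-(2 * Complex.I * θ)) := by
  rw [Complex.star_def, ← Complex.exp_conj]
  simp [Complex.conj_ofNat]

theorem star_exp_neg_two_I_mul (θ : ℝ) :
    star (Complex.exp (-(2 * Complex.I * θ))) = Complex.exp (2 * Complex.I * θ) := by
  rw [← star_exp_two_I_mul, star_star]

theorem absolutelyContinuousOnInterval_star {f : ℝ → ℂ} {s t : ℝ}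
    (hf : AbsolutelyContinuousOnInterval f s t) :
    AbsolutelyContinuousOnInterval (fun x => star (f x)) s t :=
  hf.of_dist_le 1 fun a b => by simp

/-- The symmetry exchanging the two columns. -/
theorem IsCol.star (h : IsCol q l u v) :
    IsCol q l (fun x => star (v x)) (fun x => star (u x)) := by
  refine ⟨fun s t => absolutelyContinuousOnInterval_star (h.acSnd s t),
    fun s t => absolutelyContinuousOnInterval_star (h.acFst s t), ?_⟩
  filter_upwards [h.deriv] with x hx
  constructor
  · convert! hx.2.star using 1
    rw [star_mul', star_mul', star_star, star_exp_neg_two_I_mul]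
  · convert! hx.1.star using 1
    rw [star_mul', star_mul', star_exp_two_I_mul]

/-- The Wronskian of a normalized column and its conjugate column is `1`. -/
theorem IsCol.normSq_sub_eq_one (h : IsCol q l u v) {L : Filter ℝ} [L.NeBot]
    (hu : Tendsto u L (𝓝 1)) (hv : Tendsto v L (𝓝 0)) (x : ℝ) :
    u x * Star.star (u x) - v x * Star.star (v x) = 1 := by
  have h1 : Tendsto (fun x => u x * Star.star (u x) - v x * Star.star (v x)) L (𝓝 1) := by
    simpa using (hu.mul hu.star).sub (hv.mul hv.star)
  refine tendsto_nhds_unique (tendsto_const_nhds.congr' ?_) h1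
  exact Eventually.of_forall fun y => h.wronskian_eq h.star x y

end Columns

theorem integrable_fst_coupling {q : ℝ → ℂ} (hq : Integrable q) (l : ℝ) :
    Integrable fun y => -(q y * Complex.exp (2 * Complex.I * (l * y : ℝ)) * (jostVec q y l).2) :=
  (integrable_coupling hq (bddCont_jostVec q) l).fst

theorem integrable_snd_coupling {q : ℝ → ℂ} (hq : Integrable q) (l : ℝ) :
    Integrable fun y =>
      -(star (q y) * Complex.exp (-(2 * Complex.I * (l * y : ℝ))) * (jostVec q y l).1) :=
  (integrable_coupling hq (bddCont_jostVec q) l).snd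

theorem jostVec_fst_eq {q : ℝ → ℂ} (hq : Integrable q) (x l : ℝ) : (jostVec q x l).1
    = 1 + tail (fun y => -(q y * Complex.exp (2 * Complex.I * (l * y : ℝ)) * (jostVec q y l).2)) x
    := by
  have hi := integrable_coupling hq (bddCont_jostVec q) l
  conv_lhs => rw [jostVec_eq hq]
  simp only [Pi.add_apply, Prod.fst_add, unitCol, volterra, tail]
  rw [fst_integral hi.integrableOn]
  simp only [coupling]

theorem jostVec_snd_eq {q : ℝ → ℂ} (hq : Integrable q) (x l : ℝ) : (jostVec q x l).2
    = tail (fun y =>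
      -(star (q y) * Complex.exp (-(2 * Complex.I * (l * y : ℝ))) * (jostVec q y l).1)) x := by
  have hi := integrable_coupling hq (bddCont_jostVec q) l
  conv_lhs => rw [jostVec_eq hq]
  simp only [Pi.add_apply, Prod.snd_add, unitCol, volterra, tail]
  rw [snd_integral hi.integrableOn]
  simp only [coupling, zero_add]

theorem isCol_jostVec {q : ℝ → ℂ} (hq : Integrable q) (l : ℝ) :
    IsCol q l (fun x => (jostVec q x l).1) (fun x => (jostVec q x l).2) := by
  have h1 := integrable_fst_coupling hq l
  have h2 := integrable_snd_coupling hq l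
  have e1 := funext fun x => jostVec_fst_eq hq x l
  have e2 := funext fun x => jostVec_snd_eq hq x l
  refine ⟨fun s t => ?_, fun s t => ?_, ?_⟩
  · rw [e1]
    exact (absolutelyContinuousOnInterval_const 1 s t).add
      (absolutelyContinuousOnInterval_tail h1 s t)
  · rw [e2]
    exact absolutelyContinuousOnInterval_tail h2 s t
  · filter_upwards [ae_hasDerivAt_tail h1, ae_hasDerivAt_tail h2] with x k1 k2
    rw [neg_neg] at k1 k2
    constructor
    · rw [e1]
      exact k1.const_add 1
    · rw [e2]
      exact k2

theorem tendsto_jostVec_fst {q : ℝ → ℂ} (hq : Integrable q) (l : ℝ) :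
    Tendsto (fun x => (jostVec q x l).1) atTop (𝓝 1) := by
  rw [funext fun x => jostVec_fst_eq hq x l]
  simpa using tendsto_tail_atTop.const_add (1 : ℂ)

theorem tendsto_jostVec_snd {q : ℝ → ℂ} (hq : Integrable q) (l : ℝ) :
    Tendsto (fun x => (jostVec q x l).2) atTop (𝓝 0) := by
  rw [funext fun x => jostVec_snd_eq hq x l]
  exact tendsto_tail_atTop

theorem tail_neg_eq {E : Type*} [NormedAddCommGroup E] [NormedSpace ℝ E] {f : ℝ → E}
    (hf : Integrable f) (x : ℝ) : tail f (-x) = (∫ y, f y) - tail (fun y => f (-y)) x := by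
  have h1 : tail (fun y => f (-y)) x = ∫ y in Set.Iic (-x), f y := by
    simp [tail]
  rw [h1, tail, eq_sub_iff_add_eq', intervalIntegral.integral_Iic_add_Ioi hf.integrableOn
    hf.integrableOn]

/-- The column normalized at `-∞`, obtained by reflection. -/
noncomputable def jostVecLeft (q : ℝ → ℂ) (x l : ℝ) : ℂ × ℂ := jostVec (reflectPot q) (-x) (-l)

theorem isCol_jostVecLeft {q : ℝ → ℂ} (hq : Integrable q) (l : ℝ) :
    IsCol q l (fun x => (jostVecLeft q x l).1) (fun x => (jostVecLeft q x l).2) := by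
  have hr := integrable_reflectPot hq
  have h1 := integrable_fst_coupling hr (-l)
  have h2 := integrable_snd_coupling hr (-l)
  have e1 := funext fun x => (jostVec_fst_eq hr (-x) (-l)).trans
    (by rw [tail_neg_eq h1, ← add_sub_assoc])
  have e2 := funext fun x => (jostVec_snd_eq hr (-x) (-l)).trans (tail_neg_eq h2 x)
  refine ⟨fun s t => ?_, fun s t => ?_, ?_⟩
  · simp only [jostVecLeft]
    rw [e1]
    exact (absolutelyContinuousOnInterval_const _ s t).sub
      (absolutelyContinuousOnInterval_tail h1.comp_neg s t)
  · simp only [jostVecLeft]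
    rw [e2]
    exact (absolutelyContinuousOnInterval_const _ s t).sub
      (absolutelyContinuousOnInterval_tail h2.comp_neg s t)
  · filter_upwards [ae_hasDerivAt_tail h1.comp_neg, ae_hasDerivAt_tail h2.comp_neg] with x k1 k2
    simp only [jostVecLeft]
    constructor
    · rw [e1]
      convert! k1.const_sub _ using 1
      simp [reflectPot]
    · rw [e2]
      convert! k2.const_sub _ using 1
      simp [reflectPot]

theorem tendsto_jostVecLeft_fst {q : ℝ → ℂ} (hq : Integrable q) (l : ℝ) :
    Tendsto (fun x => (jostVecLeft q x l).1) atBot (𝓝 1) :=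
  (tendsto_jostVec_fst (integrable_reflectPot hq) (-l)).comp tendsto_neg_atBot_atTop

theorem tendsto_jostVecLeft_snd {q : ℝ → ℂ} (hq : Integrable q) (l : ℝ) :
    Tendsto (fun x => (jostVecLeft q x l).2) atBot (𝓝 0) :=
  (tendsto_jostVec_snd (integrable_reflectPot hq) (-l)).comp tendsto_neg_atBot_atTop

/-! ### From columns to matrix solutions -/

/-- The phase `exp (i lam x)`. -/
noncomputable def cis (lam x : ℝ) : ℂ := Complex.exp (Complex.I * lam * x)

theorem cis_ne_zero (lam x : ℝ) : cis lam x ≠ 0 := Complex.exp_ne_zero _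

theorem exp_neg_eq_inv_cis (lam x : ℝ) :
    Complex.exp (-(Complex.I * lam * x)) = (cis lam x)⁻¹ := Complex.exp_neg _

theorem exp_two_I_eq_cis (lam x : ℝ) :
    Complex.exp (2 * Complex.I * (lam * x : ℝ)) = cis lam x * cis lam x := by
  rw [cis, ← Complex.exp_add]
  congr 1
  push_cast
  ring

theorem exp_neg_two_I_eq_cis (lam x : ℝ) :
    Complex.exp (-(2 * Complex.I * (lam * x : ℝ))) = (cis lam x)⁻¹ * (cis lam x)⁻¹ := by
  rw [Complex.exp_neg, exp_two_I_eq_cis, mul_inv]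

theorem norm_cis (lam x : ℝ) : ‖cis lam x‖ = 1 := by
  rw [cis, show Complex.I * lam * x = ((lam * x : ℝ) : ℂ) * Complex.I by push_cast; ring]
  exact Complex.norm_exp_ofReal_mul_I _

theorem hasDerivAt_cis (lam x : ℝ) :
    HasDerivAt (cis lam) (cis lam x * (Complex.I * lam)) x := by
  have h : HasDerivAt (fun x : ℝ => Complex.I * lam * (x : ℂ)) (Complex.I * lam) x := by
    simpa using (Complex.ofRealCLM.hasDerivAt (x := x)).const_mul (Complex.I * lam)
  exact h.cexp

theorem hasDerivAt_inv_cis (lam x : ℝ) :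
    HasDerivAt (fun x => (cis lam x)⁻¹) (-((cis lam x)⁻¹ * (Complex.I * lam))) x := by
  convert! (hasDerivAt_cis lam x).inv (cis_ne_zero lam x) using 1
  have := cis_ne_zero lam x
  field_simp

theorem contDiff_cis (lam : ℝ) : ContDiff ℝ 1 (cis lam) := by
  unfold cis
  exact ((contDiff_const.mul Complex.ofRealCLM.contDiff).cexp)

theorem absolutelyContinuousOnInterval_cis (lam s t : ℝ) :
    AbsolutelyContinuousOnInterval (cis lam) s t :=
  (contDiff_cis lam).contDiffOn.absolutelyContinuousOnInterval

theorem absolutelyContinuousOnInterval_inv_cis (lam s t : ℝ) :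
    AbsolutelyContinuousOnInterval (fun x => (cis lam x)⁻¹) s t :=
  ((contDiff_cis lam).inv fun x => cis_ne_zero lam x).contDiffOn.absolutelyContinuousOnInterval

/-- Passing to the interaction picture: multiplying by `exp (i lam x σ₃)` turns solutions into pairs of
columns. -/
theorem isSolution_iff (q : ℝ → ℂ) (lam : ℝ) (psi : ℝ → Matrix (Fin 2) (Fin 2) ℂ) :
    IsSolution q lam psi ↔
      ∀ j, IsCol q lam (fun x => cis lam x * psi x 0 j) (fun x => (cis lam x)⁻¹ * psi x 1 j) := by
  constructor
  · rintro ⟨hac, hd⟩ j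
    refine ⟨fun s t => absolutelyContinuousOnInterval_mul
        (absolutelyContinuousOnInterval_cis lam s t) (hac 0 j s t),
      fun s t => absolutelyContinuousOnInterval_mul
        (absolutelyContinuousOnInterval_inv_cis lam s t) (hac 1 j s t), ?_⟩
    filter_upwards [hd] with x ⟨D, hD, heq⟩
    have h0 := congrFun (congrFun heq 0) j
    have h1 := congrFun (congrFun heq 1) j
    simp [sigma3, potential, Matrix.vecMul, dotProduct, Fin.sum_univ_two] at h0 h1
    have hI := Complex.I_mul_I
    have h0' : D 0 j = -(Complex.I * lam) * psi x 0 j + q x * psi x 1 j := by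
      linear_combination (-Complex.I) * h0 + (D 0 j - q x * psi x 1 j) * hI
    have h1' : D 1 j = Complex.I * lam * psi x 1 j + star (q x) * psi x 0 j := by
      rw [Complex.star_def]
      linear_combination Complex.I * h1 + (D 1 j - (starRingEnd ℂ) (q x) * psi x 0 j) * hI
    have hc := cis_ne_zero lam x
    constructor
    · convert! (hasDerivAt_cis lam x).mul (hD 0 j) using 1
      rw [h0', exp_two_I_eq_cis]
      field_simp
      ring
    · convert! (hasDerivAt_inv_cis lam x).mul (hD 1 j) using 1
      rw [h1', exp_neg_two_I_eq_cis]
      field_simp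
      ring
  · intro h
    have e0 : ∀ j, (fun x => psi x 0 j) = fun x => (cis lam x)⁻¹ * (cis lam x * psi x 0 j) :=
      fun j => funext fun x => by rw [inv_mul_cancel_left₀ (cis_ne_zero lam x)]
    have e1 : ∀ j, (fun x => psi x 1 j) = fun x => cis lam x * ((cis lam x)⁻¹ * psi x 1 j) :=
      fun j => funext fun x => by rw [mul_inv_cancel_left₀ (cis_ne_zero lam x)]
    refine ⟨fun i j s t => ?_, ?_⟩
    · fin_cases i
      · simp only [Fin.zero_eta]
        rw [e0 j]
        exact absolutelyContinuousOnInterval_mul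
          (absolutelyContinuousOnInterval_inv_cis lam s t) ((h j).acFst s t)
      · simp only [Fin.mk_one]
        rw [e1 j]
        exact absolutelyContinuousOnInterval_mul
          (absolutelyContinuousOnInterval_cis lam s t) ((h j).acSnd s t)
    · filter_upwards [ae_all_iff.2 fun j => (h j).deriv] with x hx
      have hc := cis_ne_zero lam x
      have d0 : ∀ j, HasDerivAt (fun x => psi x 0 j)
          (-(Complex.I * lam) * psi x 0 j + q x * psi x 1 j) x := fun j => by
        rw [e0 j]
        convert! (hasDerivAt_inv_cis lam x).mul (hx j).1 using 1
        rw [exp_two_I_eq_cis]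
        field_simp
      have d1 : ∀ j, HasDerivAt (fun x => psi x 1 j)
          (Complex.I * lam * psi x 1 j + star (q x) * psi x 0 j) x := fun j => by
        rw [e1 j]
        convert! (hasDerivAt_cis lam x).mul (hx j).2 using 1
        rw [exp_neg_two_I_eq_cis]
        field_simp
      refine ⟨Matrix.of ![fun j => -(Complex.I * lam) * psi x 0 j + q x * psi x 1 j,
        fun j => Complex.I * lam * psi x 1 j + star (q x) * psi x 0 j], fun i j => ?_, ?_⟩
      · fin_cases i
        · exact d0 j
        · exact d1 j
      · have hI := Complex.I_mul_I
        ext i j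
        fin_cases i
        · simp [sigma3, potential, Matrix.vecMul, dotProduct, Fin.sum_univ_two]
          linear_combination (-(lam : ℂ) * psi x 0 j) * hI
        · simp [sigma3, potential, Matrix.vecMul, dotProduct, Fin.sum_univ_two]
          linear_combination (-(lam : ℂ) * psi x 1 j) * hI

/-! ### Existence and uniqueness of the Jost solutions -/

theorem exp_eq_cis (lam x : ℝ) : Complex.exp (Complex.I * lam * x) = cis lam x := rfl

/-- A column normalized to `(1, 0)` along the filter `L`. -/
structure IsNormalized (L : Filter ℝ) (q : ℝ → ℂ) (l : ℝ) (a b : ℝ → ℂ) : Prop where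
  isCol : IsCol q l a b
  fst : Tendsto a L (𝓝 1)
  snd : Tendsto b L (𝓝 0)

section Normalized

variable {q : ℝ → ℂ} {l : ℝ} {L : Filter ℝ} {a b u v u' v' : ℝ → ℂ}

theorem IsCol.sub (h : IsCol q l u v) (h' : IsCol q l u' v') :
    IsCol q l (fun x => u x - u' x) (fun x => v x - v' x) := by
  refine ⟨fun s t => (h.acFst s t).sub (h'.acFst s t),
    fun s t => (h.acSnd s t).sub (h'.acSnd s t), ?_⟩
  filter_upwards [h.deriv, h'.deriv] with x h1 h2
  exact ⟨by convert! h1.1.sub h2.1 using 1; ring, by convert! h1.2.sub h2.2 using 1; ring⟩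

theorem IsNormalized.mul_star_sub_eq_one [L.NeBot] (h : IsNormalized L q l a b) (x : ℝ) :
    a x * star (a x) - b x * star (b x) = 1 := h.isCol.normSq_sub_eq_one h.fst h.snd x

/-- The Wronskians of `(u, v)` with the two columns of a fundamental system tend to `0` along `L`,
hence vanish identically; Cramer's rule then gives `u = v = 0`. -/
theorem IsCol.eq_zero_of_tendsto [L.NeBot] (hab : IsNormalized L q l a b) (h : IsCol q l u v)
    (hu : Tendsto u L (𝓝 0)) (hv : Tendsto v L (𝓝 0)) (x : ℝ) : u x = 0 ∧ v x = 0 := by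
  have h1 : u x * b x - v x * a x = 0 := by
    have : Tendsto (fun y => u y * b y - v y * a y) L (𝓝 0) := by
      simpa using (hu.mul hab.snd).sub (hv.mul hab.fst)
    exact tendsto_nhds_unique (tendsto_const_nhds.congr fun y => h.wronskian_eq hab.isCol x y) this
  have h2 : u x * Star.star (a x) - v x * Star.star (b x) = 0 := by
    have : Tendsto (fun y => u y * Star.star (a y) - v y * Star.star (b y)) L (𝓝 0) := by
      simpa using (hu.mul hab.fst.star).sub (hv.mul hab.snd.star)
    exact tendsto_nhds_unique
      (tendsto_const_nhds.congr fun y => h.wronskian_eq hab.isCol.star x y) this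
  have h3 := hab.mul_star_sub_eq_one x
  constructor
  · linear_combination a x * h2 - Star.star (b x) * h1 - u x * h3
  · linear_combination b x * h2 - Star.star (a x) * h1 - v x * h3

/-- A column is determined by its limits along `L`. -/
theorem IsCol.eq_of_tendsto [L.NeBot] (hab : IsNormalized L q l a b) (h : IsCol q l u v)
    (h' : IsCol q l u' v') {c d : ℂ} (hu : Tendsto u L (𝓝 c)) (hv : Tendsto v L (𝓝 d))
    (hu' : Tendsto u' L (𝓝 c)) (hv' : Tendsto v' L (𝓝 d)) (x : ℝ) : u x = u' x ∧ v x = v' x := by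
  have := (h.sub h').eq_zero_of_tendsto hab (by simpa using hu.sub hu') (by simpa using hv.sub hv') x
  exact ⟨sub_eq_zero.1 this.1, sub_eq_zero.1 this.2⟩

theorem IsNormalized.unique [L.NeBot] (h : IsNormalized L q l u v) (h' : IsNormalized L q l u' v')
    (x : ℝ) : u x = u' x ∧ v x = v' x :=
  h.isCol.eq_of_tendsto h h'.isCol h.fst h.snd h'.fst h'.snd x

theorem isNormalized_jostVec (hq : Integrable q) (l : ℝ) :
    IsNormalized atTop q l (fun x => (jostVec q x l).1) (fun x => (jostVec q x l).2) :=
  ⟨isCol_jostVec hq l, tendsto_jostVec_fst hq l, tendsto_jostVec_snd hq l⟩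

theorem isNormalized_jostVecLeft (hq : Integrable q) (l : ℝ) :
    IsNormalized atBot q l (fun x => (jostVecLeft q x l).1) (fun x => (jostVecLeft q x l).2) :=
  ⟨isCol_jostVecLeft hq l, tendsto_jostVecLeft_fst hq l, tendsto_jostVecLeft_snd hq l⟩

/-- The matrix solution whose first column in the interaction picture is `(a, b)`. -/
noncomputable def colMatrix (lam : ℝ) (a b : ℝ → ℂ) (x : ℝ) : Matrix (Fin 2) (Fin 2) ℂ :=
  !![(cis lam x)⁻¹ * a x, (cis lam x)⁻¹ * star (b x); cis lam x * b x, cis lam x * star (a x)]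

theorem tendsto_zero_of_norm_eq {f g : ℝ → ℂ} (h : ∀ x, ‖g x‖ = ‖f x‖) (hf : Tendsto f L (𝓝 0)) :
    Tendsto g L (𝓝 0) := by
  rw [tendsto_zero_iff_norm_tendsto_zero] at hf ⊢
  simpa only [h] using hf

theorem IsNormalized.isJost (h : IsNormalized L q l a b) : IsJost L q l (colMatrix l a b) := by
  have hc := cis_ne_zero l
  constructor
  · rw [isSolution_iff]
    intro j
    fin_cases j
    · simpa [colMatrix, hc] using h.isCol
    · simpa [colMatrix, hc] using h.isCol.star
  · refine tendsto_pi_nhds.2 fun i => tendsto_pi_nhds.2 fun j => ?_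
    simp only [phase, Matrix.mul_diagonal, exp_neg_eq_inv_cis]
    fin_cases i <;> fin_cases j <;> simp only [colMatrix, exp_eq_cis, Fin.zero_eta, Fin.mk_one,
      Matrix.of_apply, Matrix.cons_val', Matrix.cons_val_zero, Matrix.cons_val_one,
      Matrix.cons_val_fin_one, Matrix.one_apply_eq, ne_eq, zero_ne_one, not_false_eq_true,
      Matrix.one_apply_ne, one_ne_zero]
    · refine h.fst.congr fun x => ?_
      have := hc x
      field_simp
    · exact tendsto_zero_of_norm_eq (fun x => by simp [norm_cis]) h.snd
    · exact tendsto_zero_of_norm_eq (fun x => by simp [norm_cis]) h.snd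
    · have := h.fst.star
      rw [star_one] at this
      refine this.congr fun x => ?_
      have := hc x
      field_simp

theorem IsNormalized.eq_of_isJost [L.NeBot] (h : IsNormalized L q l a b)
    {psi : ℝ → Matrix (Fin 2) (Fin 2) ℂ} (hpsi : IsJost L q l psi) : psi = colMatrix l a b := by
  obtain ⟨hs, ht⟩ := hpsi
  rw [isSolution_iff] at hs
  have hc := cis_ne_zero l
  have ht' := fun i j => tendsto_pi_nhds.1 (tendsto_pi_nhds.1 ht i) j
  simp only [phase, Matrix.mul_diagonal, exp_neg_eq_inv_cis, exp_eq_cis] at ht'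
  have h00 := ht' 0 0
  have h01 := ht' 0 1
  have h10 := ht' 1 0
  have h11 := ht' 1 1
  simp only [Matrix.cons_val_zero, Matrix.cons_val_one, Matrix.cons_val_fin_one,
    Matrix.one_apply_eq, ne_eq, zero_ne_one, not_false_eq_true, Matrix.one_apply_ne,
    one_ne_zero] at h00 h01 h10 h11
  have hfst := fun x => (hs 0).eq_of_tendsto h h.isCol (h00.congr fun x => mul_comm _ _)
    (tendsto_zero_of_norm_eq (fun x => by simp [norm_cis]) h10) h.fst h.snd x
  have hsnd := fun x => (hs 1).eq_of_tendsto h h.isCol.star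
    (tendsto_zero_of_norm_eq (fun x => by simp [norm_cis]) h01) (h11.congr fun x => mul_comm _ _)
    (by simpa using h.snd.star) (by simpa using h.fst.star) x
  funext x
  have hcx := hc x
  ext i j
  fin_cases i <;> fin_cases j <;> simp [colMatrix]
  · rw [← (hfst x).1, inv_mul_cancel_left₀ hcx]
  · rw [← Complex.star_def, ← (hsnd x).1, inv_mul_cancel_left₀ hcx]
  · rw [← (hfst x).2, mul_inv_cancel_left₀ hcx]
  · rw [← Complex.star_def, ← (hsnd x).2, mul_inv_cancel_left₀ hcx]

theorem IsNormalized.existsUnique [L.NeBot] (h : IsNormalized L q l a b) :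
    ∃! psi, IsJost L q l psi :=
  ⟨_, h.isJost, fun _ hpsi => h.eq_of_isJost hpsi⟩

theorem IsNormalized.det_colMatrix [L.NeBot] (h : IsNormalized L q l a b) (x : ℝ) :
    (colMatrix l a b x).det = 1 := by
  have hc := cis_ne_zero l x
  rw [← h.mul_star_sub_eq_one x, colMatrix, Matrix.det_fin_two_of]
  field_simp

end Normalized

/-! ### The scattering coefficients as Wronskians -/

/-- The coefficient `a` in terms of the values of the two normalized columns at one point. -/
noncomputable def pairA (p m : ℂ × ℂ) : ℂ := star m.1 * p.1 - star m.2 * p.2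

/-- The coefficient `b` in terms of the values of the two normalized columns at one point. -/
noncomputable def pairB (p m : ℂ × ℂ) : ℂ := m.1 * p.2 - m.2 * p.1

/-- The transition matrix with first column `(A, B)`. -/
noncomputable def pairMatrix (A B : ℂ) : Matrix (Fin 2) (Fin 2) ℂ := !![A, star B; B, star A]

section Transition

variable {q : ℝ → ℂ} {l : ℝ} {a b c d : ℝ → ℂ}

theorem pairA_eq (h : IsCol q l a b) (h' : IsCol q l c d) (x y : ℝ) :
    pairA (a x, b x) (c x, d x) = pairA (a y, b y) (c y, d y) := by
  have := h.wronskian_eq h'.star x y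
  simp only [pairA]
  linear_combination this

theorem pairB_eq (h : IsCol q l a b) (h' : IsCol q l c d) (x y : ℝ) :
    pairB (a x, b x) (c x, d x) = pairB (a y, b y) (c y, d y) := by
  have := h'.wronskian_eq h x y
  simp only [pairB]
  linear_combination this

theorem colMatrix_eq_mul (h : IsCol q l a b) (h' : IsNormalized atBot q l c d) (x : ℝ) :
    colMatrix l a b x = colMatrix l c d x *
      pairMatrix (pairA (a 0, b 0) (c 0, d 0)) (pairB (a 0, b 0) (c 0, d 0)) := by
  rw [pairA_eq h h'.isCol 0 x, pairB_eq h h'.isCol 0 x]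
  have h1 := h'.mul_star_sub_eq_one x
  ext i j
  fin_cases i <;> fin_cases j <;>
    simp only [colMatrix, pairMatrix, pairA, pairB, Fin.zero_eta, Fin.mk_one, Matrix.mul_apply,
      Fin.sum_univ_two, Matrix.of_apply, Matrix.cons_val', Matrix.cons_val_zero,
      Matrix.cons_val_one, Matrix.cons_val_fin_one, star_sub, star_mul', star_star]
  · linear_combination -(cis l x)⁻¹ * a x * h1
  · linear_combination -(cis l x)⁻¹ * star (b x) * h1
  · linear_combination -(cis l x) * b x * h1
  · linear_combination -(cis l x) * star (a x) * h1

/-- The coefficient `a` in terms of the normalized columns at the origin. -/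
noncomputable def wronA (q : ℝ → ℂ) (l : ℝ) : ℂ := pairA (jostVec q 0 l) (jostVecLeft q 0 l)

/-- The coefficient `b` in terms of the normalized columns at the origin. -/
noncomputable def wronB (q : ℝ → ℂ) (l : ℝ) : ℂ := pairB (jostVec q 0 l) (jostVecLeft q 0 l)

/-- Evaluating at the origin determines the transition matrix, because Jost solutions are
invertible. -/
theorem IsTransition.eq (hq : Integrable q) {T : Matrix (Fin 2) (Fin 2) ℂ}
    (hT : IsTransition q l T) : T = pairMatrix (wronA q l) (wronB q l) := by
  obtain ⟨p, m, hp, hm, h⟩ := hT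
  have h1 := isNormalized_jostVec hq l
  have h2 := isNormalized_jostVecLeft hq l
  rw [h1.eq_of_isJost hp, h2.eq_of_isJost hm] at h
  have hu : IsUnit (colMatrix l (fun x => (jostVecLeft q x l).1)
      (fun x => (jostVecLeft q x l).2) 0) := by
    rw [Matrix.isUnit_iff_isUnit_det, h2.det_colMatrix]
    exact isUnit_one
  exact hu.mul_left_cancel ((h 0).symm.trans (colMatrix_eq_mul h1.isCol h2 0))

theorem isTransition (hq : Integrable q) (l : ℝ) :
    IsTransition q l (pairMatrix (wronA q l) (wronB q l)) :=
  ⟨_, _, (isNormalized_jostVec hq l).isJost, (isNormalized_jostVecLeft hq l).isJost, fun x =>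
    colMatrix_eq_mul (isCol_jostVec hq l) (isNormalized_jostVecLeft hq l) x⟩

theorem existsUnique_isTransition (hq : Integrable q) (l : ℝ) : ∃! T, IsTransition q l T :=
  ⟨_, isTransition hq l, fun _ hT => hT.eq hq⟩

theorem transition_eq (hq : Integrable q) (l : ℝ) :
    transition q l = pairMatrix (wronA q l) (wronB q l) :=
  (Classical.epsilon_spec ⟨_, isTransition hq l⟩ : IsTransition q l (transition q l)).eq hq

theorem coeffA_eq (hq : Integrable q) (l : ℝ) : coeffA q l = wronA q l := by
  rw [coeffA, transition_eq hq, pairMatrix]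
  rfl

theorem coeffB_eq (hq : Integrable q) (l : ℝ) : coeffB q l = wronB q l := by
  rw [coeffB, transition_eq hq, pairMatrix]
  rfl

theorem wronA_mul_star_sub (hq : Integrable q) (l : ℝ) :
    wronA q l * star (wronA q l) - wronB q l * star (wronB q l) = 1 := by
  have h1 := (isNormalized_jostVec hq l).mul_star_sub_eq_one 0
  have h2 := (isNormalized_jostVecLeft hq l).mul_star_sub_eq_one 0
  simp only [wronA, wronB, pairA, pairB, star_sub, star_mul', star_star]
  linear_combination h1 + ((jostVec q 0 l).1 * star (jostVec q 0 l).1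
    - (jostVec q 0 l).2 * star (jostVec q 0 l).2) * h2

/-- The identity `|a|² - |b|² = 1`. -/
theorem sq_norm_wronA_sub (hq : Integrable q) (l : ℝ) :
    ‖wronA q l‖ ^ 2 - ‖wronB q l‖ ^ 2 = 1 := by
  have := wronA_mul_star_sub hq l
  rw [Complex.star_def, Complex.mul_conj', Complex.mul_conj'] at this
  exact_mod_cast this

theorem one_le_norm_wronA (hq : Integrable q) (l : ℝ) : 1 ≤ ‖wronA q l‖ := by
  nlinarith [sq_norm_wronA_sub hq l, norm_nonneg (wronA q l), sq_nonneg ‖wronB q l‖]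

theorem reflection_eq (hq : Integrable q) (l : ℝ) :
    reflection q l = -wronB q l / star (wronA q l) := by
  rw [reflection, coeffA_eq hq, coeffB_eq hq]

theorem sq_norm_reflection (hq : Integrable q) (l : ℝ) :
    ‖reflection q l‖ ^ 2 = 1 - (‖wronA q l‖ ^ 2)⁻¹ := by
  have h1 := one_le_norm_wronA hq l
  rw [reflection_eq hq, norm_div, norm_neg, norm_star, div_pow, eq_sub_iff_add_eq, ← one_div,
    ← add_div, div_eq_one_iff_eq (by positivity)]
  linarith [sq_norm_wronA_sub hq l]

theorem norm_reflection_lt_one (hq : Integrable q) (l : ℝ) : ‖reflection q l‖ < 1 := by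
  have h1 := one_le_norm_wronA hq l
  have h2 := sq_norm_reflection hq l
  have h3 : 0 < (‖wronA q l‖ ^ 2)⁻¹ := by positivity
  nlinarith [norm_nonneg (reflection q l)]

end Transition

/-! ### Regularity of the reflection coefficient -/

section Reflection

variable {w : ℝ → ℝ≥0∞}

theorem regular_wronA (hw : IsWeight w) : Regular w wronA := by
  have h1 := regular_clm_jostVec hw (ContinuousLinearMap.fst ℂ ℂ ℂ) fun v => norm_fst_le v
  have h2 := regular_clm_jostVec hw (ContinuousLinearMap.snd ℂ ℂ ℂ) fun v => norm_snd_le v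
  have := ((h1.reflect hw).star.mul h1).sub ((h2.reflect hw).star.mul h2)
  simp only [ContinuousLinearMap.coe_fst', ContinuousLinearMap.coe_snd'] at this
  unfold wronA pairA jostVecLeft
  simpa using this

/-- The reflection coefficient in terms of the normalized columns at the origin. -/
noncomputable def wronR (q : ℝ → ℂ) (l : ℝ) : ℂ :=
  ((jostVecLeft q 0 l).2 * (jostVec q 0 l).1 - (jostVecLeft q 0 l).1 * (jostVec q 0 l).2)
    * (star (wronA q l))⁻¹

theorem reflection_eq_wronR {q : ℝ → ℂ} (hq : Integrable q) : reflection q = wronR q := by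
  funext l
  rw [reflection_eq hq, wronB, pairB, neg_sub, div_eq_mul_inv, wronR]

/-- The reflection coefficient is a regular functional of the potential, because `|a| ≥ 1`. -/
theorem regular_wronR (hw : IsWeight w) : Regular w wronR := by
  have h1 := regular_clm_jostVec hw (ContinuousLinearMap.fst ℂ ℂ ℂ) fun v => norm_fst_le v
  have h2 := regular_clm_jostVec hw (ContinuousLinearMap.snd ℂ ℂ ℂ) fun v => norm_snd_le v
  have := ((h2.reflect hw).mul h1).sub ((h1.reflect hw).mul h2)
  simp only [ContinuousLinearMap.coe_fst', ContinuousLinearMap.coe_snd'] at this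
  unfold wronR
  refine Regular.mul ?_ ((regular_wronA hw).star.inv fun q hq l => ?_)
  · unfold jostVecLeft
    simpa using this
  · rw [norm_star]
    exact one_le_norm_wronA hq l

end Reflection

/-! ### Covariance under modulation and translation -/

section Covariance

variable {q : ℝ → ℂ} {L : Filter ℝ} {a b : ℝ → ℂ}

theorem absolutelyContinuousOnInterval_translate {f : ℝ → ℂ}
    (hf : ∀ s t, AbsolutelyContinuousOnInterval f s t) (h s t : ℝ) :
    AbsolutelyContinuousOnInterval (fun x => f (x + h)) s t := by
  rw [absolutelyContinuousOnInterval_iff]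
  intro ε hε
  obtain ⟨δ, hδ, H⟩ := (absolutelyContinuousOnInterval_iff _ _ _).1 (hf (s + h) (t + h)) ε hε
  refine ⟨δ, hδ, fun E hE hd =>
    H (E.1, fun i => ((E.2 i).1 + h, (E.2 i).2 + h)) ⟨fun i hi => ?_, ?_⟩ (by simpa using hd)⟩
  · have := hE.1 i hi
    simp only [Set.mem_uIcc, add_le_add_iff_right] at this ⊢
    exact this
  · intro i hi j hj hij
    have := hE.2 hi hj hij
    simp only [Function.onFun, Set.disjoint_left, Set.mem_uIoc] at this ⊢
    intro x hx hx'
    exact @this (x - h) (by grind) (by grind)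

/-- Modulation of the potential. -/
noncomputable def modulate (h : ℝ) (q : ℝ → ℂ) (x : ℝ) : ℂ :=
  Complex.exp (2 * Complex.I * (h * x : ℝ)) * q x

theorem norm_modulate (h : ℝ) (q : ℝ → ℂ) (x : ℝ) : ‖modulate h q x‖ = ‖q x‖ := by
  rw [modulate, norm_mul, norm_exp_two_I_mul, one_mul]

theorem continuous_exp_two_I_mul (h : ℝ) :
    Continuous fun x : ℝ => Complex.exp (2 * Complex.I * (h * x : ℝ)) := by fun_prop

theorem aestronglyMeasurable_modulate (h : ℝ) (hq : AEStronglyMeasurable q volume) :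
    AEStronglyMeasurable (modulate h q) volume :=
  (continuous_exp_two_I_mul h).aestronglyMeasurable.mul hq

theorem integrable_modulate (h : ℝ) (hq : Integrable q) : Integrable (modulate h q) :=
  hq.mono (aestronglyMeasurable_modulate h hq.aestronglyMeasurable)
    (Eventually.of_forall fun x => (norm_modulate h q x).le)

theorem IsNormalized.modulate {l h : ℝ} (hn : IsNormalized L q (l + h) a b) :
    IsNormalized L (modulate h q) l a b := by
  refine ⟨⟨hn.isCol.acFst, hn.isCol.acSnd, ?_⟩, hn.fst, hn.snd⟩
  filter_upwards [hn.isCol.deriv] with x hx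
  have e1 : Complex.exp (2 * Complex.I * ((l + h) * x : ℝ))
      = Complex.exp (2 * Complex.I * (h * x : ℝ)) * Complex.exp (2 * Complex.I * (l * x : ℝ)) := by
    rw [← Complex.exp_add]
    congr 1
    push_cast
    ring
  constructor
  · convert! hx.1 using 1
    rw [e1, ZSAKNS.modulate]
    ring
  · convert! hx.2 using 1
    rw [ZSAKNS.modulate, star_mul', ← star_exp_two_I_mul, ← star_exp_two_I_mul, e1, star_mul']
    ring

theorem jostVec_modulate (hq : Integrable q) (h x l : ℝ) :
    jostVec (modulate h q) x l = jostVec q x (l + h) := by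
  have := (isNormalized_jostVec (integrable_modulate h hq) l).unique
    (isNormalized_jostVec hq (l + h)).modulate x
  exact Prod.ext this.1 this.2

theorem jostVecLeft_modulate (hq : Integrable q) (h x l : ℝ) :
    jostVecLeft (modulate h q) x l = jostVecLeft q x (l + h) := by
  have := (isNormalized_jostVecLeft (integrable_modulate h hq) l).unique
    (isNormalized_jostVecLeft hq (l + h)).modulate x
  exact Prod.ext this.1 this.2

/-- Modulation of the potential shifts the spectral parameter. -/
theorem wronR_modulate (hq : Integrable q) (h l : ℝ) :
    wronR (modulate h q) l = wronR q (l + h) := by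
  simp only [wronR, wronA, jostVec_modulate hq, jostVecLeft_modulate hq]

theorem IsNormalized.translate {l : ℝ} (hn : IsNormalized L q l a b) (h : ℝ)
    (hL : Tendsto (fun x => x + h) L L) :
    IsNormalized L (fun x => q (x + h)) l (fun x => a (x + h))
      (fun x => Complex.exp (2 * Complex.I * (l * h : ℝ)) * b (x + h)) := by
  refine ⟨⟨absolutelyContinuousOnInterval_translate hn.isCol.acFst h,
    fun s t => absolutelyContinuousOnInterval_mul (absolutelyContinuousOnInterval_const _ s t)
      (absolutelyContinuousOnInterval_translate hn.isCol.acSnd h s t), ?_⟩,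
    hn.fst.comp hL, tendsto_zero_of_norm_eq
      (fun x => by rw [norm_mul, norm_exp_two_I_mul, one_mul, Function.comp_apply]) (hn.snd.comp hL)⟩
  filter_upwards [(measurePreserving_add_right volume h).quasiMeasurePreserving.ae
    hn.isCol.deriv] with x hx
  have e1 : Complex.exp (2 * Complex.I * (l * (x + h) : ℝ))
      = Complex.exp (2 * Complex.I * (l * x : ℝ)) * Complex.exp (2 * Complex.I * (l * h : ℝ)) := by
    rw [← Complex.exp_add]
    congr 1
    push_cast
    ring
  have h0 : Complex.exp (2 * Complex.I * (l * h : ℝ)) ≠ 0 := Complex.exp_ne_zero _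
  constructor
  · convert! hx.1.comp_add_const x h using 1
    rw [e1]
    ring
  · convert! (hx.2.comp_add_const x h).const_mul _ using 1
    rw [Complex.exp_neg, Complex.exp_neg, e1]
    field_simp

theorem jostVec_translate (hq : Integrable q) (h x l : ℝ) :
    jostVec (fun x => q (x + h)) x l = ((jostVec q (x + h) l).1,
      Complex.exp (2 * Complex.I * (l * h : ℝ)) * (jostVec q (x + h) l).2) := by
  have := (isNormalized_jostVec (hq.comp_add_right h) l).unique
    ((isNormalized_jostVec hq l).translate h (tendsto_atTop_add_const_right _ h tendsto_id)) x
  exact Prod.ext this.1 this.2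

theorem jostVecLeft_translate (hq : Integrable q) (h x l : ℝ) :
    jostVecLeft (fun x => q (x + h)) x l = ((jostVecLeft q (x + h) l).1,
      Complex.exp (2 * Complex.I * (l * h : ℝ)) * (jostVecLeft q (x + h) l).2) := by
  have := (isNormalized_jostVecLeft (hq.comp_add_right h) l).unique
    ((isNormalized_jostVecLeft hq l).translate h (tendsto_atBot_add_const_right _ h tendsto_id)) x
  exact Prod.ext this.1 this.2

/-- Translation of the potential modulates the reflection coefficient. -/
theorem wronR_translate (hq : Integrable q) (h l : ℝ) :
    wronR (fun x => q (x + h)) l = Complex.exp (2 * Complex.I * (l * h : ℝ)) * wronR q l := by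
  have hA := pairA_eq (isCol_jostVec hq l) (isCol_jostVecLeft hq l) (0 + h) 0
  have hB := pairB_eq (isCol_jostVec hq l) (isCol_jostVecLeft hq l) (0 + h) 0
  have he : star (Complex.exp (2 * Complex.I * (l * h : ℝ)))
      * Complex.exp (2 * Complex.I * (l * h : ℝ)) = 1 := by
    rw [Complex.star_def, Complex.conj_mul', norm_exp_two_I_mul]
    simp
  have hA' : wronA (fun x => q (x + h)) l = wronA q l := by
    rw [wronA, jostVec_translate hq, jostVecLeft_translate hq]
    simp only [pairA, wronA] at hA ⊢
    rw [← hA, star_mul']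
    linear_combination (-(star (jostVecLeft q (0 + h) l).2 * (jostVec q (0 + h) l).2)) * he
  rw [wronR, wronR, hA', jostVec_translate hq, jostVecLeft_translate hq]
  simp only [pairB] at hB
  linear_combination (-(Complex.exp (2 * Complex.I * (l * h : ℝ)) * (star (wronA q l))⁻¹)) * hB

end Covariance

/-! ### Weak derivatives and difference quotients -/

section WeakDerivative

variable {f g : ℝ → ℂ}

theorem integrable_smul_test (hf : LocallyIntegrable f) {φ : ℝ → ℝ} (hφ : Continuous φ)
    (hc : HasCompactSupport φ) : Integrable fun x => φ x • f x :=
  hf.integrable_smul_left_of_hasCompactSupport hφ hc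

theorem hasCompactSupport_comp_sub {φ : ℝ → ℝ} (hc : HasCompactSupport φ) (h : ℝ) :
    HasCompactSupport fun x => φ (x - h) :=
  hc.comp_homeomorph (Homeomorph.subRight h)

theorem integrable_smul_test_translate (hf : LocallyIntegrable f) {φ : ℝ → ℝ} (hφ : Continuous φ)
    (hc : HasCompactSupport φ) (h : ℝ) : Integrable fun x => φ x • f (x + h) := by
  have h2 : Integrable fun x => φ (x - h) • f x :=
    integrable_smul_test hf (hφ.comp (continuous_sub_right h)) (hasCompactSupport_comp_sub hc h)
  simpa using h2.comp_add_right h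

theorem integral_smul_translate_sub (hf : LocallyIntegrable f) {φ : ℝ → ℝ} (hφ : Continuous φ)
    (hc : HasCompactSupport φ) (h : ℝ) :
    ∫ x, φ x • (f (x + h) - f x) = ∫ x, (φ (x - h) - φ x) • f x := by
  have h1 := integrable_smul_test hf hφ hc
  have h2 : Integrable fun x => φ (x - h) • f x :=
    integrable_smul_test hf (hφ.comp (continuous_sub_right h)) (hasCompactSupport_comp_sub hc h)
  simp only [smul_sub, sub_smul]
  rw [integral_sub (integrable_smul_test_translate hf hφ hc h) h1, integral_sub h2 h1]
  congr 1
  rw [← integral_add_right_eq_self (fun x => φ (x - h) • f x) h]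
  simp

theorem absolutelyContinuousOnInterval_primitive (hg : LocallyIntegrable g) (s t : ℝ) :
    AbsolutelyContinuousOnInterval (fun x => ∫ y in (0 : ℝ)..x, g y) s t := by
  have hi : ∀ a b, IntervalIntegrable g volume a b := fun a b =>
    (hg.integrableOn_isCompact isCompact_uIcc).intervalIntegrable
  have h1 : AbsolutelyContinuousOnInterval (fun x => ∫ y in s..x, ‖g y‖) s t :=
    (hi s t).norm.absolutelyContinuousOnInterval_intervalIntegral (by simp)
  refine h1.of_dist_le 1 fun u v => ?_
  rw [one_mul, dist_comm, dist_comm (∫ y in s..u, ‖g y‖), dist_eq_norm, Real.dist_eq,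
    intervalIntegral.integral_interval_sub_left (hi _ _) (hi _ _),
    intervalIntegral.integral_interval_sub_left (hi _ _).norm (hi _ _).norm]
  exact intervalIntegral.norm_integral_le_abs_integral_norm

theorem ae_hasDerivAt_primitive (hg : LocallyIntegrable g) :
    ∀ᵐ x, HasDerivAt (fun x => ∫ y in (0 : ℝ)..x, g y) (g x) x := by
  filter_upwards [_root_.LocallyIntegrable.ae_hasDerivAt_integral hg] with x hx
  exact hx 0

theorem continuous_primitive_zero (hg : LocallyIntegrable g) :
    Continuous fun x => ∫ y in (0 : ℝ)..x, g y :=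
  intervalIntegral.continuous_primitive
    (fun _ _ => (hg.integrableOn_isCompact isCompact_uIcc).intervalIntegrable) 0

/-- A locally integrable function is the weak derivative of its primitive. -/
theorem isWeakDeriv_primitive (hg : LocallyIntegrable g) :
    IsWeakDeriv (fun x => ∫ y in (0 : ℝ)..x, g y) g := by
  set G : ℝ → ℂ := fun x => ∫ y in (0 : ℝ)..x, g y
  have hG := continuous_primitive_zero hg
  refine ⟨hG.locallyIntegrable, hg, fun φ hφ hc => ?_⟩
  have hφ1 : ContDiff ℝ 1 φ := hφ.of_le (by exact_mod_cast le_top)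
  have hd : Continuous (deriv φ) := hφ1.continuous_deriv le_rfl
  have i1 := integrable_smul_test hg hφ.continuous hc
  have i2 := integrable_smul_test hG.locallyIntegrable hd hc.deriv
  -- `φ G + ∫_x^∞ (φ' G + φ g)` is constant, and `φ G` vanishes near both ends.
  set k : ℝ → ℂ := fun x => deriv φ x • G x + φ x • g x
  have hk : Integrable k := i2.add i1
  have hc' : ∀ x y, φ x • G x + tail k x = φ y • G y + tail k y := by
    refine eq_of_absolutelyContinuous_of_deriv_zero (f := fun x => φ x • G x + tail k x)
      (fun s t => ?_) ?_
    · exact (AbsolutelyContinuousOnInterval.fun_smul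
        hφ1.contDiffOn.absolutelyContinuousOnInterval (absolutelyContinuousOnInterval_primitive hg s t)).add
        (absolutelyContinuousOnInterval_tail hk s t)
    · filter_upwards [ae_hasDerivAt_primitive hg, ae_hasDerivAt_tail hk] with x h1 h2
      have h3 := ((hφ1.differentiable one_ne_zero x).hasDerivAt).smul h1
      convert! h3.add h2 using 1
      simp only [k, G]
      abel
  obtain ⟨M, hM⟩ := hc.isCompact.isBounded.subset_closedBall 0
  have hz : ∀ x, M < |x| → φ x = 0 := fun x hx => by
    by_contra h0
    have := hM (subset_tsupport φ (Function.mem_support.2 h0))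
    rw [mem_closedBall_zero_iff, Real.norm_eq_abs] at this
    linarith
  have hz1 : ∀ x, M < x → φ x = 0 := fun x hx => hz x (hx.trans_le (le_abs_self x))
  have hz2 : ∀ x, x < -M → φ x = 0 := fun x hx => hz x (by
    have := neg_le_abs x
    linarith)
  have hl : tail k (-M - 1) = 0 := by
    refine tendsto_nhds_unique (tendsto_const_nhds.congr' ?_)
      (tendsto_tail_atTop (f := k))
    filter_upwards [eventually_gt_atTop M] with x hx
    have := hc' x (-M - 1)
    rw [hz1 x hx, hz2 (-M - 1) (by linarith)] at this
    simpa using this.symm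
  have hall : ∫ x, k x = 0 := by
    rw [← hl, tail, setIntegral_eq_integral_of_forall_compl_eq_zero]
    intro x hx
    have hx' : x ≤ -M - 1 := by simpa using hx
    have h0 : φ x = 0 := hz2 x (by linarith)
    have h1 : deriv φ x = 0 := by
      have : φ =ᶠ[𝓝 x] fun _ => 0 := by
        filter_upwards [gt_mem_nhds (show x < -M by linarith)] with y hy using hz2 y hy
      rw [this.deriv_eq, deriv_const]
    simp [k, h0, h1]
  rw [show (∫ x, k x) = (∫ x, deriv φ x • G x) + ∫ x, φ x • g x from integral_add i2 i1] at hall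
  exact eq_neg_of_add_eq_zero_right hall

/-- The integral of a test function over the sliding interval `[x - h, x]` is a test function. -/
theorem exists_test_deriv_eq_sub {φ : ℝ → ℝ} (hφ : ContDiff ℝ ∞ φ) (hc : HasCompactSupport φ)
    (h : ℝ) : ∃ θ : ℝ → ℝ, ContDiff ℝ ∞ θ ∧ HasCompactSupport θ ∧
      ∀ x, deriv θ x = φ x - φ (x - h) := by
  have hder : ∀ x, HasDerivAt (fun x => ∫ y in (0 : ℝ)..x, φ y) (φ x) x := fun x =>
    intervalIntegral.integral_hasDerivAt_right (hφ.continuous.intervalIntegrable _ _)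
      hφ.continuous.stronglyMeasurable.stronglyMeasurableAtFilter hφ.continuous.continuousAt
  have hd : ∀ x, HasDerivAt (fun x => ∫ y in (x - h)..x, φ y) (φ x - φ (x - h)) x := fun x => by
    have e : (fun x => ∫ y in (x - h)..x, φ y)
        = fun x => (∫ y in (0 : ℝ)..x, φ y) - ∫ y in (0 : ℝ)..(x - h), φ y := by
      funext x
      rw [intervalIntegral.integral_interval_sub_left] <;>
        exact hφ.continuous.intervalIntegrable _ _
    rw [e]
    exact (hder x).sub ((hder (x - h)).comp_sub_const x h)
  refine ⟨fun x => ∫ y in (x - h)..x, φ y, ?_, ?_, fun x => (hd x).deriv⟩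
  · rw [contDiff_infty_iff_deriv]
    refine ⟨fun x => (hd x).differentiableAt, ?_⟩
    rw [funext fun x => (hd x).deriv]
    exact hφ.sub (hφ.comp (contDiff_id.sub contDiff_const))
  · obtain ⟨M, hM⟩ := hc.isCompact.isBounded.subset_closedBall 0
    refine HasCompactSupport.intro (isCompact_closedBall 0 (M + |h|)) fun x hx => ?_
    refine intervalIntegral.integral_zero_ae (Eventually.of_forall fun y hy => ?_)
    by_contra h0
    have h1 := hM (subset_tsupport φ (Function.mem_support.2 h0))
    rw [mem_closedBall_zero_iff, Real.norm_eq_abs] at h1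
    rw [mem_closedBall_zero_iff, Real.norm_eq_abs] at hx
    rw [Set.mem_uIoc] at hy
    grind

/-- The increment `f(· + h) - f` depends only on the weak derivative of `f`. -/
theorem IsWeakDeriv.translate_sub_ae_eq (hfg : IsWeakDeriv f g) {f' : ℝ → ℂ}
    (hfg' : IsWeakDeriv f' g) (h : ℝ) (hl : LocallyIntegrable fun x => f (x + h) - f x)
    (hl' : LocallyIntegrable fun x => f' (x + h) - f' x) :
    (fun x => f (x + h) - f x) =ᵐ[volume] fun x => f' (x + h) - f' x := by
  refine ae_eq_of_integral_contDiff_smul_eq hl hl' fun φ hφ hc => ?_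
  -- Summation by parts moves the increment to `φ`, where it is the derivative of a test function.
  obtain ⟨θ, hθ, hθc, hθd⟩ := exists_test_deriv_eq_sub hφ hc h
  have key : ∀ F, IsWeakDeriv F g →
      ∫ x, φ x • (F (x + h) - F x) = ∫ x, θ x • g x := fun F hF => by
    rw [(integral_smul_translate_sub hF.1 hφ.continuous hc h), hF.2.2 θ hθ hθc, ← integral_neg]
    congr 1
    funext x
    rw [hθd, ← neg_smul, neg_sub]
  rw [key f hfg, key f' hfg']

theorem memLp_two_locallyIntegrable (hf : MemLp f 2) : LocallyIntegrable f :=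
  hf.locallyIntegrable (by norm_num)

theorem memLp_translate (hf : MemLp f 2) (h : ℝ) : MemLp (fun x => f (x + h)) 2 :=
  hf.comp_measurePreserving (measurePreserving_add_right volume h)

/-- Difference quotients are controlled by the weak derivative. -/
theorem IsWeakDeriv.eLpNorm_translate_sub_le (hfg : IsWeakDeriv f g) (hf : MemLp f 2)
    {h : ℝ} (hh : 0 ≤ h) :
    eLpNorm (fun x => f (x + h) - f x) 2 volume ≤ ENNReal.ofReal h * eLpNorm g 2 volume := by
  wlog hgm : StronglyMeasurable g generalizing g
  · have hm := hfg.2.1.aestronglyMeasurable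
    have hae := hm.ae_eq_mk
    rw [eLpNorm_congr_ae hae]
    refine this ⟨hfg.1, hfg.2.1.congr hae, fun φ hφ hc => ?_⟩ hm.stronglyMeasurable_mk
    rw [← hfg.2.2 φ hφ hc]
    exact integral_congr_ae (by filter_upwards [hae] with x hx; rw [hx])
  have hi : ∀ a b, IntervalIntegrable g volume a b := fun a b =>
    (hfg.2.1.integrableOn_isCompact isCompact_uIcc).intervalIntegrable
  have hG := continuous_primitive_zero hfg.2.1
  rw [eLpNorm_congr_ae (hfg.translate_sub_ae_eq (isWeakDeriv_primitive hfg.2.1) h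
    ((memLp_two_locallyIntegrable (memLp_translate hf h)).sub hfg.1)
    ((hG.comp (continuous_add_const h)).sub hG).locallyIntegrable)]
  have hpt : ∀ x, ‖(∫ y in (0 : ℝ)..(x + h), g y) - ∫ y in (0 : ℝ)..x, g y‖ₑ
      ≤ ∫⁻ s in Set.Ioc 0 h, 1 * ‖g (x + s)‖ₑ := fun x => by
    rw [intervalIntegral.integral_interval_sub_left (hi _ _) (hi _ _)]
    have : ∫ y in x..(x + h), g y = ∫ s in (0 : ℝ)..h, g (x + s) := by
      rw [intervalIntegral.integral_comp_add_left (fun y => g y), add_zero]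
    rw [this, intervalIntegral.integral_of_le hh]
    simpa using enorm_integral_le_lintegral_enorm (μ := volume.restrict (Set.Ioc 0 h))
      fun s => g (x + s)
  calc _ ≤ eLpNorm (fun x => ∫⁻ s in Set.Ioc 0 h, 1 * ‖g (x + s)‖ₑ) 2 volume :=
        eLpNorm_mono_enorm fun x => by simpa using hpt x
    _ ≤ ∫⁻ s in Set.Ioc 0 h, 1 * eLpNorm (fun x => ‖g (x + s)‖ₑ) 2 volume :=
        eLpNorm_lintegral_mul_le (g := fun s x => ‖g (x + s)‖ₑ) (k := fun _ => 1)
          aemeasurable_const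
          (hgm.measurable.comp (measurable_snd.add measurable_fst)).enorm
    _ = ∫⁻ s in Set.Ioc 0 h, eLpNorm g 2 volume := by
        refine lintegral_congr fun s => ?_
        rw [one_mul, eLpNorm_enorm]
        exact eLpNorm_comp_measurePreserving hgm.aestronglyMeasurable
          (measurePreserving_add_right volume s)
    _ = _ := by
        rw [setLIntegral_const, Real.volume_Ioc, sub_zero, mul_comm]

/-- Bounded sequences in a Hilbert space have weak cluster points. -/
theorem exists_weak_clusterPt {H : Type*} [NormedAddCommGroup H] [InnerProductSpace ℂ H]
    [CompleteSpace H] {x : ℕ → H} {C : ℝ} (hx : ∀ n, ‖x n‖ ≤ C) :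
    ∃ y, ‖y‖ ≤ C ∧ ∀ z c, Tendsto (fun n => inner ℂ z (x n)) atTop (𝓝 c) → inner ℂ z y = c := by
  have hK := WeakDual.isCompact_closedBall (0 : StrongDual ℂ H) C
  obtain ⟨T, hT, hcl⟩ := hK.exists_mapClusterPt (f := atTop)
    (u := fun n => StrongDual.toWeakDual (InnerProductSpace.toDual ℂ H (x n)))
    (by
      refine tendsto_principal.2 ?_
      refine Eventually.of_forall fun n => ?_
      simpa using hx n)
  refine ⟨(InnerProductSpace.toDual ℂ H).symm (WeakDual.toStrongDual T), ?_, fun z c hz => ?_⟩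
  · rw [LinearIsometryEquiv.norm_map]
    simpa using hT
  · have h1 := hcl.continuousAt_comp (f := fun S : WeakDual ℂ H => S z)
      (WeakDual.eval_continuous z).continuousAt
    have h2 : Tendsto ((fun S : WeakDual ℂ H => S z) ∘ fun n =>
        StrongDual.toWeakDual (InnerProductSpace.toDual ℂ H (x n))) atTop (𝓝 (star c)) := by
      refine hz.star.congr fun n => ?_
      simp [InnerProductSpace.toDual_apply_apply]
    have h3 : T z = star c := by
      have : (𝓝 (T z) ⊓ 𝓝 (star c)).NeBot := h1.neBot.mono (inf_le_inf_left _ h2)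
      exact eq_of_nhds_neBot this
    rw [← inner_conj_symm, InnerProductSpace.toDual_symm_apply]
    have : WeakDual.toStrongDual T z = star c := h3
    rw [this]
    simp

/-- Difference quotients converge to the distributional derivative, tested against `φ`. -/
theorem tendsto_integral_difference_quotient (hf : LocallyIntegrable f) {φ : ℝ → ℝ}
    (hφ : ContDiff ℝ 1 φ) (hc : HasCompactSupport φ) {h : ℕ → ℝ} (h0 : ∀ n, h n ≠ 0)
    (hlim : Tendsto h atTop (𝓝 0)) :
    Tendsto (fun n => ∫ x, φ x • ((h n)⁻¹ • (f (x + h n) - f x))) atTop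
      (𝓝 (-∫ x, deriv φ x • f x)) := by
  have hd : Continuous (deriv φ) := hφ.continuous_deriv le_rfl
  -- The pairing of `φ` with `f(· + t)` is the convolution of `φ(-·)` and `f`, evaluated at `t`.
  have hder := (hc.comp_homeomorph (Homeomorph.neg ℝ)).hasDerivAt_convolution_left
    (ContinuousLinearMap.lsmul ℝ ℝ : ℝ →L[ℝ] ℂ →L[ℝ] ℂ)
    (hφ.comp contDiff_neg) (μ := volume) hf 0
  have hJ : ∀ t, convolution (φ ∘ Homeomorph.neg ℝ) f (ContinuousLinearMap.lsmul ℝ ℝ) volume t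
      = ∫ x, φ x • f (x + t) := fun t => by
    rw [convolution_def, ← integral_neg_eq_self]
    simp [add_comm]
  have hJ' : convolution (deriv (φ ∘ Homeomorph.neg ℝ)) f (ContinuousLinearMap.lsmul ℝ ℝ) volume 0
      = -∫ x, deriv φ x • f x := by
    rw [convolution_def, ← integral_neg_eq_self, ← integral_neg]
    refine integral_congr_ae (Eventually.of_forall fun x => ?_)
    have : deriv (φ ∘ Homeomorph.neg ℝ) (-x) = -deriv φ x := by
      have := deriv_comp_neg φ (-x)
      rw [neg_neg] at this
      exact this
    beta_reduce
    rw [ContinuousLinearMap.lsmul_apply, this, zero_sub, neg_neg, neg_smul]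
  have hs := hder.tendsto_slope_zero.comp
    (tendsto_nhdsWithin_iff.2 ⟨hlim, Eventually.of_forall h0⟩)
  refine hJ' ▸ hs.congr fun n => ?_
  have i1 := integrable_smul_test hf hφ.continuous hc
  simp only [Function.comp_apply, hJ, zero_add, add_zero]
  simp_rw [smul_comm (φ _) (h n)⁻¹]
  rw [integral_smul]
  simp_rw [smul_sub (φ _)]
  rw [integral_sub (integrable_smul_test_translate hf hφ.continuous hc (h n)) i1]

/-- Bounded difference quotients in `L²` imply weak differentiability in `L²`. -/
theorem exists_isWeakDeriv_of_difference_quotient (hf : LocallyIntegrable f) {C : ℝ≥0}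
    {h : ℕ → ℝ} (h0 : ∀ n, h n ≠ 0) (hlim : Tendsto h atTop (𝓝 0))
    (hb : ∀ n, eLpNorm (fun x => (h n)⁻¹ • (f (x + h n) - f x)) 2 volume ≤ C) :
    ∃ g, IsWeakDeriv f g ∧ MemLp g 2 ∧ eLpNorm g 2 volume ≤ C := by
  have hm : ∀ n, MemLp (fun x => (h n)⁻¹ • (f (x + h n) - f x)) 2 := fun n =>
    ⟨AEStronglyMeasurable.const_smul (f := fun x => f (x + h n) - f x) (c := (h n)⁻¹)
      ((hf.aestronglyMeasurable.comp_measurePreserving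
        (measurePreserving_add_right volume (h n))).sub hf.aestronglyMeasurable),
      (hb n).trans_lt ENNReal.coe_lt_top⟩
  obtain ⟨y, hy, hyl⟩ := exists_weak_clusterPt (x := fun n => (hm n).toLp) (C := C) fun n => by
    rw [Lp.norm_toLp]
    exact ENNReal.toReal_le_coe_of_le_coe (hb n)
  -- A weak cluster point of the difference quotients is the weak derivative.
  refine ⟨y, ⟨hf, memLp_two_locallyIntegrable (Lp.memLp y), fun φ hφ hc => ?_⟩, Lp.memLp y, ?_⟩
  · have hφm : MemLp (fun x => (φ x : ℂ)) 2 :=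
      (Complex.continuous_ofReal.comp hφ.continuous).memLp_of_hasCompactSupport
        (hc.comp_left (g := fun x : ℝ => (x : ℂ)) Complex.ofReal_zero)
    have hin : ∀ (F : Lp ℂ 2 (volume : Measure ℝ)) (F' : ℝ → ℂ), F =ᵐ[volume] F' →
        inner ℂ hφm.toLp F = ∫ x, φ x • F' x := fun F F' hF => by
      rw [L2.inner_def]
      refine integral_congr_ae ?_
      filter_upwards [hφm.coeFn_toLp, hF] with x h1 h2
      rw [h1, h2]
      simp [mul_comm]
    rw [← hin y y (ae_eq_refl _)]
    refine hyl _ _ ((tendsto_integral_difference_quotient hf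
      (hφ.of_le (by exact_mod_cast le_top)) hc h0 hlim).congr fun n => ?_)
    exact (hin _ _ (hm n).coeFn_toLp).symm
  · rw [Lp.norm_def] at hy
    rw [← ENNReal.ofReal_toReal (Lp.eLpNorm_ne_top y)]
    exact ENNReal.ofReal_le_of_le_toReal (by simpa using hy)

end WeakDerivative

/-! ### The two weights and their norms -/

theorem isWeight_one : IsWeight fun _ => 1 :=
  ⟨measurable_const, fun _ => le_rfl, fun _ => ENNReal.one_ne_top, fun _ => rfl,
    fun _ _ _ _ => le_rfl⟩

/-- The weight `1 + |x|`. -/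
noncomputable def polyWeight (x : ℝ) : ℝ≥0∞ := ENNReal.ofReal (1 + |x|)

theorem isWeight_polyWeight : IsWeight polyWeight where
  measurable := by unfold polyWeight; fun_prop
  one_le x := by
    rw [polyWeight, ENNReal.one_le_ofReal]
    linarith [abs_nonneg x]
  ne_top x := ENNReal.ofReal_ne_top
  even x := by rw [polyWeight, abs_neg, polyWeight]
  mono x y hx hxy := by
    rw [polyWeight, polyWeight, abs_of_nonneg hx, abs_of_nonneg (hx.trans hxy)]
    exact ENNReal.ofReal_le_ofReal (by linarith)

theorem polyWeight_mul_enorm (f : ℝ → ℂ) (x : ℝ) :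
    polyWeight x * ‖f x‖ₑ = ‖f x‖ₑ + ‖mulX f x‖ₑ := by
  rw [polyWeight, ENNReal.ofReal_add zero_le_one (abs_nonneg x), add_mul, ENNReal.ofReal_one,
    one_mul, mulX, enorm_mul, ← ofReal_norm (x : ℂ), Complex.norm_real, Real.norm_eq_abs]

section Norms

variable {w : ℝ → ℝ≥0∞} {f g p q : ℝ → ℂ}

theorem weakNorm_le_strongNorm (hw : IsWeight w) (p : ℝ → ℂ) : weakNorm w p ≤ strongNorm w p := by
  rw [weakNorm, strongNorm, add_comm]
  refine add_le_add (lintegral_mono fun y => mul_le_of_le_one_right' (hw.inv_le_one y)) ?_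
  refine eLpNorm_mono_enorm fun x => ?_
  rw [enorm_eq_self]
  exact le_mul_of_one_le_left' (hw.one_le x)

theorem aestronglyMeasurable_weight_mul (hw : IsWeight w) (hf : AEStronglyMeasurable f volume) :
    AEStronglyMeasurable (fun x => w x * ‖f x‖ₑ) volume :=
  (hw.measurable.aemeasurable.mul hf.enorm).aestronglyMeasurable

theorem strongNorm_sub_le (hw : IsWeight w) (hf : AEStronglyMeasurable f volume)
    (hg : AEStronglyMeasurable g volume) :
    strongNorm w (f - g) ≤ strongNorm w f + strongNorm w g := by
  have h1 : ∫⁻ y, ‖(f - g) y‖ₑ ≤ (∫⁻ y, ‖f y‖ₑ) + ∫⁻ y, ‖g y‖ₑ := by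
    rw [← lintegral_add_left' hf.enorm]
    exact lintegral_mono fun y => enorm_sub_le
  have h2 : eLpNorm (fun x => w x * ‖(f - g) x‖ₑ) 2 volume
      ≤ eLpNorm (fun x => w x * ‖f x‖ₑ) 2 volume + eLpNorm (fun x => w x * ‖g x‖ₑ) 2 volume := by
    refine le_trans (eLpNorm_mono_enorm fun x => ?_)
      (eLpNorm_add_le (aestronglyMeasurable_weight_mul hw hf)
        (aestronglyMeasurable_weight_mul hw hg) (by norm_num))
    simp only [Pi.add_apply, enorm_eq_self]
    rw [← mul_add]
    exact mul_le_mul' le_rfl enorm_sub_le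
  calc strongNorm w (f - g) ≤ _ := add_le_add h1 h2
    _ = _ := by rw [strongNorm, strongNorm]; ring

/-- The `L²` norm of `1 / (1 + |x|)`. -/
noncomputable def weightConst : ℝ≥0 := (eLpNorm (fun x => (polyWeight x)⁻¹) 2 volume).toNNReal

theorem coe_weightConst :
    (weightConst : ℝ≥0∞) = eLpNorm (fun x => (polyWeight x)⁻¹) 2 volume := by
  refine ENNReal.coe_toNNReal ?_
  have h1 := finite_integral_one_add_norm (E := ℝ) (μ := volume) (r := 2) (by simp)
  rw [eLpNorm_two_eq]
  refine (ENNReal.rpow_lt_top_of_nonneg (by norm_num) (ne_of_lt (lt_of_le_of_lt (le_of_eq ?_) h1))).ne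
  refine lintegral_congr fun x => ?_
  have hx : 0 < 1 + |x| := by positivity
  rw [enorm_eq_self, polyWeight, ← ENNReal.ofReal_inv_of_pos hx, ← ENNReal.ofReal_pow (by positivity),
    Real.norm_eq_abs, Real.rpow_neg hx.le, inv_pow]
  norm_cast

theorem lintegral_mul_inv_polyWeight_le {k : ℝ → ℝ≥0∞} (hk : AEMeasurable k volume) :
    ∫⁻ x, k x * (polyWeight x)⁻¹ ≤ weightConst * eLpNorm k 2 volume := by
  rw [coe_weightConst, mul_comm]
  exact lintegral_mul_le_eLpNorm_two hk isWeight_polyWeight.measurable.inv.aemeasurable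

/-- For the weight `1 + |x|`, the weak norm is bounded by the norm of `L²`. -/
theorem weakNorm_polyWeight_le (hf : AEStronglyMeasurable f volume) :
    weakNorm polyWeight f ≤ (1 + weightConst : ℝ≥0) * eLpNorm f 2 volume := by
  have := lintegral_mul_inv_polyWeight_le hf.enorm
  rw [eLpNorm_enorm] at this
  push_cast
  rw [add_mul, one_mul, weakNorm]
  gcongr

theorem lintegral_enorm_le_weightConst_mul (hf : AEStronglyMeasurable f volume) :
    ∫⁻ x, ‖f x‖ₑ ≤ weightConst * eLpNorm (fun x => polyWeight x * ‖f x‖ₑ) 2 volume := by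
  refine le_trans (le_of_eq ?_) (lintegral_mul_inv_polyWeight_le
    (aestronglyMeasurable_weight_mul isWeight_polyWeight hf).aemeasurable)
  refine lintegral_congr fun x => ?_
  rw [mul_comm (polyWeight x), mul_assoc, ENNReal.mul_inv_cancel (isWeight_polyWeight.ne_zero x)
    (isWeight_polyWeight.ne_top x), mul_one]

theorem le_sqrt_sq_add (a b : ℝ≥0∞) : a ≤ (a ^ 2 + b) ^ (1 / 2 : ℝ) := by
  calc a = (a ^ 2) ^ (1 / 2 : ℝ) := by
        rw [← ENNReal.rpow_natCast, ← ENNReal.rpow_mul]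
        simp
    _ ≤ _ := by gcongr; exact le_self_add

theorem sqrt_le_of_le_sq {a b : ℝ≥0∞} (h : a ≤ b ^ 2) : a ^ (1 / 2 : ℝ) ≤ b := by
  calc a ^ (1 / 2 : ℝ) ≤ (b ^ 2) ^ (1 / 2 : ℝ) := by gcongr
    _ = b := by
        rw [← ENNReal.rpow_natCast, ← ENNReal.rpow_mul]
        simp

theorem normL_two_le_normH01 (f : ℝ → ℂ) : normL 2 f ≤ normH01 f := le_sqrt_sq_add _ _

theorem normL_two_mulX_le_normH01 (f : ℝ → ℂ) : normL 2 (mulX f) ≤ normH01 f := by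
  rw [normH01, add_comm]
  exact le_sqrt_sq_add _ _

theorem normH01_le_add (f : ℝ → ℂ) : normH01 f ≤ normL 2 f + normL 2 (mulX f) := by
  refine sqrt_le_of_le_sq ?_
  rw [add_sq, add_right_comm]
  exact le_self_add

theorem normH01_le_normH11 (f : ℝ → ℂ) : normH01 f ≤ normH11 f := by
  rw [normH01, normH11]
  gcongr
  exact le_self_add

theorem normL_two_weakDeriv_le_normH11 (f : ℝ → ℂ) : normL 2 (weakDeriv f) ≤ normH11 f := by
  rw [normH11, add_comm (normL 2 f ^ 2), add_assoc]
  exact le_sqrt_sq_add _ _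

theorem normH11_le_add (f : ℝ → ℂ) :
    normH11 f ≤ normL 2 f + normL 2 (weakDeriv f) + normL 2 (mulX f) := by
  refine sqrt_le_of_le_sq ?_
  rw [add_sq, add_sq]
  refine add_le_add (le_add_right (add_le_add le_self_add le_rfl)) le_rfl

/-- For the weight `1 + |x|`, the strong norm is bounded by the norm of `H^{0,1}`. -/
theorem strongNorm_polyWeight_le (hf : MemLp f 2) (hx : MemLp (mulX f) 2) :
    strongNorm polyWeight f ≤ (2 * (1 + weightConst) : ℝ≥0) * normH01 f := by
  have h1 : eLpNorm (fun x => polyWeight x * ‖f x‖ₑ) 2 volume ≤ 2 * normH01 f := by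
    simp only [polyWeight_mul_enorm]
    refine (eLpNorm_add_le hf.1.enorm.aestronglyMeasurable hx.1.enorm.aestronglyMeasurable
      (by norm_num)).trans ?_
    rw [eLpNorm_enorm, eLpNorm_enorm, two_mul]
    exact add_le_add (normL_two_le_normH01 f) (normL_two_mulX_le_normH01 f)
  calc strongNorm polyWeight f
      ≤ weightConst * (2 * normH01 f) + 2 * normH01 f :=
        add_le_add ((lintegral_enorm_le_weightConst_mul hf.1).trans (by gcongr)) h1
    _ = _ := by push_cast; ring

theorem mulX_sub (f g : ℝ → ℂ) : mulX (f - g) = mulX f - mulX g := by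
  funext x
  simp [mulX, mul_sub]

theorem H01.inBall {R : ℝ≥0} (hf : f ∈ H01) (hR : normH01 f ≤ R) :
    InBall polyWeight (2 * (1 + weightConst) * R) f :=
  ⟨hf.1.1, (strongNorm_polyWeight_le hf.1 hf.2).trans (by
    rw [ENNReal.coe_mul (2 * (1 + weightConst))]
    gcongr)⟩

theorem H01.strongNorm_sub_le (hf : f ∈ H01) (hg : g ∈ H01) :
    strongNorm polyWeight (f - g) ≤ (2 * (1 + weightConst) : ℝ≥0) * normH01 (f - g) :=
  strongNorm_polyWeight_le (hf.1.sub hg.1) (by rw [mulX_sub]; exact hf.2.sub hg.2)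

end Norms

/-! ### Vanishing potential -/

theorem isNormalized_zero (L : Filter ℝ) (l : ℝ) :
    IsNormalized L 0 l (fun _ => 1) fun _ => 0 := by
  refine ⟨⟨absolutelyContinuousOnInterval_const _, absolutelyContinuousOnInterval_const _,
    Eventually.of_forall fun x => ⟨?_, ?_⟩⟩, tendsto_const_nhds, tendsto_const_nhds⟩
  · simpa using hasDerivAt_const x (1 : ℂ)
  · simpa using hasDerivAt_const x (0 : ℂ)

theorem wronR_zero : wronR 0 = 0 := by
  have hq : Integrable (0 : ℝ → ℂ) := integrable_zero _ _ _
  funext l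
  have h1 := ((isNormalized_jostVec hq l).unique (isNormalized_zero atTop l) 0).2
  have h2 := ((isNormalized_jostVecLeft hq l).unique (isNormalized_zero atBot l) 0).2
  rw [wronR, h1, h2]
  simp

theorem inBall_zero (w : ℝ → ℝ≥0∞) (R : ℝ≥0) : InBall w R 0 :=
  ⟨aestronglyMeasurable_zero, by simp [strongNorm]⟩

theorem memLp_wronR {w : ℝ → ℝ≥0∞} (hw : IsWeight w) {R : ℝ≥0} {q : ℝ → ℂ} (hq : InBall w R q) :
    MemLp (wronR q) 2 := by
  refine ⟨((regular_wronR hw).cont q hq.integrable).aestronglyMeasurable, ?_⟩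
  obtain ⟨C, hC⟩ := (regular_wronR hw).lip R
  have := hC q 0 hq (inBall_zero w R)
  rw [wronR_zero, sub_zero, sub_zero] at this
  exact this.trans_lt (ENNReal.mul_lt_top ENNReal.coe_lt_top
    (((weakNorm_le_strongNorm hw q).trans hq.le).trans_lt ENNReal.coe_lt_top))

/-! ### The derivative of the reflection coefficient -/

section Derivative

variable {p q q' : ℝ → ℂ}

theorem strongNorm_congr_norm (w : ℝ → ℝ≥0∞) {f g : ℝ → ℂ} (h : ∀ x, ‖f x‖ = ‖g x‖) :
    strongNorm w f = strongNorm w g := by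
  have h' : ∀ x, ‖f x‖ₑ = ‖g x‖ₑ := fun x => by rw [← ofReal_norm, h, ofReal_norm]
  simp only [strongNorm, h']

theorem modulate_sub (h : ℝ) (p q : ℝ → ℂ) : modulate h p - modulate h q = modulate h (p - q) := by
  funext x
  simp [modulate, mul_sub]

theorem InBall.modulate {w : ℝ → ℝ≥0∞} {R : ℝ≥0} (hq : InBall w R q) (h : ℝ) :
    InBall w R (modulate h q) :=
  ⟨aestronglyMeasurable_modulate h hq.meas,
    (strongNorm_congr_norm w (norm_modulate h q)).trans_le hq.le⟩

theorem norm_exp_two_I_mul_sub_one_le (θ : ℝ) :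
    ‖Complex.exp (2 * Complex.I * θ) - 1‖ ≤ 2 * |θ| := by
  have := Real.norm_exp_I_mul_ofReal_sub_one_le (x := 2 * θ)
  rw [Real.norm_eq_abs, abs_mul, abs_two] at this
  convert this using 4
  push_cast
  ring

/-- The increment of a modulation is of order `h` in the weak norm, since
`|e^{2ihx} - 1| ≤ 2 |h| |x|`. -/
theorem weakNorm_modulate_sub_le (h : ℝ) (p : ℝ → ℂ) : weakNorm polyWeight (modulate h p - p)
    ≤ ENNReal.ofReal (2 * |h|) * strongNorm polyWeight p := by
  have hp : ∀ x, ‖(modulate h p - p) x‖ₑ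
      ≤ ENNReal.ofReal (2 * |h|) * (polyWeight x * ‖p x‖ₑ) := fun x => by
    have : (modulate h p - p) x = (Complex.exp (2 * Complex.I * (h * x : ℝ)) - 1) * p x := by
      simp [modulate, sub_mul]
    rw [this, enorm_mul, ← mul_assoc, polyWeight, ← ENNReal.ofReal_mul (by positivity),
      ← ofReal_norm (Complex.exp _ - 1)]
    gcongr
    refine (norm_exp_two_I_mul_sub_one_le _).trans ?_
    rw [abs_mul, ← mul_assoc]
    gcongr
    linarith
  rw [weakNorm, strongNorm, add_comm, mul_add]
  refine add_le_add ?_ ?_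
  · rw [← lintegral_const_mul' _ _ ENNReal.ofReal_ne_top]
    refine lintegral_mono fun x => ?_
    calc _ ≤ ENNReal.ofReal (2 * |h|) * (polyWeight x * ‖p x‖ₑ) * (polyWeight x)⁻¹ :=
          mul_le_mul' (hp x) le_rfl
      _ = ENNReal.ofReal (2 * |h|) * ‖p x‖ₑ * (polyWeight x * (polyWeight x)⁻¹) := by ring
      _ = _ := by
          rw [ENNReal.mul_inv_cancel (isWeight_polyWeight.ne_zero x)
            (isWeight_polyWeight.ne_top x), mul_one]
  · rw [← eLpNorm_two_const_mul ENNReal.ofReal_ne_top]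
    exact eLpNorm_mono_enorm fun x => by simpa using hp x

theorem eLpNorm_inv_smul_le {f : ℝ → ℂ} {h : ℝ} (hh : 0 < h) {B : ℝ≥0∞}
    (hf : eLpNorm f 2 volume ≤ ENNReal.ofReal h * B) :
    eLpNorm (fun x => h⁻¹ • f x) 2 volume ≤ B := by
  have h1 : eLpNorm (fun x => h⁻¹ • f x) 2 volume = ENNReal.ofReal h⁻¹ * eLpNorm f 2 volume := by
    rw [show (fun x => h⁻¹ • f x) = h⁻¹ • f from rfl, eLpNorm_const_smul,
      Real.enorm_of_nonneg (by positivity)]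
  rw [h1]
  calc _ ≤ ENNReal.ofReal h⁻¹ * (ENNReal.ofReal h * B) := by gcongr
    _ = B := by
        rw [← mul_assoc, ← ENNReal.ofReal_mul (by positivity), inv_mul_cancel₀ hh.ne',
          ENNReal.ofReal_one, one_mul]

/-- The difference of two reflection coefficients has a weak derivative in `L²`, controlled by the
strong norm of the difference of the potentials: its increment by `h` is a second difference over
`e^{2ihx} q`, `q`, `e^{2ihx} q'`, `q'`. -/
theorem exists_isWeakDeriv_wronR_sub (R : ℝ≥0) : ∃ C : ℝ≥0, ∀ q q', InBall polyWeight R q →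
    InBall polyWeight R q' → ∃ g, IsWeakDeriv (wronR q - wronR q') g ∧ MemLp g 2 ∧
      eLpNorm g 2 volume ≤ C * strongNorm polyWeight (q - q') := by
  obtain ⟨C, hC⟩ := (regular_wronR isWeight_polyWeight).four R
  refine ⟨C * (2 + 8 * R), fun q q' hq hq' => ?_⟩
  set S := strongNorm polyWeight (q - q')
  have hS : S ≠ ⊤ := ne_top_of_le_ne_top (ENNReal.add_ne_top.2
    ⟨ne_top_of_le_ne_top ENNReal.coe_ne_top hq.le, ne_top_of_le_ne_top ENNReal.coe_ne_top hq'.le⟩)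
    (strongNorm_sub_le isWeight_polyWeight hq.meas hq'.meas)
  have hcont : Continuous (wronR q - wronR q') :=
    ((regular_wronR isWeight_polyWeight).cont q hq.integrable).sub
      ((regular_wronR isWeight_polyWeight).cont q' hq'.integrable)
  have hB : ((C * (2 + 8 * R) : ℝ≥0) : ℝ≥0∞) * S ≠ ⊤ := ENNReal.mul_ne_top ENNReal.coe_ne_top hS
  rw [← ENNReal.coe_toNNReal hB]
  refine exists_isWeakDeriv_of_difference_quotient hcont.locallyIntegrable
    (h := fun n : ℕ => 1 / ((n : ℝ) + 1)) (fun n => by positivity)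
    tendsto_one_div_add_atTop_nhds_zero_nat fun n => ?_
  rw [ENNReal.coe_toNNReal hB]
  have hh : (0 : ℝ) < 1 / ((n : ℝ) + 1) := by positivity
  generalize (1 / ((n : ℝ) + 1)) = h at hh
  refine eLpNorm_inv_smul_le hh ?_
  have hf : (fun x => (wronR q - wronR q') (x + h) - (wronR q - wronR q') x)
      = wronR (modulate h q) - wronR q - (wronR (modulate h q') - wronR q') := by
    funext x
    simp only [Pi.sub_apply, wronR_modulate hq.integrable, wronR_modulate hq'.integrable]
    ring
  rw [hf]
  refine (hC _ _ _ _ (hq.modulate h) hq (hq'.modulate h) hq').trans ?_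
  have e1 : modulate h q - q - (modulate h q' - q') = modulate h (q - q') - (q - q') := by
    rw [← modulate_sub]
    abel
  have e2 : strongNorm polyWeight (modulate h q - modulate h q') = S := by
    rw [modulate_sub]
    exact strongNorm_congr_norm _ (norm_modulate h _)
  have h1 := weakNorm_modulate_sub_le h (q - q')
  have h2 : weakNorm polyWeight (modulate h q - q) ≤ ENNReal.ofReal (2 * |h|) * R :=
    (weakNorm_modulate_sub_le h q).trans (by gcongr; exact hq.le)
  have h3 : weakNorm polyWeight (modulate h q' - q') ≤ ENNReal.ofReal (2 * |h|) * R :=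
    (weakNorm_modulate_sub_le h q').trans (by gcongr; exact hq'.le)
  rw [fourNorm, e1, e2]
  calc _ ≤ (C : ℝ≥0∞) * (ENNReal.ofReal (2 * |h|) * S
        + (ENNReal.ofReal (2 * |h|) * R + ENNReal.ofReal (2 * |h|) * R) * (S + S)) := by gcongr
    _ = _ := by
        rw [abs_of_pos hh, ENNReal.ofReal_mul (by norm_num)]
        push_cast
        simp only [ENNReal.ofReal_ofNat]
        ring

end Derivative

/-! ### Decay of the reflection coefficient -/

section Decay

variable {f f' g g' p q q' : ℝ → ℂ}

theorem IsWeakDeriv.sub (h : IsWeakDeriv f g) (h' : IsWeakDeriv f' g') :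
    IsWeakDeriv (f - f') (g - g') := by
  refine ⟨h.1.sub h'.1, h.2.1.sub h'.2.1, fun φ hφ hc => ?_⟩
  have hd : Continuous (deriv φ) :=
    (hφ.of_le (by exact_mod_cast le_top : (1 : WithTop ℕ∞) ≤ _)).continuous_deriv le_rfl
  simp only [Pi.sub_apply, smul_sub]
  rw [integral_sub (integrable_smul_test h.2.1 hφ.continuous hc)
    (integrable_smul_test h'.2.1 hφ.continuous hc),
    integral_sub (integrable_smul_test h.1 hd hc.deriv) (integrable_smul_test h'.1 hd hc.deriv),
    h.2.2 φ hφ hc, h'.2.2 φ hφ hc]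
  ring

theorem polyWeight_le_two_mul {h : ℝ} (hh : |h| ≤ 1) (x : ℝ) :
    polyWeight x ≤ 2 * polyWeight (x + h) := by
  rw [polyWeight, polyWeight, ← ENNReal.ofReal_ofNat 2, ← ENNReal.ofReal_mul (by norm_num)]
  refine ENNReal.ofReal_le_ofReal ?_
  have := abs_sub_abs_le_abs_sub x (-h)
  rw [sub_neg_eq_add, abs_neg] at this
  linarith [abs_nonneg x, abs_nonneg (x + h)]

theorem strongNorm_translate_le (hp : AEStronglyMeasurable p volume) {h : ℝ} (hh : |h| ≤ 1) :
    strongNorm polyWeight (fun x => p (x + h)) ≤ 2 * strongNorm polyWeight p := by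
  rw [strongNorm, strongNorm, mul_add]
  refine add_le_add ?_ ?_
  · rw [lintegral_add_right_eq_self (fun x => ‖p x‖ₑ) h, two_mul]
    exact le_self_add
  · calc _ ≤ eLpNorm (fun x => 2 * (polyWeight (x + h) * ‖p (x + h)‖ₑ)) 2 volume := by
          refine eLpNorm_mono_enorm fun x => ?_
          simp only [enorm_eq_self]
          rw [← mul_assoc]
          gcongr
          exact polyWeight_le_two_mul hh x
      _ = 2 * eLpNorm (fun x => polyWeight (x + h) * ‖p (x + h)‖ₑ) 2 volume :=
          eLpNorm_two_const_mul (by norm_num) _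
      _ = _ := by
          congr 1
          exact eLpNorm_comp_measurePreserving
            (aestronglyMeasurable_weight_mul isWeight_polyWeight hp)
            (measurePreserving_add_right volume h)

theorem InBall.translate {R : ℝ≥0} (hq : InBall polyWeight R q) {h : ℝ} (hh : |h| ≤ 1) :
    InBall polyWeight (2 * R) fun x => q (x + h) :=
  ⟨hq.meas.comp_measurePreserving (measurePreserving_add_right volume h),
    (strongNorm_translate_le hq.meas hh).trans (by push_cast; gcongr; exact hq.le)⟩

/-- If the increments `e^{2ihx} f - f` are of order `h` in `L²`, then `x f ∈ L²`: Fatou's lemma for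
the difference quotients, which converge to `2 i x f`. -/
theorem eLpNorm_mulX_le {B : ℝ≥0∞} (hf : Continuous f)
    (hb : ∀ h : ℝ, 0 < h → h ≤ 1 → eLpNorm (modulate h f - f) 2 volume ≤ ENNReal.ofReal h * B) :
    eLpNorm (mulX f) 2 volume ≤ B := by
  set h : ℕ → ℝ := fun n => 1 / ((n : ℝ) + 1)
  have hpos : ∀ n, 0 < h n := fun n => by positivity
  have hle : ∀ n, h n ≤ 1 := fun n => by
    rw [div_le_one (by positivity)]
    linarith [(Nat.cast_nonneg n : (0 : ℝ) ≤ n)]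
  have hlim : Tendsto h atTop (𝓝[≠] 0) := tendsto_nhdsWithin_iff.2
    ⟨tendsto_one_div_add_atTop_nhds_zero_nat, Eventually.of_forall fun n => (hpos n).ne'⟩
  have hlim' : ∀ x, Tendsto (fun n => (h n)⁻¹ • (modulate (h n) f - f) x) atTop
      (𝓝 (2 * Complex.I * mulX f x)) := fun x => by
    have h1 : HasDerivAt (fun t : ℝ => Complex.exp (2 * Complex.I * (t * x : ℝ)))
        (2 * Complex.I * x) 0 := by
      have h2 : HasDerivAt (fun t : ℝ => 2 * Complex.I * (t * x : ℝ)) (2 * Complex.I * x) 0 := by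
        have := ((hasDerivAt_id (0 : ℝ)).mul_const x).ofReal_comp.const_mul (2 * Complex.I)
        simpa using this
      simpa using h2.cexp
    have h2 := (h1.tendsto_slope_zero.comp hlim).mul_const (f x)
    rw [show 2 * Complex.I * mulX f x = 2 * Complex.I * x * f x by rw [mulX]; ring]
    refine h2.congr fun n => ?_
    simp [modulate]
    ring
  have hmeas : ∀ n, AEStronglyMeasurable (fun x => (h n)⁻¹ • (modulate (h n) f - f) x) volume :=
    fun n => ((((continuous_exp_two_I_mul (h n)).mul hf).sub hf).const_smul
      (h n)⁻¹).aestronglyMeasurable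
  have hF := Lp.eLpNorm_lim_le_liminf_eLpNorm (p := 2) hmeas _ (Eventually.of_forall hlim')
  have hF' : eLpNorm (fun x => 2 * Complex.I * mulX f x) 2 volume ≤ B := by
    refine hF.trans ((liminf_le_liminf (Eventually.of_forall fun n =>
      eLpNorm_inv_smul_le (hpos n) (hb _ (hpos n) (hle n)))).trans_eq (liminf_const B))
  refine le_trans (eLpNorm_mono fun x => ?_) hF'
  rw [norm_mul, norm_mul, Complex.norm_I, mul_one, Complex.norm_ofNat]
  linarith [norm_nonneg (mulX f x)]

/-- The `L²` norm of `l (r(q) - r(q'))` is controlled by `q - q'` and its weak derivative: the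
increment by `h` of its modulation is a second difference over `q(· + h)`, `q`, `q'(· + h)`, `q'`. -/
theorem exists_eLpNorm_mulX_wronR_sub_le (R : ℝ≥0) : ∃ C : ℝ≥0, ∀ q q' g g',
    InBall polyWeight R q → InBall polyWeight R q' → MemLp q 2 → MemLp q' 2 →
    IsWeakDeriv q g → IsWeakDeriv q' g' → eLpNorm g 2 volume ≤ R → eLpNorm g' 2 volume ≤ R →
      eLpNorm (mulX (wronR q - wronR q')) 2 volume
        ≤ C * (eLpNorm (g - g') 2 volume + strongNorm polyWeight (q - q')) := by
  obtain ⟨C, hC⟩ := (regular_wronR isWeight_polyWeight).four (2 * R)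
  refine ⟨C * (1 + weightConst) * (1 + 6 * R),
    fun q q' g g' hq hq' m m' d d' hg hg' => ?_⟩
  set S := strongNorm polyWeight (q - q')
  set G := eLpNorm (g - g') 2 volume
  have hcont : Continuous (wronR q - wronR q') :=
    ((regular_wronR isWeight_polyWeight).cont q hq.integrable).sub
      ((regular_wronR isWeight_polyWeight).cont q' hq'.integrable)
  refine eLpNorm_mulX_le hcont fun h h0 h1 => ?_
  have hh : |h| ≤ 1 := by rwa [abs_of_pos h0]
  have hball : ∀ {q}, InBall polyWeight R q → InBall polyWeight (2 * R) q := fun hq =>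
    ⟨hq.meas, hq.le.trans (by
      rw [ENNReal.coe_le_coe, two_mul]
      exact le_self_add)⟩
  have hf : modulate h (wronR q - wronR q') - (wronR q - wronR q')
      = wronR (fun x => q (x + h)) - wronR q - (wronR (fun x => q' (x + h)) - wronR q') := by
    funext l
    simp only [Pi.sub_apply, wronR_translate hq.integrable, wronR_translate hq'.integrable,
      modulate, mul_comm l h]
    ring
  rw [hf]
  refine (hC _ _ _ _ (hq.translate hh) (hball hq) (hq'.translate hh) (hball hq')).trans ?_
  have hweak : ∀ {p k : ℝ → ℂ}, MemLp p 2 → IsWeakDeriv p k →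
      weakNorm polyWeight ((fun x => p (x + h)) - p)
        ≤ (1 + weightConst : ℝ≥0) * (ENNReal.ofReal h * eLpNorm k 2 volume) := fun {p k} hp hk =>
    (weakNorm_polyWeight_le ((memLp_translate hp h).sub hp).1).trans (by
      gcongr
      exact hk.eLpNorm_translate_sub_le hp h0.le)
  have e1 : (fun x => q (x + h)) - q - ((fun x => q' (x + h)) - q')
      = (fun x => (q - q') (x + h)) - (q - q') := by
    funext x
    simp only [Pi.sub_apply]
    ring
  have e2 : strongNorm polyWeight ((fun x => q (x + h)) - fun x => q' (x + h)) ≤ 2 * S :=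
    strongNorm_translate_le (p := q - q') (hq.meas.sub hq'.meas) hh
  have k1 := hweak (m.sub m') (d.sub d')
  have k2 : weakNorm polyWeight ((fun x => q (x + h)) - q)
      ≤ (1 + weightConst : ℝ≥0) * (ENNReal.ofReal h * R) :=
    (hweak m d).trans (by gcongr)
  have k3 : weakNorm polyWeight ((fun x => q' (x + h)) - q')
      ≤ (1 + weightConst : ℝ≥0) * (ENNReal.ofReal h * R) :=
    (hweak m' d').trans (by gcongr)
  rw [fourNorm, e1]
  calc _ ≤ (C : ℝ≥0∞) * ((1 + weightConst : ℝ≥0) * (ENNReal.ofReal h * G)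
        + ((1 + weightConst : ℝ≥0) * (ENNReal.ofReal h * R)
          + (1 + weightConst : ℝ≥0) * (ENNReal.ofReal h * R)) * (2 * S + S)) := by gcongr
    _ = ENNReal.ofReal h * (C * (1 + weightConst : ℝ≥0) * (G + 6 * R * S)) := by ring
    _ ≤ ENNReal.ofReal h * (C * (1 + weightConst : ℝ≥0) * ((1 + 6 * R) * (G + S))) := by
        gcongr
        calc G + 6 * R * S ≤ G + 6 * R * S + (6 * R * G + S) := le_self_add
          _ = _ := by ring
    _ = _ := by push_cast; ring

end Decay

/-! ### Mapping properties of the direct scattering map -/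

section Mapping

variable {q q' : ℝ → ℂ}

theorem normH01_ne_top (hq : q ∈ H01) : normH01 q ≠ ⊤ :=
  ne_top_of_le_ne_top (ENNReal.add_ne_top.2 ⟨hq.1.2.ne, hq.2.2.ne⟩) (normH01_le_add q)

theorem H01.exists_inBall (hq : q ∈ H01) : ∃ R, InBall polyWeight R q :=
  ⟨_, H01.inBall hq (R := (normH01 q).toNNReal) (by rw [ENNReal.coe_toNNReal (normH01_ne_top hq)])⟩

theorem integrable_of_mem_H01 (hq : q ∈ H01) : Integrable q :=
  let ⟨_, h⟩ := H01.exists_inBall hq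
  h.integrable

theorem mem_H01_of_mem_H11 (hq : q ∈ H11) : q ∈ H01 := ⟨hq.1, hq.2.2⟩

theorem isWeakDeriv_of_mem_H11 (hq : q ∈ H11) :
    IsWeakDeriv q (weakDeriv q) ∧ MemLp (weakDeriv q) 2 := by
  obtain ⟨g, hg, hg2⟩ := hq.2.1
  exact ⟨hg.weakDeriv, hg2.ae_eq (hg.ae_eq hg.weakDeriv)⟩

theorem weakDeriv_sub_ae_eq {g : ℝ → ℂ} (hq : ∃ k, IsWeakDeriv q k) (hq' : ∃ k, IsWeakDeriv q' k)
    (h : IsWeakDeriv (q - q') g) : weakDeriv q - weakDeriv q' =ᵐ[volume] g := by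
  obtain ⟨k, hk⟩ := hq
  obtain ⟨k', hk'⟩ := hq'
  exact (hk.weakDeriv.sub hk'.weakDeriv).ae_eq h

theorem locallyLipschitzMap_L1 :
    LocallyLipschitzMap L1 (normL 1) {r | MemLp r ⊤} (normL ⊤) reflection := by
  have hint : ∀ {q}, q ∈ L1 → Integrable q := memLp_one_iff_integrable.1
  refine ⟨fun q hq => ?_, fun ρ => ?_⟩
  · rw [reflection_eq_wronR (hint hq)]
    refine memLp_top_of_bound
      ((regular_wronR isWeight_one).cont q (hint hq)).aestronglyMeasurable 1
      (Eventually.of_forall fun l => ?_)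
    rw [← reflection_eq_wronR (hint hq)]
    exact (norm_reflection_lt_one (hint hq) l).le
  · obtain ⟨C, hC⟩ := (regular_wronR isWeight_one).lipSup ρ
    refine ⟨C, fun q hq q' hq' hρ hρ' => ?_⟩
    rw [reflection_eq_wronR (hint hq), reflection_eq_wronR (hint hq')]
    simp only [normL, eLpNorm_one_eq_lintegral_enorm, eLpNorm_exponent_top] at hρ hρ' ⊢
    exact eLpNormEssSup_le_of_ae_enorm_bound (Eventually.of_forall fun l =>
      hC q q' (hint hq) (hint hq') hρ hρ' l)

theorem strongNorm_one (q : ℝ → ℂ) : strongNorm (fun _ => 1) q = normL1L2 q := by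
  simp only [strongNorm, normL1L2, normL, eLpNorm_one_eq_lintegral_enorm, one_mul, eLpNorm_enorm]

theorem inBall_one {R : ℝ≥0} (hq : q ∈ L1L2) (hR : normL1L2 q ≤ R) : InBall (fun _ => 1) R q :=
  ⟨hq.1.1, (strongNorm_one q).trans_le hR⟩

theorem locallyLipschitzMap_L1L2 :
    LocallyLipschitzMap L1L2 normL1L2 {r | MemLp r 2} (normL 2) reflection := by
  have hint : ∀ {q}, q ∈ L1L2 → Integrable q := fun hq => memLp_one_iff_integrable.1 hq.1
  refine ⟨fun q hq => ?_, fun ρ => ?_⟩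
  · rw [reflection_eq_wronR (hint hq)]
    have hfin : normL1L2 q ≠ ⊤ := ENNReal.add_ne_top.2 ⟨hq.1.2.ne, hq.2.2.ne⟩
    exact memLp_wronR isWeight_one
      (inBall_one hq (R := (normL1L2 q).toNNReal) (by rw [ENNReal.coe_toNNReal hfin]))
  · obtain ⟨C, hC⟩ := (regular_wronR isWeight_one).lip ρ
    refine ⟨C, fun q hq q' hq' hρ hρ' => ?_⟩
    rw [reflection_eq_wronR (hint hq), reflection_eq_wronR (hint hq')]
    refine (hC q q' (inBall_one hq hρ) (inBall_one hq' hρ')).trans ?_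
    gcongr
    exact (weakNorm_le_strongNorm isWeight_one _).trans_eq (strongNorm_one _)

theorem exists_isWeakDeriv_reflection (hq : q ∈ H01) :
    ∃ g, IsWeakDeriv (reflection q) g ∧ MemLp g 2 := by
  obtain ⟨R, hR⟩ := H01.exists_inBall hq
  obtain ⟨C, hC⟩ := exists_isWeakDeriv_wronR_sub R
  obtain ⟨g, hg, hg2, -⟩ := hC q 0 hR (inBall_zero _ _)
  rw [wronR_zero, sub_zero, ← reflection_eq_wronR hR.integrable] at hg
  exact ⟨g, hg, hg2⟩

theorem locallyLipschitzMap_weakDeriv :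
    LocallyLipschitzMap H01 normH01 {g | MemLp g 2} (normL 2)
      (fun q => weakDeriv (reflection q)) := by
  refine ⟨fun q hq => ?_, fun ρ => ?_⟩
  · obtain ⟨g, hg, hg2⟩ := exists_isWeakDeriv_reflection hq
    exact hg2.ae_eq (hg.ae_eq hg.weakDeriv)
  · obtain ⟨C, hC⟩ := exists_isWeakDeriv_wronR_sub (2 * (1 + weightConst) * ρ)
    refine ⟨C * (2 * (1 + weightConst)), fun q hq q' hq' hρ hρ' => ?_⟩
    obtain ⟨g, hg, -, hle⟩ := hC q q' (H01.inBall hq hρ) (H01.inBall hq' hρ')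
    rw [← reflection_eq_wronR (integrable_of_mem_H01 hq),
      ← reflection_eq_wronR (integrable_of_mem_H01 hq')] at hg
    obtain ⟨k, hk, -⟩ := exists_isWeakDeriv_reflection hq
    obtain ⟨k', hk', -⟩ := exists_isWeakDeriv_reflection hq'
    rw [normL, eLpNorm_congr_ae (weakDeriv_sub_ae_eq ⟨k, hk⟩ ⟨k', hk'⟩ hg)]
    refine hle.trans ?_
    rw [ENNReal.coe_mul C, mul_assoc]
    gcongr
    exact H01.strongNorm_sub_le hq hq'

theorem memLp_reflection (hq : q ∈ H01) : MemLp (reflection q) 2 := by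
  obtain ⟨R, hR⟩ := H01.exists_inBall hq
  rw [reflection_eq_wronR hR.integrable]
  exact memLp_wronR isWeight_polyWeight hR

theorem exists_normL_two_reflection_sub_le (ρ : ℝ≥0) : ∃ C : ℝ≥0, ∀ q ∈ H01, ∀ q' ∈ H01,
    normH01 q ≤ ρ → normH01 q' ≤ ρ →
      normL 2 (reflection q - reflection q') ≤ C * normH01 (q - q') := by
  obtain ⟨C, hC⟩ := (regular_wronR isWeight_polyWeight).lip (2 * (1 + weightConst) * ρ)
  refine ⟨C * (2 * (1 + weightConst)), fun q hq q' hq' hρ hρ' => ?_⟩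
  rw [reflection_eq_wronR (integrable_of_mem_H01 hq),
    reflection_eq_wronR (integrable_of_mem_H01 hq'), ENNReal.coe_mul C, mul_assoc]
  refine (hC q q' (H01.inBall hq hρ) (H01.inBall hq' hρ')).trans ?_
  gcongr
  exact (weakNorm_le_strongNorm isWeight_polyWeight _).trans (H01.strongNorm_sub_le hq hq')

theorem zero_mem_H11 : (0 : ℝ → ℂ) ∈ H11 := by
  refine ⟨MemLp.zero, ⟨0, ⟨locallyIntegrable_zero, locallyIntegrable_zero, fun φ _ _ => by simp⟩,
    MemLp.zero⟩, ?_⟩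
  rw [show mulX 0 = 0 by funext x; simp [mulX]]
  exact MemLp.zero

theorem exists_normL_two_mulX_reflection_sub_le (ρ : ℝ≥0) : ∃ C : ℝ≥0, ∀ q ∈ H11, ∀ q' ∈ H11,
    normH11 q ≤ ρ → normH11 q' ≤ ρ →
      normL 2 (mulX (reflection q - reflection q')) ≤ C * normH11 (q - q') := by
  obtain ⟨C, hC⟩ := exists_eLpNorm_mulX_wronR_sub_le (ρ + 2 * (1 + weightConst) * ρ)
  refine ⟨C * (1 + 2 * (1 + weightConst)), fun q hq q' hq' hρ hρ' => ?_⟩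
  have hball : ∀ {q}, q ∈ H11 → normH11 q ≤ ρ →
      InBall polyWeight (ρ + 2 * (1 + weightConst) * ρ) q := fun hq hρ => by
    have := H01.inBall (mem_H01_of_mem_H11 hq) ((normH01_le_normH11 _).trans hρ)
    exact ⟨this.meas, this.le.trans (ENNReal.coe_le_coe.2 le_add_self)⟩
  have hder : ∀ {q}, q ∈ H11 → normH11 q ≤ ρ → eLpNorm (weakDeriv q) 2 volume
      ≤ (ρ + 2 * (1 + weightConst) * ρ : ℝ≥0) := fun hq hρ =>
    ((normL_two_weakDeriv_le_normH11 _).trans hρ).trans (ENNReal.coe_le_coe.2 le_self_add)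
  have d := isWeakDeriv_of_mem_H11 hq
  have d' := isWeakDeriv_of_mem_H11 hq'
  rw [reflection_eq_wronR (integrable_of_mem_H01 (mem_H01_of_mem_H11 hq)),
    reflection_eq_wronR (integrable_of_mem_H01 (mem_H01_of_mem_H11 hq'))]
  refine (hC q q' _ _ (hball hq hρ) (hball hq' hρ') hq.1 hq'.1 d.1 d'.1 (hder hq hρ)
    (hder hq' hρ')).trans ?_
  rw [ENNReal.coe_mul C, mul_assoc, ENNReal.coe_add, ENNReal.coe_one, add_mul, one_mul]
  gcongr
  · have hs := d.1.sub d'.1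
    rw [eLpNorm_congr_ae (hs.ae_eq hs.weakDeriv)]
    exact normL_two_weakDeriv_le_normH11 _
  · refine (H01.strongNorm_sub_le (mem_H01_of_mem_H11 hq) (mem_H01_of_mem_H11 hq')).trans ?_
    gcongr
    exact normH01_le_normH11 _

theorem normH11_ne_top (hq : q ∈ H11) : normH11 q ≠ ⊤ :=
  ne_top_of_le_ne_top (ENNReal.add_ne_top.2 ⟨ENNReal.add_ne_top.2
    ⟨hq.1.2.ne, (isWeakDeriv_of_mem_H11 hq).2.2.ne⟩, hq.2.2.2.ne⟩) (normH11_le_add q)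

theorem reflection_zero : reflection 0 = 0 := by
  rw [reflection_eq_wronR (integrable_zero _ _ _), wronR_zero]

theorem memLp_mulX_reflection (hq : q ∈ H11) : MemLp (mulX (reflection q)) 2 := by
  have hc := (regular_wronR isWeight_one).cont q (integrable_of_mem_H01 (mem_H01_of_mem_H11 hq))
  rw [← reflection_eq_wronR (integrable_of_mem_H01 (mem_H01_of_mem_H11 hq))] at hc
  refine ⟨(Complex.continuous_ofReal.mul hc).aestronglyMeasurable, ?_⟩
  have hfin := normH11_ne_top hq
  have hfin0 := normH11_ne_top zero_mem_H11
  obtain ⟨C, hC⟩ := exists_normL_two_mulX_reflection_sub_le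
    ((normH11 q).toNNReal + (normH11 0).toNNReal)
  have := hC q hq 0 zero_mem_H11
    (by rw [ENNReal.coe_add, ENNReal.coe_toNNReal hfin]; exact le_self_add)
    (by rw [ENNReal.coe_add, ENNReal.coe_toNNReal hfin0]; exact le_add_self)
  rw [reflection_zero, sub_zero, sub_zero] at this
  exact this.trans_lt (ENNReal.mul_lt_top ENNReal.coe_lt_top hfin.lt_top)

theorem reflection_mem_H11 (hq : q ∈ H11) : reflection q ∈ H11 :=
  ⟨memLp_reflection (mem_H01_of_mem_H11 hq),
    exists_isWeakDeriv_reflection (mem_H01_of_mem_H11 hq), memLp_mulX_reflection hq⟩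

/-- The supremum of `|r|` stays below `1` because `|r|² = 1 - 1 / |a|²` with `a` bounded. -/
theorem eLpNorm_top_reflection_lt_one (hq : Integrable q) : eLpNorm (reflection q) ⊤ volume < 1 := by
  obtain ⟨C, hC⟩ := (regular_wronA isWeight_one).bdd (∫⁻ y, ‖q y‖ₑ).toNNReal
  have hA : ∀ l, ‖wronA q l‖ ≤ C := fun l => by
    have := hC q hq (by rw [ENNReal.coe_toNNReal hq.hasFiniteIntegral.ne]) l
    rwa [← ofReal_norm, ENNReal.ofReal_le_coe] at this
  have hC1 : (1 : ℝ) ≤ C := (one_le_norm_wronA hq 0).trans (hA 0)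
  have hr : ∀ l, ‖reflection q l‖ ≤ Real.sqrt (1 - ((C : ℝ) ^ 2)⁻¹) := fun l => by
    refine Real.le_sqrt_of_sq_le ?_
    rw [sq_norm_reflection hq]
    have h1 := one_le_norm_wronA hq l
    have := hA l
    gcongr
  rw [eLpNorm_exponent_top]
  refine (eLpNormEssSup_le_of_ae_bound (Eventually.of_forall hr)).trans_lt ?_
  rw [ENNReal.ofReal_lt_one, Real.sqrt_lt' one_pos, one_pow]
  have : 0 < ((C : ℝ) ^ 2)⁻¹ := by positivity
  linarith

theorem locallyLipschitzMap_H01 :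
    LocallyLipschitzMap H11 normH11 H01 normH01 reflection := by
  refine ⟨fun q hq => mem_H01_of_mem_H11 (reflection_mem_H11 hq), fun ρ => ?_⟩
  obtain ⟨C₁, h₁⟩ := exists_normL_two_reflection_sub_le ρ
  obtain ⟨C₂, h₂⟩ := exists_normL_two_mulX_reflection_sub_le ρ
  refine ⟨C₁ + C₂, fun q hq q' hq' hρ hρ' => (normH01_le_add _).trans ?_⟩
  rw [ENNReal.coe_add, add_mul]
  refine add_le_add ((h₁ q (mem_H01_of_mem_H11 hq) q' (mem_H01_of_mem_H11 hq')
    ((normH01_le_normH11 q).trans hρ) ((normH01_le_normH11 q').trans hρ')).trans ?_)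
    (h₂ q hq q' hq' hρ hρ')
  gcongr
  exact normH01_le_normH11 _

theorem locallyLipschitzMap_H11One :
    LocallyLipschitzMap H11 normH11 H11One normH11 reflection := by
  refine ⟨fun q hq => ⟨reflection_mem_H11 hq,
    eLpNorm_top_reflection_lt_one (integrable_of_mem_H01 (mem_H01_of_mem_H11 hq))⟩, fun ρ => ?_⟩
  obtain ⟨C₁, h₁⟩ := locallyLipschitzMap_H01.2 ρ
  obtain ⟨C₂, h₂⟩ := locallyLipschitzMap_weakDeriv.2 ρ
  refine ⟨C₁ + C₂ + C₁, fun q hq q' hq' hρ hρ' => (normH11_le_add _).trans ?_⟩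
  rw [ENNReal.coe_add, ENNReal.coe_add, add_mul, add_mul]
  have hle := h₁ q hq q' hq' hρ hρ'
  refine add_le_add (add_le_add ((normL_two_le_normH01 _).trans hle) ?_)
    ((normL_two_mulX_le_normH01 _).trans hle)
  obtain ⟨k, hk, -⟩ := exists_isWeakDeriv_reflection (mem_H01_of_mem_H11 hq)
  obtain ⟨k', hk', -⟩ := exists_isWeakDeriv_reflection (mem_H01_of_mem_H11 hq')
  rw [normL, ← eLpNorm_congr_ae (weakDeriv_sub_ae_eq ⟨k, hk⟩ ⟨k', hk'⟩
    (hk.sub hk').weakDeriv)]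
  refine (h₂ q (mem_H01_of_mem_H11 hq) q' (mem_H01_of_mem_H11 hq')
    ((normH01_le_normH11 q).trans hρ) ((normH01_le_normH11 q').trans hρ')).trans ?_
  gcongr
  exact normH01_le_normH11 _

theorem scattering_data {q : ℝ → ℂ} (hq : Integrable q) (lam : ℝ) :
    (∃! psi, IsJost atTop q lam psi) ∧ (∃! psi, IsJost atBot q lam psi) ∧
      (∃! T, IsTransition q lam T) ∧
      transition q lam = !![coeffA q lam, star (coeffB q lam);
        coeffB q lam, star (coeffA q lam)] ∧
      ‖coeffA q lam‖ ^ 2 - ‖coeffB q lam‖ ^ 2 = 1 ∧ ‖reflection q lam‖ < 1 := by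
  refine ⟨(isNormalized_jostVec hq lam).existsUnique, (isNormalized_jostVecLeft hq lam).existsUnique,
    existsUnique_isTransition hq lam, ?_, ?_, norm_reflection_lt_one hq lam⟩
  · rw [coeffA_eq hq, coeffB_eq hq, transition_eq hq, pairMatrix]
  · rw [coeffA_eq hq, coeffB_eq hq]
    exact sq_norm_wronA_sub hq lam

end Mapping

end ZSAKNS

theorem mainTheorem2 :
    -- the scattering data are well defined for integrable potentials
    (∀ q : ℝ → ℂ, q ∈ ZSAKNS.L1 → ∀ lam : ℝ,
      (∃! psi, ZSAKNS.IsJost atTop q lam psi) ∧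
      (∃! psi, ZSAKNS.IsJost atBot q lam psi) ∧
      (∃! T, ZSAKNS.IsTransition q lam T) ∧
      ZSAKNS.transition q lam =
        !![ZSAKNS.coeffA q lam, star (ZSAKNS.coeffB q lam);
           ZSAKNS.coeffB q lam, star (ZSAKNS.coeffA q lam)] ∧
      ‖ZSAKNS.coeffA q lam‖ ^ 2 - ‖ZSAKNS.coeffB q lam‖ ^ 2 = 1 ∧
      ‖ZSAKNS.reflection q lam‖ < 1) ∧
    -- `H^{1,1} → H^{1,1}_1`
    ZSAKNS.LocallyLipschitzMap ZSAKNS.H11 ZSAKNS.normH11 ZSAKNS.H11One ZSAKNS.normH11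
      ZSAKNS.reflection ∧
    -- `L¹ → L^∞`
    ZSAKNS.LocallyLipschitzMap ZSAKNS.L1 (ZSAKNS.normL 1) {r | MemLp r ∞} (ZSAKNS.normL ∞)
      ZSAKNS.reflection ∧
    -- `L¹ ∩ L² → L²`
    ZSAKNS.LocallyLipschitzMap ZSAKNS.L1L2 ZSAKNS.normL1L2 {r | MemLp r 2} (ZSAKNS.normL 2)
      ZSAKNS.reflection ∧
    -- `H^{1,1} → H^{0,1}`
    ZSAKNS.LocallyLipschitzMap ZSAKNS.H11 ZSAKNS.normH11 ZSAKNS.H01 ZSAKNS.normH01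
      ZSAKNS.reflection ∧
    -- `q ↦ r'`, from `H^{0,1}` to `L²`
    (∀ q ∈ ZSAKNS.H01, ∃ g, ZSAKNS.IsWeakDeriv (ZSAKNS.reflection q) g) ∧
    ZSAKNS.LocallyLipschitzMap ZSAKNS.H01 ZSAKNS.normH01 {g | MemLp g 2} (ZSAKNS.normL 2)
      (fun q => ZSAKNS.weakDeriv (ZSAKNS.reflection q)) :=
  ⟨fun _ hq lam => ZSAKNS.scattering_data (memLp_one_iff_integrable.1 hq) lam,
    ZSAKNS.locallyLipschitzMap_H11One, ZSAKNS.locallyLipschitzMap_L1,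
    ZSAKNS.locallyLipschitzMap_L1L2, ZSAKNS.locallyLipschitzMap_H01,
    fun _ hq => (ZSAKNS.exists_isWeakDeriv_reflection hq).imp fun _ h => h.1,
    ZSAKNS.locallyLipschitzMap_weakDeriv⟩
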